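/- Let $1<\alpha\le 2$, $x_r,T>0$, and let $a:\mathbb R\to\mathbb R$ satisfy $0<a_0\le a(x)\le a_1$ for $x\in(0,x_r)$. For $n-1\le\alpha<n$, $n\in\mathbb N$, and $\kappa_\alpha=\frac{1}{2\cos(\alpha\pi/2)}$, let $$\frac{\partial^\alpha v}{\partial|x|^\alpha}(x)=-\frac{\kappa_\alpha}{\Gamma(n-\alpha)}\frac{d^n}{dx^n}\Big[\int_0^x (x-\xi)^{n-\alpha-1}v(\xi)\,d\xi+(-1)^n\int_x^{x_r}(\xi-x)^{n-\alpha-1}v(\xi)\,d\xi\Big]$$ be the Riesz derivative on $(0,x_r)$. Let $u$ be a solution of $$u_{tt}(x,t)=a(x)\frac{\partial^\alpha u(x,t)}{\partial|x|^\alpha}+f(x,t),\qquad 0<x<x_r,\ 0\le t\le T,$$ with $u(x,0)=\varphi(x)$, $u_t(x,0)=\psi(x)$ for $0<x<x_r$ and $u(0,t)=u(x_r,t)=0$ for $0\le t\le T$, which is of class $C^4$ on $[0,x_r]\times[0,T]$ and, if $\alpha<2$, whose extension by zero to $x\notin[0,x_r]$ is of class $C^4$ on $\mathbb R\times[0,T]$.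 For integers $N_x,N_t\ge 1$ put $h=x_r/N_x$, $\tau=T/N_t$, $x_i=ih$, $t_k=k\tau$, $a_i=a(x_i)$, $f_i^k=f(x_i,t_k)$. Let $g_0^\alpha=1$, $g_m^\alpha=(1-\frac{\alpha+1}{m})g_{m-1}^\alpha$, $\phi_0^\alpha=\frac{\alpha}{2}g_0^\alpha$, $\phi_m^\alpha=\frac{\alpha}{2}g_m^\alpha+\frac{2-\alpha}{2}g_{m-1}^\alpha$ $(m\ge1)$ and, for grid functions $v=(v_0,\dots,v_{N_x})$, $$\nabla_h^\alpha v_i=-\frac{\kappa_\alpha}{h^\alpha}\Big[\sum_{m=0}^{i+1}\phi_m^\alpha v_{i-m+1}+\sum_{m=0}^{N_x-i+1}\phi_m^\alpha v_{i+m-1}\Big],\qquad 1\le i\le N_x-1 .$$ For $\frac14\le\theta\le1$ let $u_i^k$ $(0\le i\le N_x,\ 0\le k\le N_t)$ solve the weighted scheme $$\frac{u_i^{k+1}-2u_i^k+u_i^{k-1}}{\tau^2}=\theta a_i\nabla_h^\alpha u_i^{k+1}+(1-2\theta)a_i\nabla_h^\alpha u_i^k+\theta a_i\nabla_h^\alpha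 u_i^{k-1}+f_i^k,\quad 1\le i\le N_x-1,\ 1\le k\le N_t-1,$$ with $u_0^k=u_{N_x}^k=0$ for $0\le k\le N_t$ and, for $1\le i\le N_x-1$, $u_i^0=\varphi(x_i)$ and $$u_i^1=\varphi(x_i)+\tau\psi(x_i)+\tfrac{\tau^2}{2}\big[a_i\nabla_h^\alpha u_i^0+f_i^0\big].$$ On grid functions vanishing at $x_0$ and $x_{N_x}$ the operator $-\nabla_h^\alpha$ is a symmetric matrix of size $N_x-1$. This matrix has a symmetric positive definite square root $\Lambda_h^\alpha$, that is, $-\nabla_h^\alpha=\Lambda_h^\alpha\Lambda_h^\alpha$. Put $e_i^k=u(x_i,t_k)-u_i^k$, $\|v\|^2=h\sum_{i=1}^{N_x-1}v_i^2$ and, for $0\le k\le N_t-1$, $$E^k=\Big\|\frac{e^{k+1}-e^k}{\tau}\Big\|^2+\frac14\big\|\sqrt a\,(\Lambda_h^\alpha e^{k+1}+\Lambda_h^\alpha e^k)\big\|^2+\frac14(4\theta-1)\big\|\sqrt a\,(\Lambda_h^\alpha e^{k+1}-\Lambda_h^\alpha e^k)\big\|^2 .$$ Then $E^k=\mathcal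 O\big((\tau^2+h^2)^2\big)$: there is a constant $C$, independent of $\theta,N_x,N_t$ and $k$ (hence of $h$ and $\tau$), such that $$E^k\le C(\tau^2+h^2)^2\qquad\text{for all }N_x,N_t\ge1,\ \tfrac14\le\theta\le1,\ 0\le k\le N_t-1,$$ for every such grid solution $u_i^k$. -/

import Mathlib

noncomputable section

namespace RieszWave

open Set

/-- The left Riemann-Liouville derivative of order `α` on `(0, xr)`, with `n = ⌊α⌋ + 1`, that is
`n - 1 ≤ α < n`. -/
def leftRL (α : ℝ) (v : ℝ → ℝ) (x : ℝ) : ℝ :=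
  (1 / Real.Gamma (((⌊α⌋₊ + 1 : ℕ) : ℝ) - α)) *
    iteratedDeriv (⌊α⌋₊ + 1)
      (fun y => ∫ ξ in (0 : ℝ)..y, (y - ξ) ^ (((⌊α⌋₊ + 1 : ℕ) : ℝ) - α - 1) * v ξ) x

/-- The right Riemann-Liouville derivative of order `α` on `(0, xr)`, with `n = ⌊α⌋ + 1`. -/
def rightRL (α xr : ℝ) (v : ℝ → ℝ) (x : ℝ) : ℝ :=
  ((-1) ^ (⌊α⌋₊ + 1) / Real.Gamma (((⌊α⌋₊ + 1 : ℕ) : ℝ) - α)) *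
    iteratedDeriv (⌊α⌋₊ + 1)
      (fun y => ∫ ξ in y..xr, (ξ - y) ^ (((⌊α⌋₊ + 1 : ℕ) : ℝ) - α - 1) * v ξ) x

/-- The constant `κ_α = 1 / (2 cos (α π / 2))`. -/
def kappa (α : ℝ) : ℝ := 1 / (2 * Real.cos (α * Real.pi / 2))

/-- The Riesz derivative `∂^α v / ∂|x|^α` on `(0, xr)`. -/
def rieszDeriv (α xr : ℝ) (v : ℝ → ℝ) (x : ℝ) : ℝ :=
  -kappa α * (leftRL α v x + rightRL α xr v x)

/-- The extension of `u`, given on `[0, xr]` in the first variable, by zero. -/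
def zeroExt (xr : ℝ) (u : ℝ → ℝ → ℝ) (p : ℝ × ℝ) : ℝ :=
  open Classical in if p.1 ∈ Icc 0 xr then u p.1 p.2 else 0

/-- `u` is a classical solution, of class `C⁴`, of
`u_tt = a(x) ∂^α u / ∂|x|^α + f` in `(0, xr) × [0, T]`, with `u(x, 0) = φ(x)`, `u_t(x, 0) = ψ(x)`
and zero Dirichlet boundary values. For `α < 2` the derivative is nonlocal, and `u` is required to
be of class `C⁴` across the end points when it is continued by zero. -/
structure IsSolution (α xr T : ℝ) (a : ℝ → ℝ) (f : ℝ → ℝ → ℝ) (φ ψ : ℝ → ℝ)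
    (u : ℝ → ℝ → ℝ) : Prop where
  smooth : ContDiffOn ℝ 4 (fun p : ℝ × ℝ => u p.1 p.2) (Icc 0 xr ×ˢ Icc 0 T)
  smooth_zeroExt : α < 2 → ContDiffOn ℝ 4 (zeroExt xr u) (univ ×ˢ Icc 0 T)
  pde : ∀ x ∈ Ioo 0 xr, ∀ t ∈ Icc 0 T,
    iteratedDerivWithin 2 (fun s => u x s) (Icc 0 T) t =
      a x * rieszDeriv α xr (fun y => u y t) x + f x t
  init : ∀ x ∈ Ioo 0 xr, u x 0 = φ x
  init_deriv : ∀ x ∈ Ioo 0 xr, derivWithin (fun s => u x s) (Icc 0 T) 0 = ψ x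
  dirichlet : ∀ t ∈ Icc 0 T, u 0 t = 0 ∧ u xr t = 0

/-- `g_m^α = (-1)^m (α choose m)`. -/
def gCoeff (α : ℝ) : ℕ → ℝ
  | 0 => 1
  | m + 1 => (1 - (α + 1) / ((m : ℝ) + 1)) * gCoeff α m

/-- The weights `φ_m^α`. -/
def phiCoeff (α : ℝ) : ℕ → ℝ
  | 0 => α / 2 * gCoeff α 0
  | m + 1 => α / 2 * gCoeff α (m + 1) + (2 - α) / 2 * gCoeff α m

/-- `δ_{x,+}^α v_i = h^{-α} ∑_{m=0}^{i+1} φ_m v_{i-m+1}`. -/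
def deltaPlus (α h : ℝ) (v : ℕ → ℝ) (i : ℕ) : ℝ :=
  1 / h ^ α * ∑ m ∈ Finset.range (i + 2), phiCoeff α m * v (i + 1 - m)

/-- `δ_{x,-}^α v_i = h^{-α} ∑_{m=0}^{N-i+1} φ_m v_{i+m-1}`, for `1 ≤ i ≤ N - 1`. -/
def deltaMinus (α h : ℝ) (N : ℕ) (v : ℕ → ℝ) (i : ℕ) : ℝ :=
  1 / h ^ α * ∑ m ∈ Finset.range (N - i + 2), phiCoeff α m * v (i + m - 1)

/-- The discrete Riesz derivative `∇_h^α v_i`, for `1 ≤ i ≤ N - 1`, of a grid function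
`v_0, …, v_N`. -/
def nabla (α h : ℝ) (N : ℕ) (v : ℕ → ℝ) (i : ℕ) : ℝ :=
  -kappa α * (deltaPlus α h v i + deltaMinus α h N v i)

/-- The Toeplitz matrix `B_α`, of size `N - 1`. -/
def bMatrix (α : ℝ) (N : ℕ) : Matrix (Fin (N - 1)) (Fin (N - 1)) ℝ :=
  Matrix.of fun i j => if (i : ℕ) ≤ (j : ℕ) + 1 then phiCoeff α ((j : ℕ) + 1 - (i : ℕ)) else 0

/-- The matrix `-κ_α h^{-α} (B_α + B_αᵀ)` of `∇_h^α` on grid functions that vanish at the end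
points; the row and column `j` belong to the grid point `x_{j+1}`. -/
def nablaMatrix (α h : ℝ) (N : ℕ) : Matrix (Fin (N - 1)) (Fin (N - 1)) ℝ :=
  (-kappa α / h ^ α) • (bMatrix α N + (bMatrix α N).transpose)

/-- `Λ` is the symmetric positive definite square root of `-∇_h^α`. -/
def IsLambda (α h : ℝ) (N : ℕ) (Λ : Matrix (Fin (N - 1)) (Fin (N - 1)) ℝ) : Prop :=
  Λ.PosDef ∧ Λ * Λ = -nablaMatrix α h N

/-- The grid function `U k i = u_i^k`, `0 ≤ i ≤ Nx`, `0 ≤ k ≤ Nt`, on the grid `x_i = i h`,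
`t_k = k τ` with `h = xr / Nx` and `τ = T / Nt`, solves the weighted scheme with its starting step, the initial values and the zero
boundary values. -/
structure IsScheme (α θ : ℝ) (a : ℝ → ℝ) (f : ℝ → ℝ → ℝ) (φ ψ : ℝ → ℝ) (Nx Nt : ℕ)
    (h τ : ℝ) (U : ℕ → ℕ → ℝ) : Prop where
  boundary : ∀ k ≤ Nt, U k 0 = 0 ∧ U k Nx = 0
  init : ∀ i, 1 ≤ i → i < Nx → U 0 i = φ (i * h)
  start : ∀ i, 1 ≤ i → i < Nx →
    U 1 i = φ (i * h) + τ * ψ (i * h) +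
      τ ^ 2 / 2 * (a (i * h) * nabla α h Nx (U 0) i + f (i * h) 0)
  step : ∀ k, 1 ≤ k → k < Nt → ∀ i, 1 ≤ i → i < Nx →
    (U (k + 1) i - 2 * U k i + U (k - 1) i) / τ ^ 2 =
      θ * a (i * h) * nabla α h Nx (U (k + 1)) i +
      (1 - 2 * θ) * a (i * h) * nabla α h Nx (U k) i +
      θ * a (i * h) * nabla α h Nx (U (k - 1)) i + f (i * h) (k * τ)

/-- The vector `(v_1, …, v_{N-1})` of the interior values of a grid function. -/
def interiorVec (N : ℕ) (v : ℕ → ℝ) : Fin (N - 1) → ℝ := fun j => v ((j : ℕ) + 1)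

/-- The square `h ∑_{i=1}^{N-1} v_i²` of the discrete norm. -/
def normSq (h : ℝ) (N : ℕ) (v : Fin (N - 1) → ℝ) : ℝ := h * ∑ j, v j ^ 2

/-- Pointwise multiplication by `√a` at the interior grid points. -/
def sqrtMul (a : ℝ → ℝ) (h : ℝ) (N : ℕ) (v : Fin (N - 1) → ℝ) : Fin (N - 1) → ℝ :=
  fun j => Real.sqrt (a ((((j : ℕ) + 1 : ℕ) : ℝ) * h)) * v j

/-- The discrete energy `E^k` of a family `e^k` of grid functions:
`‖(e^{k+1} - e^k)/τ‖² + ¼ ‖√a (Λ e^{k+1} + Λ e^k)‖² + ¼ (4θ - 1) ‖√a (Λ e^{k+1} - Λ e^k)‖²`. -/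
def energy (θ : ℝ) (a : ℝ → ℝ) (h τ : ℝ) (N : ℕ)
    (Λ : Matrix (Fin (N - 1)) (Fin (N - 1)) ℝ) (e : ℕ → ℕ → ℝ) (k : ℕ) : ℝ :=
  normSq h N (interiorVec N fun i => (e (k + 1) i - e k i) / τ) +
  1 / 4 * normSq h N (sqrtMul a h N
    (Λ.mulVec (interiorVec N (e (k + 1))) + Λ.mulVec (interiorVec N (e k)))) +
  1 / 4 * (4 * θ - 1) * normSq h N (sqrtMul a h N
    (Λ.mulVec (interiorVec N (e (k + 1))) - Λ.mulVec (interiorVec N (e k))))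

end RieszWave

end

/-! Energy method. Once the error equation is divided by `a`, the variable coefficient sits in the
diagonal mass `h / a(x_i)`, and the stiffness matrix, `-h` times the discrete Riesz operator, is
symmetric positive definite. Testing with `e^{k+1} - e^{k-1}` gives an exact energy balance
(`weightedEnergy_sub`). For `θ ≥ 1/4` every term of the energy is nonnegative, so in one step its
square root grows by at most `τ` times the weighted norm of the truncation error
(`sqrt_weightedEnergy_le`). Neither a Gronwall argument nor a coupling of `τ` and `h` is needed, and
the upper bound on `a` returns to the energy of the statement (`energy_le_weightedEnergy`). What
remains is definiteness, consistency and the starting step.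

Definiteness. The quadratic form of the Toeplitz matrix is a combination of autocorrelations. The
weights from index 3 on are nonnegative and all long enough partial sums of the weights are
nonpositive, so the form is bounded above by a negative multiple of a discrete Dirichlet form, and
below by the inverse inequality (`dotProduct_bMatrix_le`).

Consistency. Put `β = 2 - α`. The weights have generating function `(1 - β/2 + (β/2) z) (1 - z)^2 (1
- z)^{-β}`, so the one-sided operator is a fractional sum, with the coefficients of `(1 - z)^{-β}`,
of averaged second differences. The averaging moves the nodes by `β h / 2`, exactly the shift for
which the fractional quadrature has order two. This is read off its Peano kernel, whose deviation
from `t^{β+1} / Γ(β+2)` is `O(t^{β-1})` and hence integrable (`abs_kernel_le`,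
`abs_quadrature_sub_le`, `abs_deltaPlus_sub_leftRL_le`). Reflection gives the right-sided operator;
`α = 2` is the classical second difference.

Start. The first error is a Taylor remainder in time plus `τ^2` times a consistency error in space.
The energy of the former is bounded directly, that of the latter through the inverse inequality
(`weightedEnergy_start_le`). -/

namespace RieszWave

/-! ### Generating-function identities and signs of the weights -/

open Finset

/-- The coefficients of the power series `(1 - z)^{-β}`. -/
noncomputable def fracCoeff (β : ℝ) : ℕ → ℝ
  | 0 => 1
  | m + 1 => fracCoeff β m * (((m : ℝ) + β) / ((m : ℝ) + 1))

/-- The coefficients of `z * ∑ c_m z^m`. -/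
def shiftCoeff (c : ℕ → ℝ) : ℕ → ℝ
  | 0 => 0
  | m + 1 => c m

/-- The coefficients of the power series `(1 - z)^{-β-1}`. -/
noncomputable def fracSum (β : ℝ) (n : ℕ) : ℝ := ∑ j ∈ range (n + 1), fracCoeff β j

theorem fracCoeff_nonneg {β : ℝ} (hβ : 0 ≤ β) (m : ℕ) : 0 ≤ fracCoeff β m := by
  induction m with
  | zero => simp [fracCoeff]
  | succ m ih => rw [fracCoeff]; positivity

/-- Coefficient form of `d/dz (1 - z)^{-β} = β (1 - z)^{-β-1}`. -/
theorem fracCoeff_eq_fracSum {β : ℝ} (hβ : 0 < β) (n : ℕ) :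
    fracCoeff β n * (n + β) = β * fracSum β n := by
  induction n with
  | zero => simp [fracCoeff, fracSum]
  | succ n ih =>
    rw [fracSum, sum_range_succ, ← fracSum, mul_add β, ← ih, fracCoeff]
    push_cast
    field_simp

theorem fracSum_succ {β : ℝ} (hβ : 0 < β) (n : ℕ) :
    fracSum β (n + 1) = fracSum β n * ((n + 1 + β) / (n + 1)) := by
  have h := fracCoeff_eq_fracSum hβ n
  rw [fracSum, sum_range_succ, ← fracSum, fracCoeff]
  have : (n : ℝ) + 1 ≠ 0 := by positivity
  field_simp
  linarith

theorem fracSum_pos {β : ℝ} (hβ : 0 < β) (n : ℕ) : 0 < fracSum β n := by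
  induction n with
  | zero => simp [fracSum, fracCoeff]
  | succ n ih => rw [fracSum_succ hβ]; positivity

/-- Coefficient of `z^n` in `z (1 - z)^{-2} (1 - z)^{-β}`. It evaluates the piecewise linear Peano
kernel in closed form. -/
theorem sum_fracCoeff_mul {β : ℝ} (hβ : 0 < β) (n : ℕ) :
    ∑ j ∈ range (n + 1), fracCoeff β j * ((n : ℝ) - j) = n * fracSum β n / (β + 1) := by
  induction n with
  | zero => simp
  | succ n ih =>
    have h1 : ∑ j ∈ range (n + 1), fracCoeff β j * (((n + 1 : ℕ) : ℝ) - j) =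
        n * fracSum β n / (β + 1) + fracSum β n := by
      rw [← ih, fracSum, ← sum_add_distrib]
      refine sum_congr rfl fun j _ => ?_
      push_cast; ring
    rw [sum_range_succ, h1, fracSum_succ hβ]
    push_cast
    field_simp
    ring

theorem gCoeff_add_two (α : ℝ) (m : ℕ) :
    gCoeff α (m + 2) = fracCoeff (2 - α) m * (α * (α - 1) / (((m : ℝ) + 1) * (m + 2))) := by
  induction m with
  | zero => simp only [gCoeff, fracCoeff]; push_cast; ring
  | succ m ih =>
    rw [gCoeff, ih, fracCoeff]
    push_cast
    field_simp
    ring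

/-- The factorization `(1 - z)^α = (1 - z)^2 (1 - z)^{-(2-α)}`, which separates a second difference
from a fractional sum. -/
theorem gCoeff_eq (α : ℝ) (m : ℕ) :
    gCoeff α m = fracCoeff (2 - α) m - 2 * shiftCoeff (fracCoeff (2 - α)) m +
      shiftCoeff (shiftCoeff (fracCoeff (2 - α))) m := by
  match m with
  | 0 => simp [gCoeff, fracCoeff, shiftCoeff]
  | 1 => simp [gCoeff, fracCoeff, shiftCoeff]
  | m + 2 =>
    rw [gCoeff_add_two]
    simp only [shiftCoeff, fracCoeff]
    push_cast
    field_simp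
    ring

theorem phiCoeff_eq (α : ℝ) (m : ℕ) :
    phiCoeff α m = α / 2 * gCoeff α m + (2 - α) / 2 * shiftCoeff (gCoeff α) m := by
  cases m <;> simp [phiCoeff, shiftCoeff]

/-- Multiplying the series by `z` translates the argument by `h`. The index range stays the same
because the one additional term on the right is killed by `hw`. -/
theorem sum_shiftCoeff_mul (c : ℕ → ℝ) (w : ℝ → ℝ) (h x : ℝ) (n : ℕ)
    (hw : w (x - h - n * h) = 0) :
    ∑ m ∈ range (n + 1), shiftCoeff c m * w (x - m * h) =
      ∑ m ∈ range (n + 1), c m * w (x - h - m * h) := by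
  rw [sum_range_succ', sum_range_succ, hw]
  simp only [shiftCoeff, zero_mul, mul_zero, add_zero]
  refine sum_congr rfl fun m _ => ?_
  congr 2
  push_cast; ring

/-- Convolution with `g^α` is a fractional sum of second differences. -/
theorem sum_gCoeff_mul (α : ℝ) (w : ℝ → ℝ) (h x : ℝ) (n : ℕ)
    (h1 : w (x - h - n * h) = 0) (h2 : w (x - h - h - n * h) = 0) :
    ∑ m ∈ range (n + 1), gCoeff α m * w (x - m * h) =
      ∑ j ∈ range (n + 1), fracCoeff (2 - α) j *
        (w (x - j * h) - 2 * w (x - h - j * h) + w (x - h - h - j * h)) := by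
  have e1 := sum_shiftCoeff_mul (fracCoeff (2 - α)) w h x n h1
  have e2 := sum_shiftCoeff_mul (shiftCoeff (fracCoeff (2 - α))) w h x n h1
  have e3 := sum_shiftCoeff_mul (fracCoeff (2 - α)) w h (x - h) n h2
  rw [e3] at e2
  simp only [gCoeff_eq, mul_add, mul_sub, add_mul, sub_mul, sum_add_distrib, sum_sub_distrib]
  rw [e2]
  congr 2
  simp only [mul_assoc, mul_left_comm _ (2 : ℝ), ← mul_sum]
  rw [e1]

theorem sum_phiCoeff_mul (α : ℝ) (w : ℝ → ℝ) (h x : ℝ) (n : ℕ)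
    (h1 : w (x - h - n * h) = 0) (h2 : w (x - h - h - n * h) = 0)
    (h3 : w (x - h - h - h - n * h) = 0) :
    ∑ m ∈ range (n + 1), phiCoeff α m * w (x - m * h) =
      ∑ j ∈ range (n + 1), fracCoeff (2 - α) j *
        (α / 2 * (w (x - j * h) - 2 * w (x - h - j * h) + w (x - h - h - j * h)) +
        (2 - α) / 2 *
          (w (x - h - j * h) - 2 * w (x - h - h - j * h) + w (x - h - h - h - j * h))) := by
  have e1 := sum_gCoeff_mul α w h x n h1 h2
  have e2 := sum_gCoeff_mul α w h (x - h) n h2 h3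
  have e3 := sum_shiftCoeff_mul (gCoeff α) w h x n h1
  simp only [phiCoeff_eq, add_mul, sum_add_distrib, mul_assoc, ← mul_sum]
  rw [e3, e1, e2, mul_sum, mul_sum, ← sum_add_distrib]
  refine sum_congr rfl fun j _ => ?_
  ring

theorem gCoeff_nonneg {α : ℝ} (h1 : 1 ≤ α) (h2 : α ≤ 2) (m : ℕ) : 0 ≤ gCoeff α (m + 2) := by
  rw [gCoeff_add_two]
  have := fracCoeff_nonneg (sub_nonneg.2 h2) m
  have : 0 ≤ α - 1 := by linarith
  positivity

theorem phiCoeff_one (α : ℝ) : phiCoeff α 1 = -((α - 1) * (α + 2) / 2) := by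
  simp [phiCoeff, gCoeff]; ring

theorem phiCoeff_zero_add_two (α : ℝ) :
    phiCoeff α 0 + phiCoeff α 2 = α * ((α - 1) * (α + 2)) / 4 := by
  simp [phiCoeff, gCoeff]; ring

/-- The weight is `g_{m+2}` times a factor that is nonnegative because `α (α + 1) ≤ 6`. Index 3 is
where this argument starts to work for every `α ≤ 2`; `φ_2` alone may be negative, so below only
`φ_0 + φ_2` is used. -/
theorem phiCoeff_nonneg {α : ℝ} (h1 : 1 ≤ α) (h2 : α ≤ 2) (m : ℕ) :
    0 ≤ phiCoeff α (m + 3) := by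
  have hg := gCoeff_nonneg h1 h2 m
  have h : phiCoeff α (m + 3) = gCoeff α (m + 2) * (1 - α * (α + 1) / (2 * (m + 3))) := by
    rw [phiCoeff, gCoeff]
    push_cast
    field_simp
    ring
  rw [h]
  refine mul_nonneg hg (sub_nonneg.2 ?_)
  rw [div_le_one (by positivity)]
  have : (0 : ℝ) ≤ m := m.cast_nonneg
  nlinarith

/-- The partial sums are the coefficients of `(1 - z)^{α-1}`, hence obey the same kind of recursion.
-/
theorem sum_gCoeff_succ (α : ℝ) (n : ℕ) :
    ∑ m ∈ range (n + 2), gCoeff α m = (1 - α / (n + 1)) * ∑ m ∈ range (n + 1), gCoeff α m := by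
  have key : ∀ n : ℕ, ((n : ℝ) + 1) * gCoeff α (n + 1) = -α * ∑ m ∈ range (n + 1), gCoeff α m := by
    intro n
    induction n with
    | zero => simp [gCoeff]
    | succ n ih =>
      rw [sum_range_succ, mul_add, ← ih, gCoeff]
      push_cast
      field_simp
      ring
  have h := key n
  rw [sum_range_succ]
  have : (n : ℝ) + 1 ≠ 0 := by positivity
  field_simp
  linarith

theorem sum_gCoeff_nonpos {α : ℝ} (h1 : 1 ≤ α) (h2 : α ≤ 2) (n : ℕ) :
    ∑ m ∈ range (n + 2), gCoeff α m ≤ 0 := by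
  induction n with
  | zero => simp [sum_range_succ, gCoeff]; linarith
  | succ n ih =>
    rw [sum_gCoeff_succ]
    refine mul_nonpos_of_nonneg_of_nonpos (sub_nonneg.2 ?_) ih
    rw [div_le_one (by positivity)]
    push_cast
    linarith [(n.cast_nonneg : (0 : ℝ) ≤ n)]

theorem sum_phiCoeff_nonpos {α : ℝ} (h1 : 1 ≤ α) (h2 : α ≤ 2) (n : ℕ) :
    ∑ m ∈ range (n + 3), phiCoeff α m ≤ 0 := by
  have h : ∑ m ∈ range (n + 3), phiCoeff α m =
      α / 2 * ∑ m ∈ range (n + 3), gCoeff α m +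
        (2 - α) / 2 * ∑ m ∈ range (n + 2), gCoeff α m := by
    simp only [phiCoeff_eq, sum_add_distrib, ← mul_sum]
    rw [sum_range_succ' (shiftCoeff _)]
    simp [shiftCoeff]
  rw [h]
  have := sum_gCoeff_nonpos h1 h2 n
  have := sum_gCoeff_nonpos h1 h2 (n + 1)
  exact add_nonpos (mul_nonpos_of_nonneg_of_nonpos (by linarith) this)
    (mul_nonpos_of_nonneg_of_nonpos (by linarith) (sum_gCoeff_nonpos h1 h2 n))

end RieszWave

/-! ### Definiteness of the discrete Riesz operator and the inverse inequality -/

namespace RieszWave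

open Finset Matrix

theorem sum_fin_interior (N : ℕ) (hN : 1 ≤ N) (c v : ℕ → ℝ) (h0 : v 0 = 0) (h1 : v N = 0) :
    ∑ j : Fin (N - 1), c (j + 1) * interiorVec N v j = ∑ k ∈ range (N + 1), c k * v k := by
  obtain ⟨n, rfl⟩ : ∃ n, N = n + 1 := ⟨N - 1, by omega⟩
  rw [sum_range_succ, sum_range_succ', h0, h1]
  simp [interiorVec, Fin.sum_univ_eq_sum_range (fun k => c (k + 1) * v (k + 1))]

theorem bMatrix_mulVec (α : ℝ) (N : ℕ) (v : ℕ → ℝ) (h0 : v 0 = 0) (h1 : v N = 0)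
    (i : Fin (N - 1)) :
    (bMatrix α N *ᵥ interiorVec N v) i =
      ∑ m ∈ range (N - (i + 1) + 2), phiCoeff α m * v (i + 1 + m - 1) := by
  have hi := i.2
  have e := sum_fin_interior N (by omega)
    (fun k => if (i : ℕ) ≤ k then phiCoeff α (k - i) else 0) v h0 h1
  simp only [mulVec, dotProduct, bMatrix, of_apply]
  rw [e, range_eq_Ico, ← sum_Ico_consecutive _ (Nat.zero_le (i : ℕ)) (by omega : (i : ℕ) ≤ N + 1),
    sum_eq_zero, zero_add, sum_Ico_eq_sum_range, show N + 1 - i = N - (i + 1) + 2 by omega]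
  · refine sum_congr rfl fun m _ => ?_
    rw [if_pos (by omega), show (i : ℕ) + 1 + m - 1 = i + m by omega, Nat.add_sub_cancel_left]
  · intro k hk
    rw [if_neg (by have := (mem_Ico.1 hk).2; omega), zero_mul]

theorem bMatrix_transpose_mulVec (α : ℝ) (N : ℕ) (v : ℕ → ℝ) (h0 : v 0 = 0) (h1 : v N = 0)
    (i : Fin (N - 1)) :
    ((bMatrix α N)ᵀ *ᵥ interiorVec N v) i =
      ∑ m ∈ range (i + 1 + 2), phiCoeff α m * v (i + 1 + 1 - m) := by
  have hi := i.2
  have e := sum_fin_interior N (by omega)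
    (fun k => if k ≤ i + 2 then phiCoeff α (i + 2 - k) else 0) v h0 h1
  have e' : ((bMatrix α N)ᵀ *ᵥ interiorVec N v) i = ∑ j : Fin (N - 1),
      (if (j + 1 : ℕ) ≤ i + 2 then phiCoeff α (i + 2 - (j + 1)) else 0) *
        interiorVec N v j := by
    simp only [mulVec, dotProduct, bMatrix, of_apply, transpose_apply]
    refine sum_congr rfl fun j _ => ?_
    simp only [show ((j : ℕ) + 1 ≤ i + 2) = ((j : ℕ) ≤ i + 1) from by simp,
      show (i : ℕ) + 2 - (j + 1) = i + 1 - j by omega]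
  rw [e', e, range_eq_Ico, ← sum_Ico_consecutive _ (Nat.zero_le ((i : ℕ) + 3))
    (by omega : (i : ℕ) + 3 ≤ N + 1), add_comm, sum_eq_zero, zero_add, ← range_eq_Ico,
    ← sum_range_reflect]
  · refine sum_congr rfl fun m hm => ?_
    have := mem_range.1 hm
    rw [if_pos (by omega), show (i : ℕ) + 3 - 1 - m = i + 1 + 1 - m by omega,
      show (i : ℕ) + 2 - (i + 1 + 1 - m) = m by omega]
  · intro k hk
    rw [if_neg (by have := (mem_Ico.1 hk).1; omega), zero_mul]

/-- `nablaMatrix` is the matrix of `nabla`. -/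
theorem nablaMatrix_mulVec (α h : ℝ) (N : ℕ) (v : ℕ → ℝ) (h0 : v 0 = 0) (h1 : v N = 0)
    (i : Fin (N - 1)) :
    (nablaMatrix α h N *ᵥ interiorVec N v) i = nabla α h N v (i + 1) := by
  rw [nablaMatrix, smul_mulVec, Pi.smul_apply, add_mulVec, Pi.add_apply,
    bMatrix_mulVec α N v h0 h1, bMatrix_transpose_mulVec α N v h0 h1, nabla, deltaPlus, deltaMinus,
    smul_eq_mul]
  ring

/-- The extension of a vector to a grid function vanishing outside of the interior points. -/
def gridExt (N : ℕ) (x : Fin (N - 1) → ℝ) (k : ℕ) : ℝ :=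
  if h : k - 1 < N - 1 then (if 1 ≤ k then x ⟨k - 1, h⟩ else 0) else 0

theorem interiorVec_gridExt (N : ℕ) (x : Fin (N - 1) → ℝ) :
    interiorVec N (gridExt N x) = x := by
  ext j
  simp [interiorVec, gridExt]

theorem gridExt_zero (N : ℕ) (x : Fin (N - 1) → ℝ) : gridExt N x 0 = 0 := by
  simp [gridExt]

theorem gridExt_of_le (N : ℕ) (x : Fin (N - 1) → ℝ) (k : ℕ) (hk : N ≤ k) (hk' : 1 ≤ k) :
    gridExt N x k = 0 := by
  rw [gridExt, dif_neg (by omega)]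

/-- The quadratic form of `bMatrix` in terms of autocorrelations. -/
theorem dotProduct_bMatrix (α : ℝ) (N : ℕ) (hN : 1 ≤ N) (v : ℕ → ℝ) (h0 : v 0 = 0)
    (h1 : ∀ k, N ≤ k → v k = 0) :
    interiorVec N v ⬝ᵥ (bMatrix α N *ᵥ interiorVec N v) =
      ∑ m ∈ range (N + 2), phiCoeff α m * ∑ i ∈ range N, v (i + 1) * v (i + m) := by
  have hv : ∀ i : ℕ, i < N → ∑ m ∈ range (N - (i + 1) + 2), phiCoeff α m * v (i + 1 + m - 1) =
      ∑ m ∈ range (N + 2), phiCoeff α m * v (i + m) := by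
    intro i hi
    have : N - (i + 1) + 2 ≤ N + 2 := by omega
    rw [← sum_range_add_sum_Ico (fun m => phiCoeff α m * v (i + m)) this,
      sum_eq_zero (s := Ico _ _), add_zero]
    · exact sum_congr rfl fun m _ => by rw [show i + 1 + m - 1 = i + m by omega]
    · intro m hm
      rw [h1 _ (by have := (mem_Ico.1 hm).1; omega), mul_zero]
  simp only [dotProduct, bMatrix_mulVec α N v h0 (h1 N le_rfl)]
  obtain ⟨n, rfl⟩ : ∃ n, N = n + 1 := ⟨N - 1, by omega⟩
  have e : ∀ i : Fin (n + 1 - 1), interiorVec (n + 1) v i *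
      ∑ m ∈ range (n + 1 - (i + 1) + 2), phiCoeff α m * v (i + 1 + m - 1) =
      (fun k : ℕ => v (k + 1) * ∑ m ∈ range (n + 1 + 2), phiCoeff α m * v (k + m)) i := by
    intro i
    have hi := i.2
    rw [hv i (by omega)]
    rfl
  rw [sum_congr rfl fun i _ => e i]
  refine (Fin.sum_univ_eq_sum_range
    (fun k : ℕ => v (k + 1) * ∑ m ∈ range (n + 1 + 2), phiCoeff α m * v (k + m)) n).trans ?_
  simp only [mul_sum]
  rw [sum_comm' (t' := range (n + 1 + 2)) (s' := fun _ => range n) (by intros; tauto)]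
  refine sum_congr rfl fun m _ => ?_
  rw [sum_range_succ _ n, h1 (n + 1) le_rfl]
  simp only [zero_mul, mul_zero, add_zero]
  exact sum_congr rfl fun k _ => by ring

/-- Young's inequality for each product; the shifted sum of squares only loses terms, as `v`
vanishes from `N` on. -/
theorem abs_autocorrelation_le (N : ℕ) (v : ℕ → ℝ) (h1 : ∀ k, N ≤ k → v k = 0) (m : ℕ) :
    |∑ i ∈ range N, v (i + 1) * v (i + 1 + m)| ≤ ∑ i ∈ range N, v (i + 1) ^ 2 := by
  have hs : ∑ i ∈ range N, v (i + 1 + m) ^ 2 ≤ ∑ i ∈ range N, v (i + 1) ^ 2 := by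
    have : ∑ i ∈ range N, v (i + 1 + m) ^ 2 = ∑ i ∈ Ico m (m + N), v (i + 1) ^ 2 := by
      rw [sum_Ico_eq_sum_range, Nat.add_sub_cancel_left]
      exact sum_congr rfl fun i _ => by rw [show m + i + 1 = i + 1 + m by omega]
    rw [this]
    have h2 : ∑ i ∈ range N, v (i + 1) ^ 2 = ∑ i ∈ range (m + N), v (i + 1) ^ 2 := by
      rw [← sum_range_add_sum_Ico _ (by omega : N ≤ m + N), left_eq_add]
      refine sum_eq_zero fun i hi => ?_
      rw [h1 _ (by have := (mem_Ico.1 hi).1; omega)]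
      norm_num
    rw [h2]
    refine sum_le_sum_of_subset_of_nonneg (fun i hi => ?_) fun i _ _ => sq_nonneg _
    exact mem_range.2 (mem_Ico.1 hi).2
  calc _ ≤ ∑ i ∈ range N, |v (i + 1) * v (i + 1 + m)| := abs_sum_le_sum_abs _ _
    _ ≤ ∑ i ∈ range N, (v (i + 1) ^ 2 / 2 + v (i + 1 + m) ^ 2 / 2) := by
        refine sum_le_sum fun i _ => ?_
        rw [abs_le]
        constructor <;> nlinarith [sq_nonneg (v (i + 1) + v (i + 1 + m)),
          sq_nonneg (v (i + 1) - v (i + 1 + m))]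
    _ = (∑ i ∈ range N, v (i + 1) ^ 2) / 2 + (∑ i ∈ range N, v (i + 1 + m) ^ 2) / 2 := by
        rw [sum_add_distrib, sum_div, sum_div]
    _ ≤ _ := by linarith

/-- The weights `φ_0, φ_1, φ_2` multiply the autocorrelations of lag -1, 0, 1, and lags -1 and 1
agree. Every other autocorrelation is at most `S` in modulus and has a nonnegative weight; the total
of those weights is at most `-(φ_0 + φ_1 + φ_2)` by `sum_phiCoeff_nonpos`. The upper bound yields
definiteness, the lower one the inverse inequality. -/
theorem dotProduct_bMatrix_le {α : ℝ} (hα1 : 1 < α) (hα2 : α ≤ 2) (N : ℕ) (hN : 1 ≤ N)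
    (v : ℕ → ℝ) (h0 : v 0 = 0) (h1 : ∀ k, N ≤ k → v k = 0) :
    interiorVec N v ⬝ᵥ (bMatrix α N *ᵥ interiorVec N v) ≤
      (phiCoeff α 0 + phiCoeff α 2) *
        (∑ i ∈ range N, v (i + 1) * v (i + 2) - ∑ i ∈ range N, v (i + 1) ^ 2) ∧
    2 * phiCoeff α 1 * ∑ i ∈ range N, v (i + 1) ^ 2 ≤
      interiorVec N v ⬝ᵥ (bMatrix α N *ᵥ interiorVec N v) := by
  obtain ⟨n, rfl⟩ : ∃ n, N = n + 1 := ⟨N - 1, by omega⟩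
  set N := n + 1 with hNdef
  set S := ∑ i ∈ range N, v (i + 1) ^ 2 with hS
  have hS0 : 0 ≤ S := sum_nonneg fun i _ => sq_nonneg _
  have hc0 : ∑ i ∈ range N, v (i + 1) * v (i + 0) = ∑ i ∈ range N, v (i + 1) * v (i + 2) := by
    rw [hNdef, sum_range_succ', sum_range_succ, h1 (n + 1) le_rfl]
    simp only [add_zero, zero_add, h0, mul_zero, zero_mul]
    exact sum_congr rfl fun i _ => by rw [mul_comm]
  have hc1 : ∑ i ∈ range N, v (i + 1) * v (i + 1) = S :=
    sum_congr rfl fun i _ => (sq _).symm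
  have hq := dotProduct_bMatrix α N hN v h0 h1
  rw [show N + 2 = n + 3 by omega, sum_range_succ', sum_range_succ', sum_range_succ'] at hq
  simp only [zero_add] at hq
  rw [hc0, hc1] at hq
  set c := ∑ i ∈ range N, v (i + 1) * v (i + 2)
  have hc2 : |c| ≤ S := abs_autocorrelation_le N v h1 1
  have hr : |∑ k ∈ range n, phiCoeff α (k + 1 + 1 + 1) *
      ∑ i ∈ range N, v (i + 1) * v (i + (k + 1 + 1 + 1))| ≤
      (∑ k ∈ range n, phiCoeff α (k + 3)) * S := by
    rw [sum_mul]
    refine (abs_sum_le_sum_abs _ _).trans (sum_le_sum fun k _ => ?_)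
    rw [abs_mul, abs_of_nonneg (phiCoeff_nonneg hα1.le hα2 k)]
    refine mul_le_mul_of_nonneg_left ?_ (phiCoeff_nonneg hα1.le hα2 k)
    have := abs_autocorrelation_le N v h1 (k + 2)
    simpa only [show ∀ i, i + 1 + (k + 2) = i + (k + 1 + 1 + 1) from fun i => by omega] using this
  have hsum := sum_phiCoeff_nonpos hα1.le hα2 n
  rw [sum_range_succ', sum_range_succ', sum_range_succ'] at hsum
  have hp : 0 ≤ phiCoeff α 0 + phiCoeff α 2 := by
    rw [phiCoeff_zero_add_two]
    have : 0 ≤ α - 1 := by linarith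
    positivity
  simp only [zero_add] at hsum
  have e3 : ∑ k ∈ range n, phiCoeff α (k + 1 + 1 + 1) = ∑ k ∈ range n, phiCoeff α (k + 3) := rfl
  rw [e3] at hsum
  rw [abs_le] at hr hc2
  simp only [add_assoc, Nat.reduceAdd] at hr hq hsum
  set A := ∑ k ∈ range n, phiCoeff α (k + 3)
  constructor
  · nlinarith [hr.2]
  · nlinarith [hr.1, mul_le_mul_of_nonneg_left hc2.1 hp]

/-- Twice the gap is `∑ (v_{i+1} - v_{i+2})^2 + v_1^2`. If it were not positive, `v_1 = 0` would
propagate to all entries. -/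
theorem autocorrelation_lt {N : ℕ} (v : ℕ → ℝ) (h1 : ∀ k, N ≤ k → v k = 0)
    (hv : ∃ k, v (k + 1) ≠ 0) :
    ∑ i ∈ range N, v (i + 1) * v (i + 2) < ∑ i ∈ range N, v (i + 1) ^ 2 := by
  have hshift : ∑ i ∈ range N, v (i + 1) ^ 2 = ∑ i ∈ range N, v (i + 2) ^ 2 + v 1 ^ 2 := by
    have h := sum_range_succ (fun i => v (i + 1) ^ 2) N
    rw [sum_range_succ', h1 (N + 1) (by omega)] at h
    simp only [zero_add] at h
    rw [show (0 : ℝ) ^ 2 = 0 by norm_num, add_zero] at h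
    exact h.symm
  have hid : 2 * (∑ i ∈ range N, v (i + 1) ^ 2 - ∑ i ∈ range N, v (i + 1) * v (i + 2)) =
      ∑ i ∈ range N, (v (i + 1) - v (i + 2)) ^ 2 + v 1 ^ 2 := by
    have : ∑ i ∈ range N, (v (i + 1) - v (i + 2)) ^ 2 = ∑ i ∈ range N, v (i + 1) ^ 2 -
        2 * ∑ i ∈ range N, v (i + 1) * v (i + 2) + ∑ i ∈ range N, v (i + 2) ^ 2 := by
      rw [mul_sum, ← sum_sub_distrib, ← sum_add_distrib]
      exact sum_congr rfl fun i _ => by ring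
    linarith
  by_contra hcon
  have hn : 0 ≤ ∑ i ∈ range N, (v (i + 1) - v (i + 2)) ^ 2 := sum_nonneg fun i _ => sq_nonneg _
  have hv1 : v 1 = 0 := by
    have : v 1 ^ 2 ≤ 0 := by linarith [not_lt.1 hcon]
    nlinarith [sq_nonneg (v 1)]
  have hz : ∑ i ∈ range N, (v (i + 1) - v (i + 2)) ^ 2 = 0 := by
    nlinarith [sq_nonneg (v 1), not_lt.1 hcon]
  rw [sum_eq_zero_iff_of_nonneg fun i _ => sq_nonneg _] at hz
  have hall : ∀ k, v (k + 1) = 0 := by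
    intro k
    induction k with
    | zero => exact hv1
    | succ k ih =>
      by_cases hk : k < N
      · have := hz k (mem_range.2 hk)
        have := pow_eq_zero_iff (two_ne_zero) |>.1 this
        linarith
      · exact h1 _ (by omega)
  obtain ⟨k, hk⟩ := hv
  exact hk (hall k)

theorem kappa_neg {α : ℝ} (hα1 : 1 < α) (hα2 : α ≤ 2) : kappa α < 0 := by
  have : Real.cos (α * Real.pi / 2) < 0 :=
    Real.cos_neg_of_pi_div_two_lt_of_lt (by nlinarith [Real.pi_pos]) (by nlinarith [Real.pi_pos])
  rw [kappa, one_div]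
  exact inv_lt_zero.2 (by linarith)

theorem dotProduct_nablaMatrix (α h : ℝ) (N : ℕ) (x : Fin (N - 1) → ℝ) :
    x ⬝ᵥ ((-nablaMatrix α h N) *ᵥ x) = 2 * (kappa α / h ^ α) * (x ⬝ᵥ (bMatrix α N *ᵥ x)) := by
  have e : x ⬝ᵥ ((bMatrix α N)ᵀ *ᵥ x) = x ⬝ᵥ (bMatrix α N *ᵥ x) := by
    rw [dotProduct_mulVec, vecMul_transpose, dotProduct_comm]
  rw [neg_mulVec, dotProduct_neg, nablaMatrix, smul_mulVec, add_mulVec, dotProduct_smul,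
    dotProduct_add, e, smul_eq_mul]
  ring

theorem neg_nablaMatrix_posDef {α h : ℝ} (hα1 : 1 < α) (hα2 : α ≤ 2) (hh : 0 < h) (N : ℕ)
    (hN : 1 ≤ N) : (-nablaMatrix α h N).PosDef := by
  rw [posDef_iff_dotProduct_mulVec]
  constructor
  · rw [IsHermitian, conjTranspose_eq_transpose_of_trivial, nablaMatrix]
    simp [add_comm]
  · intro x hx
    rw [star_trivial, dotProduct_nablaMatrix]
    have hκ : kappa α / h ^ α < 0 := div_neg_of_neg_of_pos (kappa_neg hα1 hα2) (by positivity)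
    have hb := (dotProduct_bMatrix_le hα1 hα2 N hN (gridExt N x) (gridExt_zero N x)
      fun k hk => gridExt_of_le N x k hk (by omega)).1
    rw [interiorVec_gridExt] at hb
    have hlt := autocorrelation_lt (gridExt N x)
      (fun k hk => gridExt_of_le N x k hk (by omega)) (by
        obtain ⟨j, hj⟩ := Function.ne_iff.1 hx
        exact ⟨j, by
          have := congrFun (interiorVec_gridExt N x) j
          rw [interiorVec] at this
          rwa [this]⟩)
    have hp : 0 < phiCoeff α 0 + phiCoeff α 2 := by
      rw [phiCoeff_zero_add_two]
      have : 0 < α - 1 := by linarith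
      positivity
    have : x ⬝ᵥ (bMatrix α N *ᵥ x) < 0 :=
      hb.trans_lt (mul_neg_of_pos_of_neg hp (by linarith))
    nlinarith [mul_pos_of_neg_of_neg hκ this]

/-- The inverse inequality for `-∇_h^α`. -/
theorem dotProduct_neg_nablaMatrix_le {α h : ℝ} (hα1 : 1 < α) (hα2 : α ≤ 2) (hh : 0 < h) (N : ℕ)
    (hN : 1 ≤ N) (x : Fin (N - 1) → ℝ) :
    x ⬝ᵥ ((-nablaMatrix α h N) *ᵥ x) ≤
      4 * (kappa α * phiCoeff α 1) / h ^ α * ∑ j, x j ^ 2 := by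
  have hκ : kappa α / h ^ α < 0 := div_neg_of_neg_of_pos (kappa_neg hα1 hα2) (by positivity)
  have hb := (dotProduct_bMatrix_le hα1 hα2 N hN (gridExt N x) (gridExt_zero N x)
      fun k hk => gridExt_of_le N x k hk (by omega)).2
  have hs : ∑ i ∈ range N, gridExt N x (i + 1) ^ 2 = ∑ j, x j ^ 2 := by
    obtain ⟨n, rfl⟩ : ∃ n, N = n + 1 := ⟨N - 1, by omega⟩
    rw [sum_range_succ, gridExt_of_le _ _ _ le_rfl (by omega)]
    have := Fin.sum_univ_eq_sum_range (fun i => gridExt (n + 1) x (i + 1) ^ 2) n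
    simp only [ne_eq, OfNat.ofNat_ne_zero, not_false_eq_true, zero_pow, add_zero]
    rw [← this]
    exact sum_congr rfl fun j _ => by
      rw [show gridExt (n + 1) x (j + 1) = x j from congrFun (interiorVec_gridExt (n + 1) x) j]
  rw [interiorVec_gridExt, hs] at hb
  rw [dotProduct_nablaMatrix]
  have := mul_le_mul_of_nonpos_left hb hκ.le
  calc _ = 2 * (kappa α / h ^ α * (x ⬝ᵥ (bMatrix α N *ᵥ x))) := by ring
    _ ≤ 2 * (kappa α / h ^ α * (2 * phiCoeff α 1 * ∑ j, x j ^ 2)) := by linarith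
    _ = _ := by ring

open scoped MatrixOrder in
theorem exists_isLambda {α h : ℝ} (hα1 : 1 < α) (hα2 : α ≤ 2) (hh : 0 < h) (N : ℕ)
    (hN : 1 ≤ N) : ∃ Λ, IsLambda α h N Λ := by
  have hM := neg_nablaMatrix_posDef hα1 hα2 hh N hN
  have hs : CFC.sqrt (-nablaMatrix α h N) * CFC.sqrt (-nablaMatrix α h N) = -nablaMatrix α h N :=
    CFC.sqrt_mul_sqrt_self _ hM.posSemidef.nonneg
  have hp : (CFC.sqrt (-nablaMatrix α h N)).PosSemidef := (CFC.sqrt_nonneg _).posSemidef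
  -- The functional calculus only gives a semidefinite root; a null vector of the root would also be
  -- one of its square, which is definite.
  refine ⟨CFC.sqrt (-nablaMatrix α h N), ?_, hs⟩
  rw [posDef_iff_dotProduct_mulVec]
  refine ⟨hp.isHermitian, fun x hx => lt_of_le_of_ne (hp.dotProduct_mulVec_nonneg x) fun h0 => ?_⟩
  have h1 := (hp.dotProduct_mulVec_zero_iff x).1 h0.symm
  have h2 := hM.dotProduct_mulVec_pos hx
  rw [← hs, ← mulVec_mulVec, h1] at h2
  simp at h2

end RieszWave

/-! ### Asymptotics of the fractional coefficients and of the Peano kernel -/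

namespace RieszWave

open Finset Filter Topology

/-- The logarithmic defect of `Γ(1 + β) ∑_{j ≤ n} A_j ≈ (n + (1 + β) / 2)^β`. -/
noncomputable def logDefect (β : ℝ) (n : ℕ) : ℝ :=
  Real.log (Real.Gamma (1 + β) * fracSum β n) - β * Real.log (n + (1 + β) / 2)

/-- The expression is odd in `x`, so the quadratic Taylor terms of the two logarithms cancel. -/
theorem abs_log_sub_log_sub_le {x : ℝ} (h0 : 0 ≤ x) (h1 : x < 1) :
    |Real.log (1 + x) - Real.log (1 - x) - 2 * x| ≤ 2 * (x ^ 3 / (1 - x)) := by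
  have e1 := Real.abs_log_sub_add_sum_range_le (x := x) (by rwa [abs_of_nonneg h0]) 2
  have e2 := Real.abs_log_sub_add_sum_range_le (x := -x) (by rwa [abs_neg, abs_of_nonneg h0]) 2
  simp only [sum_range_succ, range_zero, sum_empty, abs_neg, abs_of_nonneg h0, sub_neg_eq_add]
    at e1 e2
  norm_num at e1 e2
  rw [abs_le] at *
  constructor <;> linarith [e1.1, e1.2, e2.1, e2.2]

/-- Centre everything at `P = n + 1 + β/2`. The ratio of consecutive `fracSum` becomes `(1 + x)/(1 -
x)`, that of the comparison points `(1 + y)/(1 - y)`, with `x = β y` and `y = 1/(2P)`. The offset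
`(1 + β)/2` is what makes both symmetric: linear terms cancel by `x = β y`, quadratic ones by
oddness. -/
theorem abs_logDefect_succ_sub_le {β : ℝ} (h0 : 0 < β) (h1 : β < 1) (n : ℕ) :
    |logDefect β (n + 1) - logDefect β n| ≤ 1 / ((n : ℝ) + 1) ^ 3 := by
  set m : ℝ := (n : ℝ) + 1 with hm
  have hm1 : 1 ≤ m := by rw [hm]; linarith [(n.cast_nonneg : (0 : ℝ) ≤ n)]
  set P : ℝ := m + β / 2 with hP
  have hP1 : 1 < P := by rw [hP]; linarith
  have hG : Real.Gamma (1 + β) ≠ 0 := (Real.Gamma_pos_of_pos (by linarith)).ne'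
  have hp := (fracSum_pos h0 n).ne'
  set x := β / (2 * P) with hx
  set y := 1 / (2 * P) with hy
  have hxy : x = β * y := by rw [hx, hy]; ring
  have hy0 : 0 < y := by rw [hy]; positivity
  have hy1 : y ≤ 1 / 2 := by
    rw [hy, div_le_div_iff₀ (by positivity) (by norm_num)]; linarith
  have hx0 : 0 ≤ x := by rw [hxy]; positivity
  have hxly : x ≤ y := by rw [hxy]; nlinarith
  have e1 : m + β = P * (1 + x) := by rw [hx]; field_simp; rw [hP]; ring
  have e2 : m = P * (1 - x) := by rw [hx]; field_simp; rw [hP]; ring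
  have e3 : ((n + 1 : ℕ) : ℝ) + (1 + β) / 2 = P * (1 + y) := by
    rw [hy]; push_cast; rw [← hm]; field_simp; rw [hP]; ring
  have e4 : (n : ℝ) + (1 + β) / 2 = P * (1 - y) := by
    rw [hy, show (n : ℝ) = m - 1 by rw [hm]; ring]; field_simp; rw [hP]; ring
  have key : logDefect β (n + 1) - logDefect β n =
      (Real.log (1 + x) - Real.log (1 - x) - 2 * x) -
        β * (Real.log (1 + y) - Real.log (1 - y) - 2 * y) := by
    rw [logDefect, logDefect, fracSum_succ h0, ← hm, e1, e3, e4]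
    nth_rewrite 1 [e2]
    have a1 : 1 + x ≠ 0 := by linarith
    have a2 : 1 - x ≠ 0 := by linarith
    have a3 : 1 + y ≠ 0 := by linarith
    have a4 : 1 - y ≠ 0 := by linarith
    have a5 : P ≠ 0 := by linarith
    rw [Real.log_mul hG (by positivity), Real.log_mul hp (by positivity),
      Real.log_div (by positivity) (by positivity), Real.log_mul a5 a1, Real.log_mul a5 a2,
      Real.log_mul a5 a3, Real.log_mul a5 a4, Real.log_mul hG hp, hxy]
    ring
  have b1 := abs_log_sub_log_sub_le hx0 (by linarith)
  have b2 := abs_log_sub_log_sub_le hy0.le (by linarith)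
  have b3 : x ^ 3 / (1 - x) ≤ 2 * y ^ 3 := by
    rw [div_le_iff₀ (by linarith)]
    have : x ^ 3 ≤ y ^ 3 := pow_le_pow_left₀ hx0 hxly 3
    nlinarith [pow_pos hy0 3]
  have b4 : y ^ 3 / (1 - y) ≤ 2 * y ^ 3 := by
    rw [div_le_iff₀ (by linarith)]
    nlinarith [pow_pos hy0 3]
  have b5 : 8 * y ^ 3 ≤ 1 / m ^ 3 := by
    have : 8 * y ^ 3 = 1 / P ^ 3 := by rw [hy]; field_simp; norm_num
    rw [this]
    exact one_div_le_one_div_of_le (by positivity) (pow_le_pow_left₀ (by linarith)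
      (by rw [hP]; linarith) 3)
  rw [key]
  refine (abs_sub _ _).trans ?_
  rw [abs_mul, abs_of_pos h0]
  nlinarith [abs_nonneg (Real.log (1 + y) - Real.log (1 - y) - 2 * y)]

theorem fracSum_mul_GammaSeq {β : ℝ} (h0 : 0 < β) (n : ℕ) :
    Real.GammaSeq (1 + β) n * (fracSum β n * (n + 1 + β)) = (n : ℝ) ^ (1 + β) := by
  have hp : ∀ n : ℕ, ∏ j ∈ range (n + 1), (1 + β + j) =
      fracSum β n * n.factorial * (n + 1 + β) := by
    intro n
    induction n with
    | zero => simp [fracSum, fracCoeff]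
    | succ n ih =>
      rw [prod_range_succ, ih, fracSum_succ h0, Nat.factorial_succ]
      push_cast
      field_simp
      ring
  have := fracSum_pos h0 n
  rw [Real.GammaSeq, hp]
  field_simp

/-- By `fracSum_mul_GammaSeq` this is Euler's limit for `Γ(1 + β)`, up to logarithms of ratios `n /
(n + c)`. -/
theorem tendsto_logDefect {β : ℝ} (h0 : 0 < β) : Tendsto (logDefect β) atTop (𝓝 0) := by
  have hG : 0 < Real.Gamma (1 + β) := Real.Gamma_pos_of_pos (by linarith)
  have t1 : Tendsto (fun n => Real.log (Real.GammaSeq (1 + β) n)) atTop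
      (𝓝 (Real.log (Real.Gamma (1 + β)))) :=
    (Real.continuousAt_log hG.ne').tendsto.comp (Real.GammaSeq_tendsto_Gamma (1 + β))
  have t2 : ∀ c : ℝ, Tendsto (fun n : ℕ => Real.log ((n : ℝ) / (n + c))) atTop (𝓝 0) := by
    intro c
    rw [← Real.log_one]
    exact (Real.continuousAt_log one_ne_zero).tendsto.comp
      (tendsto_natCast_div_add_atTop c)
  have t := ((tendsto_const_nhds (x := Real.log (Real.Gamma (1 + β)))).sub t1).add
    ((t2 (1 + β)).add ((t2 ((1 + β) / 2)).const_mul β))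
  simp only [sub_self, mul_zero, add_zero] at t
  refine t.congr' ?_
  filter_upwards [eventually_gt_atTop 0] with n hn
  have hn' : (0 : ℝ) < n := Nat.cast_pos.2 hn
  have hp := fracSum_pos h0 n
  have e : Real.GammaSeq (1 + β) n = (n : ℝ) ^ (1 + β) / (fracSum β n * (n + 1 + β)) := by
    rw [← fracSum_mul_GammaSeq h0 n]
    field_simp
  rw [logDefect, e, Real.log_div (by positivity) (by positivity),
    Real.log_div (by positivity) (by positivity), Real.log_div (by positivity) (by positivity),
    Real.log_mul hp.ne' (by positivity), Real.log_mul hG.ne' hp.ne', Real.log_rpow hn',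
    ← add_assoc (n : ℝ) 1 β]
  ring

/-- The cubic bound on the increments is dominated by a telescoping difference of inverse squares,
so adding or subtracting `1/(n+1)^2` makes the sequence monotone; its limit is zero. -/
theorem abs_logDefect_le {β : ℝ} (h0 : 0 < β) (h1 : β < 1) (n : ℕ) :
    |logDefect β (n + 1)| ≤ 1 / ((n : ℝ) + 1) ^ 2 := by
  have hstep : ∀ n : ℕ, |logDefect β (n + 1 + 1) - logDefect β (n + 1)| ≤
      1 / ((n : ℝ) + 1) ^ 2 - 1 / (((n + 1 : ℕ) : ℝ) + 1) ^ 2 := by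
    intro n
    refine (abs_logDefect_succ_sub_le h0 h1 (n + 1)).trans ?_
    push_cast
    have hn : (0 : ℝ) ≤ n := n.cast_nonneg
    rw [div_sub_div _ _ (by positivity) (by positivity), div_le_div_iff₀ (by positivity)
      (by positivity)]
    have : 0 ≤ ((n : ℝ) + 1 + 1) ^ 2 * (((n : ℝ) + 1 + 1) * (2 * n + 3) - (n + 1) ^ 2) := by
      refine mul_nonneg (by positivity) ?_
      nlinarith
    nlinarith
  have hz : Tendsto (fun n : ℕ => 1 / ((n : ℝ) + 1) ^ 2) atTop (𝓝 0) := by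
    have := (tendsto_one_div_add_atTop_nhds_zero_nat (𝕜 := ℝ)).pow 2
    simpa using this
  have hl := (tendsto_logDefect h0).comp (tendsto_add_atTop_nat 1)
  have ha : Antitone fun n : ℕ => logDefect β (n + 1) + 1 / ((n : ℝ) + 1) ^ 2 :=
    antitone_nat_of_succ_le fun n => by linarith [(abs_le.1 (hstep n)).2]
  have hm : Monotone fun n : ℕ => logDefect β (n + 1) - 1 / ((n : ℝ) + 1) ^ 2 :=
    monotone_nat_of_le_succ fun n => by linarith [(abs_le.1 (hstep n)).1]
  have r1 := ha.le_of_tendsto (hl.add hz) n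
  have r2 := hm.ge_of_tendsto (hl.sub hz) n
  rw [abs_le]
  constructor <;> linarith

theorem Gamma_mul_fracSum {β : ℝ} (h0 : 0 < β) (n : ℕ) :
    Real.Gamma (1 + β) * fracSum β n =
      ((n : ℝ) + (1 + β) / 2) ^ β * Real.exp (logDefect β n) := by
  have hG : 0 < Real.Gamma (1 + β) := Real.Gamma_pos_of_pos (by linarith)
  have hp := fracSum_pos h0 n
  have hn : (0 : ℝ) < (n : ℝ) + (1 + β) / 2 := by positivity
  rw [logDefect, Real.exp_sub, Real.exp_log (by positivity), Real.rpow_def_of_pos hn, mul_comm β]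
  field_simp

theorem fracSum_le {β : ℝ} (h0 : 0 < β) (h1 : β < 1) :
    ∃ C, 0 ≤ C ∧ ∀ n : ℕ, fracSum β n ≤ C * ((n : ℝ) + 1) ^ β := by
  have hG : 0 < Real.Gamma (1 + β) := Real.Gamma_pos_of_pos (by linarith)
  refine ⟨max 1 (Real.exp 1 / Real.Gamma (1 + β)), by positivity, fun n => ?_⟩
  rcases n with _ | n
  · simp [fracSum, fracCoeff]
  · have h := Gamma_mul_fracSum h0 (n + 1)
    have hd : logDefect β (n + 1) ≤ 1 := by
      refine (le_abs_self _).trans ((abs_logDefect_le h0 h1 n).trans ?_)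
      rw [div_le_one (by positivity)]
      nlinarith [(n.cast_nonneg : (0 : ℝ) ≤ n)]
    have hle : (((n + 1 : ℕ) : ℝ) + (1 + β) / 2) ^ β * Real.exp (logDefect β (n + 1)) ≤
        (((n + 1 : ℕ) : ℝ) + 1) ^ β * Real.exp 1 := by
      gcongr
      linarith
    calc fracSum β (n + 1) = Real.Gamma (1 + β) * fracSum β (n + 1) / Real.Gamma (1 + β) := by
          field_simp
      _ ≤ (((n + 1 : ℕ) : ℝ) + 1) ^ β * Real.exp 1 / Real.Gamma (1 + β) := by
          rw [h]; gcongr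
      _ = Real.exp 1 / Real.Gamma (1 + β) * (((n + 1 : ℕ) : ℝ) + 1) ^ β := by ring
      _ ≤ _ := by gcongr; exact le_max_right _ _

/-- Bernoulli bounds the complementary power `(1 + x)^{1-β}` from above; dividing `1 + x` by it
bounds `(1 + x)^β` from below. -/
theorem one_add_mul_sub_le_rpow {β x : ℝ} (h0 : 0 < β) (h1 : β < 1) (hx : |x| ≤ 1 / 2) :
    1 + β * x - 2 * x ^ 2 ≤ (1 + x) ^ β := by
  rw [abs_le] at hx
  have hp : 0 < 1 + x := by linarith
  have h := rpow_one_add_le_one_add_mul_self (s := x) (p := 1 - β) (by linarith)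
    (by linarith) (by linarith)
  have hq : 0 < (1 + x) ^ (1 - β) := Real.rpow_pos_of_pos hp _
  have e : (1 + x) ^ β * (1 + x) ^ (1 - β) = 1 + x := by
    rw [← Real.rpow_add hp]; simp
  have hneg : (1 + β * x - 2 * x ^ 2) * (1 + (1 - β) * x) ≤ 1 + x := by
    have : 0 ≤ x ^ 2 * (2 + 2 * (1 - β) * x - β * (1 - β)) := by
      refine mul_nonneg (sq_nonneg _) ?_
      nlinarith [mul_nonneg (by linarith : 0 ≤ 1 - β) (by linarith : 0 ≤ 1 / 2 + x),
        sq_nonneg (β - 1 / 2)]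
    nlinarith
  by_contra hcon
  rw [not_le] at hcon
  have hA : 0 < (1 + x) ^ β := Real.rpow_pos_of_pos hp _
  have : (1 + x) ^ β * (1 + (1 - β) * x) < (1 + β * x - 2 * x ^ 2) * (1 + (1 - β) * x) :=
    mul_lt_mul_of_pos_right hcon (by linarith)
  nlinarith [mul_le_mul_of_nonneg_left h hA.le]

theorem abs_rpow_mul_sub_one_le {β x : ℝ} (h0 : 0 < β) (h1 : β < 1) (hx : |x| ≤ 1 / 2) :
    |(1 + x) ^ β * (1 - β * x) - 1| ≤ 5 * x ^ 2 := by
  have hl := one_add_mul_sub_le_rpow h0 h1 hx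
  rw [abs_le] at hx
  have hu := rpow_one_add_le_one_add_mul_self (s := x) (p := β) (by linarith)
    h0.le h1.le
  have hb : 0 < 1 - β * x := by nlinarith
  have hb2 : 1 - β * x ≤ 2 := by nlinarith
  have hβ : β ^ 2 ≤ 1 := by nlinarith
  rw [abs_le]
  constructor
  · nlinarith [mul_le_mul_of_nonneg_right hl hb.le, mul_nonneg (sq_nonneg x)
      (sub_nonneg.2 hb2), mul_nonneg (sq_nonneg x) (sub_nonneg.2 hβ)]
  · nlinarith [mul_le_mul_of_nonneg_right hu hb.le, sq_nonneg (β * x), sq_nonneg x]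

/-- With `n` the integer part of `t - β/2`, exactly the terms `j ≤ n` survive the truncation, and
the sum is affine in `t` there. -/
theorem sum_fracCoeff_mul_max {β t : ℝ} (hβ : 0 < β) (n N : ℕ) (hn : n < N)
    (h1 : (n : ℝ) ≤ t - β / 2) (h2 : t - β / 2 < n + 1) :
    ∑ j ∈ range N, fracCoeff β j * max (t - j - β / 2) 0 =
      fracSum β n * (n + (t - β / 2 - n) * (β + 1)) / (β + 1) := by
  rw [← sum_range_add_sum_Ico _ (by omega : n + 1 ≤ N), sum_eq_zero (s := Ico _ _), add_zero]
  · have : ∑ j ∈ range (n + 1), fracCoeff β j * max (t - j - β / 2) 0 =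
        ∑ j ∈ range (n + 1), (fracCoeff β j * ((n : ℝ) - j) +
          fracCoeff β j * (t - β / 2 - n)) := by
      refine sum_congr rfl fun j hj => ?_
      have : (j : ℝ) ≤ n := Nat.cast_le.2 (by have := mem_range.1 hj; omega)
      rw [max_eq_left (by linarith)]
      ring
    rw [this, sum_add_distrib, ← sum_mul, sum_fracCoeff_mul hβ, ← fracSum]
    field_simp
  · intro j hj
    have : ((n + 1 : ℕ) : ℝ) ≤ j := Nat.cast_le.2 (mem_Ico.1 hj).1
    push_cast at this
    rw [max_eq_right (by linarith), mul_zero]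

/-- The Peano kernel of the shifted fractional quadrature decays like `t^{β - 1}`. -/
theorem abs_kernel_le {β : ℝ} (h0 : 0 < β) (h1 : β < 1) :
    ∃ C, 0 ≤ C ∧ ∀ (t : ℝ) (N : ℕ), 0 < t → t ≤ N →
      |∑ j ∈ range N, fracCoeff β j * max (t - j - β / 2) 0 -
        t ^ (β + 1) / Real.Gamma (β + 2)| ≤ C * t ^ (β - 1) := by
  have hG : 0 < Real.Gamma (β + 2) := Real.Gamma_pos_of_pos (by linarith)
  set G := Real.Gamma (β + 2) with hGdef
  refine ⟨max (2 * (4 + 4 / G)) (22 / G), by positivity, fun t N ht htN => ?_⟩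
  -- For `t < 2` only `j = 0, 1` contribute and `t^{β-1} ≥ 1/2`, so boundedness of both terms
  -- suffices.
  rcases lt_or_ge t 2 with ht2 | ht2
  · have hs : |∑ j ∈ range N, fracCoeff β j * max (t - j - β / 2) 0| ≤ 4 := by
      have hnn : ∀ j : ℕ, 0 ≤ fracCoeff β j * max (t - j - β / 2) 0 := fun j =>
        mul_nonneg (fracCoeff_nonneg h0.le j) (le_max_right _ _)
      rw [abs_of_nonneg (sum_nonneg fun j _ => hnn j)]
      calc _ ≤ ∑ j ∈ range (2 + N), fracCoeff β j * max (t - j - β / 2) 0 :=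
            sum_le_sum_of_subset_of_nonneg (range_mono (by omega)) fun j _ _ => hnn j
        _ = ∑ j ∈ range 2, fracCoeff β j * max (t - j - β / 2) 0 := by
            rw [← sum_range_add_sum_Ico _ (by omega : 2 ≤ 2 + N), sum_eq_zero (s := Ico _ _),
              add_zero]
            intro j hj
            have : ((2 : ℕ) : ℝ) ≤ j := Nat.cast_le.2 (mem_Ico.1 hj).1
            push_cast at this
            rw [max_eq_right (by linarith), mul_zero]
        _ ≤ 4 := by
            have m1 : max (t - ((0 : ℕ) : ℝ) - β / 2) 0 ≤ 2 :=
              max_le (by push_cast; linarith) (by norm_num)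
            have m2 : max (t - ((1 : ℕ) : ℝ) - β / 2) 0 ≤ 2 :=
              max_le (by push_cast; linarith) (by norm_num)
            rw [sum_range_succ, sum_range_one]
            have a1 : fracCoeff β 0 = 1 := rfl
            have a2 : fracCoeff β 1 = β := by simp [fracCoeff]
            rw [a1, a2]
            nlinarith [le_max_right (t - ((1 : ℕ) : ℝ) - β / 2) 0]
    have hp : |t ^ (β + 1) / G| ≤ 4 / G := by
      rw [abs_of_nonneg (by positivity)]
      gcongr
      calc t ^ (β + 1) ≤ 2 ^ (β + 1) := Real.rpow_le_rpow ht.le ht2.le (by linarith)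
        _ ≤ 2 ^ (2 : ℝ) := Real.rpow_le_rpow_of_exponent_le (by norm_num) (by linarith)
        _ = 4 := by norm_num
    have hq : 1 / 2 ≤ t ^ (β - 1) := by
      calc (1 / 2 : ℝ) = 2 ^ (-1 : ℝ) := by rw [Real.rpow_neg_one]; norm_num
        _ ≤ 2 ^ (β - 1) := Real.rpow_le_rpow_of_exponent_le (by norm_num) (by linarith)
        _ ≤ t ^ (β - 1) := Real.rpow_le_rpow_of_nonpos ht ht2.le (by linarith)
    calc _ ≤ 4 + 4 / G := (abs_sub _ _).trans (add_le_add hs hp)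
      _ = 2 * (4 + 4 / G) * (1 / 2) := by ring
      _ ≤ _ := by gcongr; exact le_max_left _ _
  · have hb : 0 ≤ t - β / 2 := by linarith
    -- The integer part is positive for `t ≥ 2`; `abs_logDefect_le` covers positive indices only.
    obtain ⟨n, hn⟩ : ∃ n : ℕ, ⌊t - β / 2⌋₊ = n + 1 :=
      Nat.exists_eq_succ_of_ne_zero (Nat.pos_iff_ne_zero.1 (Nat.floor_pos.2 (by linarith)))
    have l1 := Nat.floor_le hb
    have l2 := Nat.lt_floor_add_one (t - β / 2)
    rw [hn] at l1 l2
    have hnN : n + 1 < N := by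
      have : ((n + 1 : ℕ) : ℝ) < N := by linarith
      exact_mod_cast this
    rw [sum_fracCoeff_mul_max h0 (n + 1) N hnN l1 l2]
    have hc := Gamma_mul_fracSum h0 (n + 1)
    have hε := abs_logDefect_le h0 h1 n
    set ε := logDefect β (n + 1)
    have hGG : G = (β + 1) * Real.Gamma (1 + β) := by
      rw [hGdef, show β + 2 = (β + 1) + 1 by ring, Real.Gamma_add_one (by linarith),
        add_comm 1 β]
    set k : ℝ := ((n + 1 : ℕ) : ℝ) with hk
    have hk1 : 1 ≤ k := by rw [hk]; push_cast; linarith [(n.cast_nonneg : (0 : ℝ) ≤ n)]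
    rw [show (n : ℝ) + 1 = k by rw [hk]; push_cast; ring] at hε
    -- With `x = δ/t` the asymptotic base `k + (1 + β)/2` is `t (1 + x)` and the affine factor is `t
    -- (1 - β x)`. Their contributions cancel to first order in `x`, thanks to the node shift `β/2`,
    -- which leaves a relative error `O(t^{-2})`.
    set δ := 1 / 2 - (t - β / 2 - k) with hδ
    have hδ1 : |δ| ≤ 1 / 2 := by rw [hδ, abs_le]; constructor <;> linarith
    set x := δ / t with hx
    have hx1 : |x| ≤ 1 / 2 := by
      rw [hx, abs_div, abs_of_pos ht, div_le_iff₀ ht]; linarith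
    have hx2 : x ^ 2 ≤ 1 / 4 / t ^ 2 := by
      rw [hx, div_pow]
      gcongr
      rw [← sq_abs]
      nlinarith [abs_nonneg δ]
    have hε1 : |ε| ≤ 9 / t ^ 2 := by
      refine hε.trans ?_
      rw [div_le_div_iff₀ (by positivity) (by positivity)]
      nlinarith
    have hε2 : |ε| ≤ 1 := hε.trans (by rw [div_le_one (by positivity)]; nlinarith)
    have hexp := Real.abs_exp_sub_one_le hε2
    have hexp3 : Real.exp ε ≤ 3 := by
      linarith [(abs_le.1 hexp).2]
    have hM := abs_rpow_mul_sub_one_le h0 h1 hx1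
    set M := (1 + x) ^ β * (1 - β * x) with hMdef
    have hMe : |M * Real.exp ε - 1| ≤ 22 / t ^ 2 := by
      have : M * Real.exp ε - 1 = (M - 1) * Real.exp ε + (Real.exp ε - 1) := by ring
      rw [this]
      refine (abs_add_le _ _).trans ?_
      rw [abs_mul, abs_of_pos (Real.exp_pos ε)]
      calc _ ≤ (5 * (1 / 4 / t ^ 2)) * 3 + 2 * (9 / t ^ 2) := by
            gcongr
            · exact hM.trans (by gcongr)
            · exact hexp.trans (by gcongr)
        _ = (87 / 4) / t ^ 2 := by ring
        _ ≤ 22 / t ^ 2 := by gcongr; norm_num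
    have main : fracSum β (n + 1) * (k + (t - β / 2 - k) * (β + 1)) / (β + 1) -
        t ^ (β + 1) / G = t ^ (β + 1) / G * (M * Real.exp ε - 1) := by
      have e1 : k + (1 + β) / 2 = t * (1 + x) := by
        rw [hx]; field_simp; rw [hδ]; ring
      have e2 : k + (t - β / 2 - k) * (β + 1) = t * (1 - β * x) := by
        rw [hx]; field_simp; rw [hδ]; ring
      have e3 : 0 ≤ 1 + x := by linarith [(abs_le.1 hx1).1]
      have e4 : fracSum β (n + 1) = t ^ β * (1 + x) ^ β * Real.exp ε / Real.Gamma (1 + β) := by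
        rw [e1, Real.mul_rpow ht.le e3] at hc
        rw [← hc]
        have : 0 < Real.Gamma (1 + β) := Real.Gamma_pos_of_pos (by linarith)
        field_simp
      have : 0 < Real.Gamma (1 + β) := Real.Gamma_pos_of_pos (by linarith)
      rw [e2, e4, hGG, Real.rpow_add_one ht.ne', hMdef]
      field_simp
    rw [main, abs_mul, abs_of_nonneg (by positivity)]
    calc _ ≤ t ^ (β + 1) / G * (22 / t ^ 2) := by gcongr
      _ = 22 / G * t ^ (β - 1) := by
          rw [show β - 1 = β + 1 - (2 : ℕ) by push_cast; ring, Real.rpow_sub_natCast ht.ne']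
          ring
      _ ≤ _ := by gcongr; exact le_max_right _ _

end RieszWave

/-! ### Taylor estimates and second differences with one-sided derivatives -/

namespace RieszWave

open Set

/-- Taylor's formula with a crude remainder bound, for a chain of one-sided derivatives. -/
theorem abs_sub_taylor_le {a b M : ℝ} (n : ℕ) : ∀ F : ℕ → ℝ → ℝ,
    (∀ j < n, ∀ x ∈ Icc a b, HasDerivWithinAt (F j) (F (j + 1) x) (Icc a b) x) →
    (∀ x ∈ Icc a b, |F n x| ≤ M) → ∀ c d : ℝ, c ∈ Icc a b → c + d ∈ Icc a b →
    |F 0 (c + d) - ∑ j ∈ Finset.range n, F j c * d ^ j / (j.factorial : ℝ)| ≤ M * |d| ^ n := by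
  induction n with
  | zero => intro F _ hM c d _ hd; simpa using hM _ hd
  | succ n ih =>
    intro F hF hM c d hc hd
    have hM0 : 0 ≤ M := (abs_nonneg _).trans (hM c hc)
    have hseg : ∀ s ∈ Icc (0 : ℝ) 1, c + s * d ∈ Icc a b := by
      intro s hs
      have := (convex_Icc a b).add_smul_sub_mem hc hd hs
      simpa using this
    have hder : ∀ s ∈ Icc (0 : ℝ) 1, HasDerivWithinAt
        (fun s => F 0 (c + s * d) - ∑ j ∈ Finset.range (n + 1),
          F j c * (s * d) ^ j / (j.factorial : ℝ))
        (d * (F 1 (c + s * d) - ∑ j ∈ Finset.range n,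
          F (j + 1) c * (s * d) ^ j / (j.factorial : ℝ))) (Icc 0 1) s := by
      intro s hs
      have hlin : HasDerivWithinAt (fun s : ℝ => c + s * d) d (Icc 0 1) s := by
        simpa using (((hasDerivAt_id s).mul_const d).const_add c).hasDerivWithinAt
      have h1 : HasDerivWithinAt (fun s => F 0 (c + s * d)) (F 1 (c + s * d) * d) (Icc 0 1) s :=
        (hF 0 (by omega) _ (hseg s hs)).comp s hlin fun r hr => hseg r hr
      have h2 : HasDerivAt (fun s => ∑ j ∈ Finset.range (n + 1),
          F j c * (s * d) ^ j / (j.factorial : ℝ))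
          (∑ j ∈ Finset.range n, F (j + 1) c * (s * d) ^ j / (j.factorial : ℝ) * d) s := by
        have hs' : ∀ s, ∑ j ∈ Finset.range (n + 1), F j c * (s * d) ^ j / (j.factorial : ℝ) =
            ∑ j ∈ Finset.range n, F (j + 1) c * (s * d) ^ (j + 1) / ((j + 1).factorial : ℝ) +
              F 0 c := by
          intro s
          rw [Finset.sum_range_succ']
          simp
        simp only [hs']
        refine HasDerivAt.add_const _ (HasDerivAt.fun_sum fun j _ => ?_)
        have hp : HasDerivAt (fun s : ℝ => (s * d) ^ (j + 1))
            (((j + 1 : ℕ) : ℝ) * (s * d) ^ j * d) s := by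
          simpa using ((hasDerivAt_id s).mul_const d).fun_pow (j + 1)
        convert! (hp.const_mul (F (j + 1) c)).div_const ((j + 1).factorial : ℝ) using 1
        rw [Nat.factorial_succ]
        push_cast
        field_simp
      convert! h1.sub h2.hasDerivWithinAt using 1
      rw [← Finset.sum_mul]
      ring
    have hbd : ∀ s ∈ Ico (0 : ℝ) 1, ‖d * (F 1 (c + s * d) - ∑ j ∈ Finset.range n,
          F (j + 1) c * (s * d) ^ j / (j.factorial : ℝ))‖ ≤ M * |d| ^ (n + 1) := by
      intro s hs
      have := ih (fun j => F (j + 1)) (fun j hj => hF (j + 1) (by omega)) hM c (s * d) hc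
        (hseg s (Ico_subset_Icc_self hs))
      rw [Real.norm_eq_abs, abs_mul]
      have hsd : |s * d| ^ n ≤ |d| ^ n := by
        refine pow_le_pow_left₀ (abs_nonneg _) ?_ n
        rw [abs_mul, abs_of_nonneg hs.1]
        nlinarith [abs_nonneg d, hs.2]
      calc _ ≤ |d| * (M * |s * d| ^ n) := by gcongr
        _ ≤ |d| * (M * |d| ^ n) := by gcongr
        _ = _ := by ring
    -- Along the segment from `c` to `c + d` the derivative of the remainder is `d` times the
    -- remainder of `F 1` one order lower. The mean value inequality avoids integrals at the cost of
    -- the factorial in the constant.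
    have := norm_image_sub_le_of_norm_deriv_le_segment' hder hbd 1 (right_mem_Icc.2 zero_le_one)
    simp only [Real.norm_eq_abs, one_mul, zero_mul, add_zero, sub_zero, mul_one] at this
    have hz : ∑ j ∈ Finset.range (n + 1), F j c * (0 : ℝ) ^ j / (j.factorial : ℝ) = F 0 c := by
      rw [Finset.sum_range_succ']
      simp
    rwa [hz, sub_self, sub_zero] at this

section Differences

variable {a b M : ℝ} {F : ℕ → ℝ → ℝ}

theorem abs_sub_taylor_two_le
    (hF : ∀ j < 2, ∀ x ∈ Icc a b, HasDerivWithinAt (F j) (F (j + 1) x) (Icc a b) x)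
    (hM : ∀ x ∈ Icc a b, |F 2 x| ≤ M) {c d : ℝ} (hc : c ∈ Icc a b) (hd : c + d ∈ Icc a b) :
    |F 0 (c + d) - F 0 c - d * F 1 c| ≤ M * d ^ 2 := by
  have h := abs_sub_taylor_le 2 F hF hM c d hc hd
  rw [sq_abs] at h
  convert h using 2
  simp [Finset.sum_range_succ]
  ring

theorem abs_sub_taylor_three_le
    (hF : ∀ j < 3, ∀ x ∈ Icc a b, HasDerivWithinAt (F j) (F (j + 1) x) (Icc a b) x)
    (hM : ∀ x ∈ Icc a b, |F 3 x| ≤ M) {c d : ℝ} (hc : c ∈ Icc a b) (hd : c + d ∈ Icc a b) :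
    |F 0 (c + d) - F 0 c - d * F 1 c - d ^ 2 / 2 * F 2 c| ≤ M * |d| ^ 3 := by
  have h := abs_sub_taylor_le 3 F hF hM c d hc hd
  convert h using 2
  simp [Finset.sum_range_succ, Nat.factorial]
  ring

theorem abs_second_diff_le
    (hF : ∀ j < 2, ∀ x ∈ Icc a b, HasDerivWithinAt (F j) (F (j + 1) x) (Icc a b) x)
    (hM : ∀ x ∈ Icc a b, |F 2 x| ≤ M) {c d : ℝ} (hc : c ∈ Icc a b) (hd : c + d ∈ Icc a b)
    (hd' : c - d ∈ Icc a b) :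
    |F 0 (c + d) - 2 * F 0 c + F 0 (c - d)| ≤ 2 * M * d ^ 2 := by
  have h1 := abs_sub_taylor_two_le hF hM hc hd
  have h2 := abs_sub_taylor_two_le hF hM hc (d := -d) (by rwa [← sub_eq_add_neg])
  rw [← sub_eq_add_neg] at h2
  calc _ = |(F 0 (c + d) - F 0 c - d * F 1 c) + (F 0 (c - d) - F 0 c - -d * F 1 c)| := by
        congr 1; ring
    _ ≤ _ := (abs_add_le _ _).trans (add_le_add h1 h2)
    _ = _ := by ring

theorem abs_second_diff_sub_le
    (hF : ∀ j < 4, ∀ x ∈ Icc a b, HasDerivWithinAt (F j) (F (j + 1) x) (Icc a b) x)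
    (hM : ∀ x ∈ Icc a b, |F 4 x| ≤ M) {c d : ℝ} (hc : c ∈ Icc a b) (hd : c + d ∈ Icc a b)
    (hd' : c - d ∈ Icc a b) :
    |F 0 (c + d) - 2 * F 0 c + F 0 (c - d) - d ^ 2 * F 2 c| ≤ 2 * M * d ^ 4 := by
  have h1 := abs_sub_taylor_le 4 F hF hM c d hc hd
  have h2 := abs_sub_taylor_le 4 F hF hM c (-d) hc (by rwa [← sub_eq_add_neg])
  rw [← sub_eq_add_neg, abs_neg] at h2
  have e : |d| ^ 4 = d ^ 4 := by rw [← abs_pow, abs_of_nonneg (by positivity)]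
  rw [e] at h1 h2
  refine le_trans (le_of_eq ?_) ((abs_add_le _ _).trans ((add_le_add h1 h2).trans
    (le_of_eq (by ring))))
  congr 1
  simp [Finset.sum_range_succ, Nat.factorial]
  ring

end Differences

end RieszWave

/-! ### Riemann-Liouville integrals of functions vanishing on the negative half line -/

namespace RieszWave

open Set MeasureTheory Filter Topology intervalIntegral

theorem intervalIntegrable_sub_rpow_mul {q : ℝ} (hq : 0 < q) (x a b : ℝ) {p : ℝ → ℝ}
    (hp : Continuous p) :
    IntervalIntegrable (fun ξ => (x - ξ) ^ (q - 1) * p ξ) volume a b := by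
  have h : IntervalIntegrable (fun s : ℝ => s ^ (q - 1)) volume (x - a) (x - b) :=
    intervalIntegrable_rpow' (by linarith)
  have h2 := h.comp_sub_left x
  simp only [sub_sub_cancel] at h2
  exact h2.mul_continuousOn hp.continuousOn

/-- Integration by parts for the Riemann-Liouville integral. -/
theorem integral_sub_rpow_mul {q x : ℝ} (hq : 0 < q) (hx : 0 ≤ x) {p p' : ℝ → ℝ}
    (hp : ∀ y, HasDerivAt p (p' y) y) (hp' : Continuous p') (h0 : p 0 = 0) :
    ∫ ξ in (0 : ℝ)..x, (x - ξ) ^ (q - 1) * p ξ =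
      (∫ ξ in (0 : ℝ)..x, (x - ξ) ^ q * p' ξ) / q := by
  have hcp : Continuous p := continuous_iff_continuousAt.2 fun y => (hp y).continuousAt
  have hc : ContinuousOn (fun ξ : ℝ => (x - ξ) ^ q) (uIcc 0 x) :=
    ((continuous_const.sub continuous_id).rpow_const fun _ => Or.inr hq.le).continuousOn
  have h := integral_mul_deriv_eq_deriv_mul_of_hasDerivAt (a := 0) (b := x)
    (u := fun ξ : ℝ => (x - ξ) ^ q) (u' := fun ξ => -(q * (x - ξ) ^ (q - 1))) (v := p) (v' := p')
    hc hcp.continuousOn (fun ξ hξ => ?_) (fun ξ _ => hp ξ) ?_ (hp'.intervalIntegrable _ _)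
  · simp only [sub_self, Real.zero_rpow hq.ne', h0, mul_zero, zero_mul, neg_mul,
      intervalIntegral.integral_neg, sub_neg_eq_add, zero_add] at h
    rw [h]
    simp only [mul_assoc, intervalIntegral.integral_const_mul]
    field_simp
  · rw [min_eq_left hx, max_eq_right hx] at hξ
    have h1 : HasDerivAt (fun ξ : ℝ => x - ξ) (-1) ξ := by
      simpa using (hasDerivAt_id ξ).const_sub x
    have h2 := h1.rpow_const (p := q) (Or.inl (by linarith [hξ.2]))
    convert! h2 using 1
    ring
  · have := intervalIntegrable_sub_rpow_mul hq x 0 x (continuous_const (y := -q))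
    refine this.congr fun ξ _ => ?_
    ring

/-- Differentiation of the Riemann-Liouville integral of a function vanishing on `(-∞, 0]`. -/
theorem hasDerivAt_integral_sub_rpow_mul {q : ℝ} (hq : 0 < q) {p p' : ℝ → ℝ}
    (hp : ∀ y, HasDerivAt p (p' y) y) (hp' : Continuous p') (hz : ∀ y ≤ 0, p y = 0)
    (hz' : ∀ y ≤ 0, p' y = 0) {y : ℝ} (hy : 0 < y) :
    HasDerivAt (fun y => ∫ ξ in (0 : ℝ)..y, (y - ξ) ^ (q - 1) * p ξ)
      (∫ ξ in (0 : ℝ)..y, (y - ξ) ^ (q - 1) * p' ξ) y := by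
  have hcp : Continuous p := continuous_iff_continuousAt.2 fun y => (hp y).continuousAt
  set X := y + 1
  -- The substitution `s = z - ξ` fixes the singularity at `s = 0`, and vanishing of `r` on the
  -- negative side allows a fixed upper limit `X`. The parameter then occurs only in the smooth
  -- factor, and dominated differentiation applies.
  have hrep : ∀ r : ℝ → ℝ, Continuous r → (∀ y ≤ 0, r y = 0) → ∀ z ∈ Ioo 0 X,
      ∫ ξ in (0 : ℝ)..z, (z - ξ) ^ (q - 1) * r ξ =
        ∫ s in (0 : ℝ)..X, s ^ (q - 1) * r (z - s) := by
    intro r hr hr0 z hz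
    have hint : ∀ a b, IntervalIntegrable (fun s : ℝ => s ^ (q - 1) * r (z - s)) volume a b :=
      fun a b => (intervalIntegrable_rpow' (by linarith)).mul_continuousOn
        (hr.comp (continuous_const.sub continuous_id)).continuousOn
    have e1 := intervalIntegral.integral_comp_sub_left (a := 0) (b := z)
      (fun s : ℝ => s ^ (q - 1) * r (z - s)) z
    simp only [sub_sub_cancel, sub_self, sub_zero] at e1
    rw [e1, ← intervalIntegral.integral_add_adjacent_intervals (hint 0 z) (hint z X)]
    have e2 : ∫ s in z..X, s ^ (q - 1) * r (z - s) = ∫ s in z..X, (0 : ℝ) := by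
      refine intervalIntegral.integral_congr fun s hs => ?_
      rw [uIcc_of_le hz.2.le] at hs
      simp only [hr0 (z - s) (by linarith [hs.1]), mul_zero]
    rw [e2]
    simp
  have hyX : y ∈ Ioo 0 X := ⟨hy, by simp [X]⟩
  rw [hrep p' hp' hz' y hyX]
  obtain ⟨K, hK⟩ := (isCompact_Icc (a := y - 1 - X) (b := y + 1)).exists_bound_of_continuousOn
    hp'.continuousOn
  have hmain := hasDerivAt_integral_of_dominated_loc_of_deriv_le (μ := volume) (a := 0) (b := X)
    (F := fun z s => s ^ (q - 1) * p (z - s)) (F' := fun z s => s ^ (q - 1) * p' (z - s))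
    (x₀ := y) (s := Ioo (y - 1) (y + 1)) (bound := fun s => s ^ (q - 1) * K)
    (Ioo_mem_nhds (by linarith) (by linarith)) ?_ ?_ ?_ ?_ ?_ ?_
  · refine hmain.2.congr_of_eventuallyEq ?_
    filter_upwards [Ioo_mem_nhds hyX.1 hyX.2] with z hzz
    exact hrep p hcp hz z hzz
  · refine Eventually.of_forall fun z => ?_
    have : IntervalIntegrable (fun s : ℝ => s ^ (q - 1) * p (z - s)) volume 0 X :=
      (intervalIntegrable_rpow' (by linarith)).mul_continuousOn
        (hcp.comp (continuous_const.sub continuous_id)).continuousOn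
    exact (intervalIntegrable_iff.1 this).aestronglyMeasurable
  · exact (intervalIntegrable_rpow' (by linarith)).mul_continuousOn
        (hcp.comp (continuous_const.sub continuous_id)).continuousOn
  · have : IntervalIntegrable (fun s : ℝ => s ^ (q - 1) * p' (y - s)) volume 0 X :=
      (intervalIntegrable_rpow' (by linarith)).mul_continuousOn
        (hp'.comp (continuous_const.sub continuous_id)).continuousOn
    exact (intervalIntegrable_iff.1 this).aestronglyMeasurable
  · refine Eventually.of_forall fun s hs z hzz => ?_
    rw [uIoc_of_le (hyX.1.trans hyX.2).le] at hs
    rw [norm_mul, Real.norm_of_nonneg (Real.rpow_nonneg hs.1.le _)]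
    refine mul_le_mul_of_nonneg_left (hK _ ⟨?_, ?_⟩) (Real.rpow_nonneg hs.1.le _)
    · linarith [hzz.1, hs.2]
    · linarith [hzz.2, hs.1]
  · exact (intervalIntegrable_rpow' (by linarith)).mul_const K
  · refine Eventually.of_forall fun s _ z _ => ?_
    have := (hp (z - s)).comp z ((hasDerivAt_id z).sub_const s)
    simp only [mul_one] at this
    exact this.const_mul _

/-- A smooth function with its derivatives, vanishing on the negative half line. -/
structure VanishingJet (W : ℕ → ℝ → ℝ) (n : ℕ) : Prop where
  deriv : ∀ j < n, ∀ y, HasDerivAt (W j) (W (j + 1) y) y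
  cont : Continuous (W n)
  vanish : ∀ j ≤ n, ∀ y ≤ 0, W j y = 0

theorem VanishingJet.shift {W : ℕ → ℝ → ℝ} {n k : ℕ} (h : VanishingJet W (n + k)) :
    VanishingJet (fun j => W (j + k)) n where
  deriv j hj y := by
    have := h.deriv (j + k) (by omega) y
    rwa [show j + k + 1 = j + 1 + k by omega] at this
  cont := h.cont
  vanish j hj := h.vanish (j + k) (by omega)

theorem VanishingJet.continuous {W : ℕ → ℝ → ℝ} {n : ℕ} (h : VanishingJet W n) (j : ℕ)
    (hj : j ≤ n) : Continuous (W j) := by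
  rcases hj.lt_or_eq with hj | rfl
  · exact continuous_iff_continuousAt.2 fun y => (h.deriv j hj y).continuousAt
  · exact h.cont

theorem vanishingJet_iteratedDeriv {w : ℝ → ℝ} {n : ℕ} (hw : ContDiff ℝ n w)
    (h0 : ∀ x < 0, w x = 0) : VanishingJet (fun j => iteratedDeriv j w) n where
  deriv j hj y := by
    have := (hw.differentiable_iteratedDeriv j (by exact_mod_cast hj)).differentiableAt (x := y)
    rw [iteratedDeriv_succ]
    exact this.hasDerivAt
  cont := hw.continuous_iteratedDeriv n le_rfl
  vanish j hj := by
    have hc : Continuous (iteratedDeriv j w) := hw.continuous_iteratedDeriv j (by exact_mod_cast hj)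
    have hneg : ∀ y < 0, iteratedDeriv j w y = 0 := by
      intro y hy
      have he : w =ᶠ[𝓝 y] fun _ => (0 : ℝ) := by
        filter_upwards [Iio_mem_nhds hy] with z hz using h0 z hz
      rw [he.iteratedDeriv_eq j]
      simp
    intro y hy
    have hcl : closure (Iio (0 : ℝ)) ⊆ {y | iteratedDeriv j w y = 0} :=
      closure_minimal (fun z hz => hneg z hz) (isClosed_eq hc continuous_const)
    rw [closure_Iio] at hcl
    exact hcl hy

theorem floor_eq_one {α : ℝ} (h1 : 1 < α) (h2 : α < 2) : ⌊α⌋₊ = 1 := by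
  rw [Nat.floor_eq_iff (by linarith)]
  norm_num
  exact ⟨h1.le, h2⟩

/-- Both derivatives pass onto the function since it vanishes to the left of the origin; two
integrations by parts without boundary terms then trade two more derivatives for two powers of the
kernel, as the Peano argument requires. -/
theorem leftRL_eq {α : ℝ} (h1 : 1 < α) (h2 : α < 2) {W : ℕ → ℝ → ℝ} (hW : VanishingJet W 4)
    {x : ℝ} (hx : 0 < x) :
    leftRL α (W 0) x =
      (∫ s in (0 : ℝ)..x, (x - s) ^ (2 - α + 1) * W 4 s) / Real.Gamma (2 - α + 2) := by
  set β := 2 - α with hβ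
  have hβ0 : 0 < β := by rw [hβ]; linarith
  have hd : ∀ j < 2, ∀ y > 0, HasDerivAt
      (fun y => ∫ ξ in (0 : ℝ)..y, (y - ξ) ^ (β - 1) * W j ξ)
      (∫ ξ in (0 : ℝ)..y, (y - ξ) ^ (β - 1) * W (j + 1) ξ) y := fun j hj y hy =>
    hasDerivAt_integral_sub_rpow_mul hβ0 (hW.deriv j (by omega))
      (hW.continuous (j + 1) (by omega)) (hW.vanish j (by omega)) (hW.vanish (j + 1) (by omega)) hy
  have e : (((1 + 1 : ℕ) : ℝ) - α) = β := by rw [hβ]; norm_num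
  rw [leftRL, floor_eq_one h1 h2, e, iteratedDeriv_succ, iteratedDeriv_one]
  have hev : deriv (fun y => ∫ ξ in (0 : ℝ)..y, (y - ξ) ^ (β - 1) * W 0 ξ) =ᶠ[𝓝 x]
      fun y => ∫ ξ in (0 : ℝ)..y, (y - ξ) ^ (β - 1) * W 1 ξ := by
    filter_upwards [Ioi_mem_nhds hx] with y hy
    exact (hd 0 (by norm_num) y hy).deriv
  rw [hev.deriv_eq, (hd 1 (by norm_num) x hx).deriv,
    integral_sub_rpow_mul hβ0 hx.le (hW.deriv 2 (by norm_num)) (hW.continuous 3 (by norm_num))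
      (hW.vanish 2 (by norm_num) 0 le_rfl)]
  have e2 := integral_sub_rpow_mul (q := β + 1) (by linarith) hx.le (hW.deriv 3 (by norm_num))
    (hW.continuous 4 (by norm_num)) (hW.vanish 3 (by norm_num) 0 le_rfl)
  rw [add_sub_cancel_right] at e2
  rw [e2, show β + 2 = β + 1 + 1 by ring, Real.Gamma_add_one (by linarith),
    Real.Gamma_add_one hβ0.ne']
  have : 0 < Real.Gamma β := Real.Gamma_pos_of_pos hβ0
  field_simp

/-- Taylor's formula with integral remainder at the origin. The truncated kernel lets all nodes `y ≤
x` share one interval of integration. -/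
theorem eq_integral_max_mul {W : ℕ → ℝ → ℝ} (hW : VanishingJet W 2) {x y : ℝ} (hx : 0 ≤ x)
    (hy : y ≤ x) : W 0 y = ∫ s in (0 : ℝ)..x, max (y - s) 0 * W 2 s := by
  have hc2 := hW.cont
  rcases le_or_gt y 0 with h | h
  · rw [hW.vanish 0 (by norm_num) y h]
    have e0 : ∫ s in (0 : ℝ)..x, max (y - s) 0 * W 2 s = ∫ s in (0 : ℝ)..x, (0 : ℝ) := by
      refine intervalIntegral.integral_congr fun s hs => ?_
      rw [uIcc_of_le hx] at hs
      simp only [max_eq_right (show y - s ≤ 0 by linarith [hs.1]), zero_mul]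
    rw [e0]
    simp
  · have hint : ∀ a b, IntervalIntegrable (fun s => max (y - s) 0 * W 2 s) volume a b :=
      fun a b => (((continuous_const.sub continuous_id).max continuous_const).mul
        hc2).intervalIntegrable a b
    rw [← intervalIntegral.integral_add_adjacent_intervals (hint 0 y) (hint y x)]
    have e1 : ∫ s in y..x, max (y - s) 0 * W 2 s = ∫ s in y..x, (0 : ℝ) := by
      refine intervalIntegral.integral_congr fun s hs => ?_
      rw [uIcc_of_le hy] at hs
      simp only [max_eq_right (show y - s ≤ 0 by linarith [hs.1]), zero_mul]
    have e2 : ∫ s in (0 : ℝ)..y, max (y - s) 0 * W 2 s =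
        ∫ s in (0 : ℝ)..y, (y - s) * W 2 s := by
      refine intervalIntegral.integral_congr fun s hs => ?_
      rw [uIcc_of_le h.le] at hs
      simp only [max_eq_left (by linarith [hs.2] : 0 ≤ y - s)]
    have e3 : ∫ s in (0 : ℝ)..y, (y - s) * W 2 s =
        ((y - y) * W 1 y + W 0 y) - ((y - 0) * W 1 0 + W 0 0) := by
      refine intervalIntegral.integral_eq_sub_of_hasDerivAt
        (f := fun s => (y - s) * W 1 s + W 0 s) (fun s _ => ?_)
        (((continuous_const.sub continuous_id).mul hc2).intervalIntegrable _ _)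
      have := (((hasDerivAt_id s).const_sub y).mul (hW.deriv 1 (by norm_num) s)).add
        (hW.deriv 0 (by norm_num) s)
      convert! this using 1
      simp only [id_eq]
      ring
    rw [e1, e2, e3, hW.vanish 1 (by norm_num) 0 le_rfl, hW.vanish 0 (by norm_num) 0 le_rfl]
    simp

end RieszWave

/-! ### Second order consistency of the one-sided operators -/

namespace RieszWave

open Set MeasureTheory

theorem deltaPlus_eq {α h : ℝ} (hh : 0 < h) {w : ℝ → ℝ} (hw : ∀ x < 0, w x = 0) (i : ℕ) :
    deltaPlus α h (fun j => w (j * h)) i =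
      h ^ (2 - α) * ∑ j ∈ Finset.range (i + 2), fracCoeff (2 - α) j *
        ((α / 2 * (w ((i + 1) * h - j * h) - 2 * w ((i + 1) * h - h - j * h) +
            w ((i + 1) * h - h - h - j * h)) +
          (2 - α) / 2 * (w ((i + 1) * h - h - j * h) - 2 * w ((i + 1) * h - h - h - j * h) +
            w ((i + 1) * h - h - h - h - j * h))) / h ^ 2) := by
  have e1 : ∑ m ∈ Finset.range (i + 2), phiCoeff α m * w (((i + 1 - m : ℕ) : ℝ) * h) =
      ∑ m ∈ Finset.range (i + 1 + 1), phiCoeff α m * w ((i + 1) * h - m * h) := by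
    refine Finset.sum_congr rfl fun m hm => ?_
    have := Finset.mem_range.1 hm
    rw [Nat.cast_sub (by omega)]
    push_cast
    congr 2
    ring
  have hneg : ∀ c : ℝ, 0 < c → w ((i + 1) * h - c * h - ((i + 1 : ℕ) : ℝ) * h) = 0 := by
    intro c hc
    refine hw _ ?_
    push_cast
    nlinarith
  have h1 := hneg 1 (by norm_num)
  have h2 := hneg 2 (by norm_num)
  have h3 := hneg 3 (by norm_num)
  rw [show ((i : ℝ) + 1) * h - 1 * h = (i + 1) * h - h by ring] at h1
  rw [show ((i : ℝ) + 1) * h - 2 * h = (i + 1) * h - h - h by ring] at h2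
  rw [show ((i : ℝ) + 1) * h - 3 * h = (i + 1) * h - h - h - h by ring] at h3
  rw [deltaPlus, e1, sum_phiCoeff_mul α w h _ (i + 1) h1 h2 h3, Finset.mul_sum, Finset.mul_sum]
  have e2 : h ^ (2 - α) = h ^ 2 / h ^ α := by
    rw [Real.rpow_sub hh, Real.rpow_two]
  refine Finset.sum_congr rfl fun j _ => ?_
  have : 0 < h ^ α := by positivity
  rw [e2]
  field_simp

/-- The total mass of the quadrature weights on a bounded interval stays bounded as `h → 0`, so
pointwise errors are not amplified. -/
theorem rpow_mul_fracSum_le {β L : ℝ} (h0 : 0 < β) (h1 : β < 1) (hL : 0 < L) :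
    ∃ C, 0 ≤ C ∧ ∀ h : ℝ, 0 < h → ∀ i : ℕ, 1 ≤ i → (i + 1) * h ≤ L →
      h ^ β * fracSum β (i + 1) ≤ C := by
  obtain ⟨C, hC, hp⟩ := fracSum_le h0 h1
  refine ⟨C * (2 * L) ^ β, by positivity, fun h hh i _ hL' => ?_⟩
  calc _ ≤ h ^ β * (C * (((i + 1 : ℕ) : ℝ) + 1) ^ β) := by gcongr; exact hp _
    _ = C * (h * (((i + 1 : ℕ) : ℝ) + 1)) ^ β := by
        rw [Real.mul_rpow hh.le (by positivity)]; ring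
    _ ≤ _ := by
        have : h * (((i + 1 : ℕ) : ℝ) + 1) ≤ 2 * L := by
          push_cast
          nlinarith [(i.cast_nonneg : (0 : ℝ) ≤ i)]
        gcongr

theorem abs_sum_fracCoeff_mul_le {β h K : ℝ} (h0 : 0 < β) (hh : 0 < h) (n : ℕ) (E : ℕ → ℝ)
    (hE : ∀ j ∈ Finset.range (n + 1), |E j| ≤ K) :
    |h ^ β * ∑ j ∈ Finset.range (n + 1), fracCoeff β j * E j| ≤ h ^ β * fracSum β n * K := by
  rw [abs_mul, abs_of_nonneg (by positivity), mul_assoc, fracSum, Finset.sum_mul]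
  refine mul_le_mul_of_nonneg_left ?_ (by positivity)
  refine (Finset.abs_sum_le_sum_abs _ _).trans (Finset.sum_le_sum fun j hj => ?_)
  rw [abs_mul, abs_of_nonneg (fracCoeff_nonneg h0.le j)]
  exact mul_le_mul_of_nonneg_left (hE j hj) (fracCoeff_nonneg h0.le j)

/-- `δ_{x,+}^α` is bounded by second differences. -/
theorem abs_deltaPlus_le {α L : ℝ} (h1 : 1 < α) (h2 : α < 2) (hL : 0 < L) :
    ∃ C, 0 ≤ C ∧ ∀ w : ℝ → ℝ, (∀ x < 0, w x = 0) → ∀ M h : ℝ, 0 < h → 0 ≤ M →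
      (∀ y ≤ L - h, -(3 * L) ≤ y - h → |w (y + h) - 2 * w y + w (y - h)| ≤ M * h ^ 2) →
      ∀ i : ℕ, 1 ≤ i → (i + 1) * h ≤ L → |deltaPlus α h (fun j => w (j * h)) i| ≤ C * M := by
  obtain ⟨C, hC, hp⟩ := rpow_mul_fracSum_le (β := 2 - α) (by linarith) (by linarith) hL
  refine ⟨C, hC, fun w hw M h hh hM hD i hi hiL => ?_⟩
  rw [deltaPlus_eq hh hw]
  refine (abs_sum_fracCoeff_mul_le (K := M) (by linarith) hh (i + 1) _ fun j hj => ?_).trans ?_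
  · have hj0 : (0 : ℝ) ≤ j * h := by positivity
    have hi1 : (1 : ℝ) ≤ i := by exact_mod_cast hi
    have hj1 : (j : ℝ) * h ≤ (i + 1) * h := by
      have : (j : ℝ) ≤ i + 1 := by
        have := Finset.mem_range.1 hj
        exact_mod_cast (by omega : j ≤ i + 1)
      gcongr
    have d1 := hD ((i + 1) * h - h - j * h) (by linarith) (by nlinarith)
    have d2 := hD ((i + 1) * h - h - h - j * h) (by linarith) (by nlinarith)
    rw [show (i + 1) * h - h - j * h + h = (i + 1) * h - j * h by ring,
      show (i + 1) * h - h - j * h - h = (i + 1) * h - h - h - j * h by ring] at d1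
    rw [show (i + 1) * h - h - h - j * h + h = (i + 1) * h - h - j * h by ring,
      show (i + 1) * h - h - h - j * h - h = (i + 1) * h - h - h - h - j * h by ring] at d2
    rw [abs_div, abs_of_pos (by positivity : 0 < h ^ 2), div_le_iff₀ (by positivity)]
    refine (abs_add_le _ _).trans ?_
    rw [abs_mul, abs_mul, abs_of_pos (by linarith : 0 < α / 2),
      abs_of_pos (by linarith : 0 < (2 - α) / 2)]
    nlinarith
  · exact mul_le_mul_of_nonneg_right (hp h hh i hi hiL) hM

theorem integral_sub_rpow {q x : ℝ} (hq : 0 < q) :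
    ∫ s in (0 : ℝ)..x, (x - s) ^ (q - 1) = x ^ q / q := by
  have := intervalIntegral.integral_comp_sub_left (a := 0) (b := x) (fun s : ℝ => s ^ (q - 1)) x
  rw [this, sub_self, sub_zero, integral_rpow (Or.inl (by linarith)), sub_add_cancel,
    Real.zero_rpow hq.ne', sub_zero]

/-- The shifted fractional quadrature rule is of second order. -/
theorem abs_quadrature_sub_le {β : ℝ} (h0 : 0 < β) (h1 : β < 1) :
    ∃ C, 0 ≤ C ∧ ∀ V : ℕ → ℝ → ℝ, VanishingJet V 2 → ∀ M h : ℝ, 0 < h → ∀ i : ℕ, 1 ≤ i →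
      (∀ x ≤ i * h, |V 2 x| ≤ M) →
      |h ^ β * ∑ j ∈ Finset.range (i + 2), fracCoeff β j * V 0 (i * h - j * h - β / 2 * h) -
        (∫ s in (0 : ℝ)..i * h, (i * h - s) ^ (β + 1) * V 2 s) / Real.Gamma (β + 2)| ≤
      C * (i * h) ^ β * M * h ^ 2 := by
  obtain ⟨C, hC, hK⟩ := abs_kernel_le h0 h1
  refine ⟨C / β, by positivity, fun V hV M h hh i hi hM => ?_⟩
  have hi0 : (0 : ℝ) < i := by exact_mod_cast hi
  set x : ℝ := i * h with hx
  have hx0 : 0 < x := by positivity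
  have hM0 : 0 ≤ M := (abs_nonneg _).trans (hM x le_rfl)
  have hc := hV.cont
  have hsum : h ^ β * ∑ j ∈ Finset.range (i + 2),
      fracCoeff β j * V 0 (x - j * h - β / 2 * h) =
      ∫ s in (0 : ℝ)..x, (h ^ β * ∑ j ∈ Finset.range (i + 2),
        fracCoeff β j * max (x - j * h - β / 2 * h - s) 0) * V 2 s := by
    have : ∀ j ∈ Finset.range (i + 2), IntervalIntegrable
        (fun s => fracCoeff β j * (max (x - j * h - β / 2 * h - s) 0 * V 2 s)) volume 0 x := by
      intro j _
      exact (continuous_const.mul (((continuous_const.sub continuous_id).max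
        continuous_const).mul hc)).intervalIntegrable _ _
    simp only [mul_assoc, Finset.sum_mul, intervalIntegral.integral_const_mul]
    rw [intervalIntegral.integral_finsetSum this]
    congr 1
    refine Finset.sum_congr rfl fun j _ => ?_
    rw [intervalIntegral.integral_const_mul, ← eq_integral_max_mul hV hx0.le]
    have : (0 : ℝ) ≤ j * h := by positivity
    nlinarith
  have hint1 : IntervalIntegrable (fun s => (h ^ β * ∑ j ∈ Finset.range (i + 2),
        fracCoeff β j * max (x - j * h - β / 2 * h - s) 0) * V 2 s) volume 0 x := by
    refine Continuous.intervalIntegrable ?_ _ _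
    refine (continuous_const.mul (continuous_finsetSum _ fun j _ => continuous_const.mul
      ((continuous_const.sub continuous_id).max continuous_const))).mul hc
  have hint2 : IntervalIntegrable (fun s => (x - s) ^ (β + 1) * V 2 s / Real.Gamma (β + 2))
      volume 0 x := by
    have := intervalIntegrable_sub_rpow_mul (q := β + 2) (by linarith) x 0 x hc
    rw [show β + 2 - 1 = β + 1 by ring] at this
    exact this.div_const _
  rw [hsum, ← intervalIntegral.integral_div, ← intervalIntegral.integral_sub hint1 hint2]
  have hbd := intervalIntegral.norm_integral_le_of_norm_le (μ := volume) (a := 0) (b := x)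
    (f := fun s => (h ^ β * ∑ j ∈ Finset.range (i + 2),
        fracCoeff β j * max (x - j * h - β / 2 * h - s) 0) * V 2 s -
          (x - s) ^ (β + 1) * V 2 s / Real.Gamma (β + 2))
    (g := fun s => C * M * h ^ 2 * (x - s) ^ (β - 1)) hx0.le ?_ ?_
  · rw [intervalIntegral.integral_const_mul, integral_sub_rpow h0] at hbd
    refine hbd.trans (le_of_eq ?_)
    ring
  -- The kernel bound needs `t = (x - s)/h > 0`, so the endpoint is discarded. Rescaling turns `C
  -- t^{β-1}` into `C h^2 (x - s)^{β-1}`, which is integrable.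
  · have hne : ∀ᵐ s ∂(volume : Measure ℝ), s ≠ x := by
      simp [ae_iff, measure_singleton]
    filter_upwards [hne] with s hsx hs
    have hts : 0 < (x - s) / h := div_pos (sub_pos.2 (lt_of_le_of_ne hs.2 hsx)) hh
    have htN : (x - s) / h ≤ ((i + 2 : ℕ) : ℝ) := by
      rw [div_le_iff₀ hh]
      push_cast
      nlinarith [hs.1]
    have hk := hK ((x - s) / h) (i + 2) hts htN
    have hxs : 0 < x - s := sub_pos.2 (lt_of_le_of_ne hs.2 hsx)
    have hmax : ∀ j : ℕ, max (x - j * h - β / 2 * h - s) 0 =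
        h * max ((x - s) / h - j - β / 2) 0 := by
      intro j
      rw [mul_max_of_nonneg _ _ hh.le, mul_zero]
      congr 1
      field_simp
      ring
    have e1 : (h ^ β * ∑ j ∈ Finset.range (i + 2),
        fracCoeff β j * max (x - j * h - β / 2 * h - s) 0) * V 2 s -
          (x - s) ^ (β + 1) * V 2 s / Real.Gamma (β + 2) =
        h ^ (β + 1) * (∑ j ∈ Finset.range (i + 2),
          fracCoeff β j * max ((x - s) / h - j - β / 2) 0 -
          ((x - s) / h) ^ (β + 1) / Real.Gamma (β + 2)) * V 2 s := by
      simp only [hmax]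
      have : ∑ j ∈ Finset.range (i + 2), fracCoeff β j * (h * max ((x - s) / h - j - β / 2) 0) =
          h * ∑ j ∈ Finset.range (i + 2), fracCoeff β j * max ((x - s) / h - j - β / 2) 0 := by
        rw [Finset.mul_sum]
        exact Finset.sum_congr rfl fun j _ => by ring
      rw [this, Real.div_rpow hxs.le hh.le, Real.rpow_add_one hh.ne']
      have : 0 < h ^ β := by positivity
      generalize ∑ j ∈ Finset.range (i + 2),
        fracCoeff β j * max ((x - s) / h - j - β / 2) 0 = S
      field_simp
    rw [e1, Real.norm_eq_abs, abs_mul, abs_mul, abs_of_pos (by positivity : 0 < h ^ (β + 1))]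
    have e2 : h ^ (β + 1) * (C * ((x - s) / h) ^ (β - 1)) * M = C * M * h ^ 2 * (x - s) ^ (β - 1) := by
      rw [Real.div_rpow hxs.le hh.le, show β + 1 = (β - 1) + (2 : ℕ) by push_cast; ring,
        Real.rpow_add_natCast hh.ne']
      have : 0 < h ^ (β - 1) := by positivity
      field_simp
    rw [← e2]
    refine mul_le_mul (mul_le_mul_of_nonneg_left hk (by positivity)) (hM s hs.2) (abs_nonneg _) ?_
    exact mul_nonneg (by positivity) (mul_nonneg hC (by positivity))
  · have := intervalIntegrable_sub_rpow_mul h0 x 0 x (continuous_const (y := (1 : ℝ)))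
    simp only [mul_one] at this
    exact this.const_mul _

theorem abs_combination_le {μ K B e₁ e₂ e₃ e₄ : ℝ} (h0 : 0 ≤ μ) (h1 : μ ≤ 1) (hK : 0 ≤ K)
    (h₁ : |e₁| ≤ 2 * K) (h₂ : |e₂| ≤ 2 * K) (h₃ : |e₃| ≤ K) (h₄ : |e₄| ≤ K) (hB : B = 4 * K) :
    |(1 - μ) * e₁ + μ * e₂ + μ * e₃ - e₄| ≤ B := by
  have a1 : |(1 - μ) * e₁| ≤ (1 - μ) * (2 * K) := by
    rw [abs_mul, abs_of_nonneg (sub_nonneg.2 h1)]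
    exact mul_le_mul_of_nonneg_left h₁ (sub_nonneg.2 h1)
  have a2 : |μ * e₂| ≤ μ * (2 * K) := by
    rw [abs_mul, abs_of_nonneg h0]
    exact mul_le_mul_of_nonneg_left h₂ h0
  have a3 : |μ * e₃| ≤ μ * K := by
    rw [abs_mul, abs_of_nonneg h0]
    exact mul_le_mul_of_nonneg_left h₃ h0
  have a4 : μ * K ≤ K := mul_le_of_le_one_left hK h1
  refine (abs_sub _ _).trans ((add_le_add_left ((abs_add_le _ _).trans
    (add_le_add_left (abs_add_le _ _) _)) _).trans ?_)
  linarith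

/-- Second order consistency of `δ_{x,+}^α` with the left Riemann-Liouville derivative. -/
theorem abs_deltaPlus_sub_leftRL_le {α L : ℝ} (h1 : 1 < α) (h2 : α < 2) (hL : 0 < L) :
    ∃ C, 0 ≤ C ∧ ∀ W : ℕ → ℝ → ℝ, VanishingJet W 4 → ∀ M : ℝ, (∀ x ≤ L, |W 4 x| ≤ M) →
      ∀ h : ℝ, 0 < h → ∀ i : ℕ, 1 ≤ i → (i + 1) * h ≤ L →
      |deltaPlus α h (fun j => W 0 (j * h)) i - leftRL α (W 0) (i * h)| ≤ C * M * h ^ 2 := by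
  set β := 2 - α with hβ
  have hβ0 : 0 < β := by rw [hβ]; linarith
  have hβ1 : β < 1 := by rw [hβ]; linarith
  obtain ⟨C₁, hC₁, hp⟩ := rpow_mul_fracSum_le hβ0 hβ1 hL
  obtain ⟨C₂, hC₂, hq⟩ := abs_quadrature_sub_le hβ0 hβ1
  refine ⟨C₁ * 4 + C₂ * L ^ β, by positivity, fun W hW M hM h hh i hi hiL => ?_⟩
  have hi1 : (1 : ℝ) ≤ i := by exact_mod_cast hi
  have hM0 : 0 ≤ M := (abs_nonneg _).trans (hM L le_rfl)
  have hx0 : 0 < (i : ℝ) * h := by positivity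
  have hV : VanishingJet (fun j => W (j + 2)) 2 := hW.shift (n := 2) (k := 2)
  have hq' := hq _ hV M h hh i hi fun x hx => hM x (by linarith)
  rw [← leftRL_eq h1 h2 hW hx0] at hq'
  have hw0 : ∀ x < 0, W 0 x = 0 := fun x hx => hW.vanish 0 (by norm_num) x hx.le
  have hdiff : |deltaPlus α h (fun j => W 0 (j * h)) i -
      h ^ β * ∑ j ∈ Finset.range (i + 2), fracCoeff β j * W 2 (i * h - j * h - β / 2 * h)| ≤
      C₁ * (4 * M * h ^ 2) := by
    rw [deltaPlus_eq hh hw0, ← hβ, ← mul_sub, ← Finset.sum_sub_distrib]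
    simp only [← mul_sub]
    refine (abs_sum_fracCoeff_mul_le (K := 4 * M * h ^ 2) hβ0 hh (i + 1) _ fun j _ => ?_).trans
      (mul_le_mul_of_nonneg_right (hp h hh i hi hiL) (by positivity))
    have hj0 : (0 : ℝ) ≤ j * h := by positivity
    -- The second differences are centred at `y - h` and `y - 2h`. With weights `1 - β/2` and `β/2`
    -- their mean position is `y - h - β h/2`, the quadrature node; hence the first-order terms
    -- cancel in `hid`, leaving four Taylor errors.
    set y := (i + 1) * h - j * h with hy
    have hyL : y ≤ L := by linarith
    have hF : ∀ j < 4, ∀ x ∈ Icc (y - 3 * h) y,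
        HasDerivWithinAt (W j) (W (j + 1) x) (Icc (y - 3 * h) y) x :=
      fun j hj x _ => (hW.deriv j hj x).hasDerivWithinAt
    have hF2 : ∀ j < 2, ∀ x ∈ Icc (y - 3 * h) y,
        HasDerivWithinAt (W (j + 2)) (W (j + 1 + 2) x) (Icc (y - 3 * h) y) x :=
      fun j hj x _ => (hV.deriv j hj x).hasDerivWithinAt
    have hMs : ∀ x ∈ Icc (y - 3 * h) y, |W 4 x| ≤ M := fun x hx => hM x (hx.2.trans hyL)
    have t1 := abs_second_diff_sub_le hF hMs (c := y - h) (d := h)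
      ⟨by linarith, by linarith⟩ ⟨by linarith, by linarith⟩ ⟨by linarith, by linarith⟩
    have t2 := abs_second_diff_sub_le hF hMs (c := y - 2 * h) (d := h)
      ⟨by linarith, by linarith⟩ ⟨by linarith, by linarith⟩ ⟨by linarith, by linarith⟩
    have t3 := abs_sub_taylor_two_le (F := fun j => W (j + 2)) hF2 hMs (c := y - h) (d := -h)
      ⟨by linarith, by linarith⟩ ⟨by linarith, by linarith⟩
    have t4 := abs_sub_taylor_two_le (F := fun j => W (j + 2)) hF2 hMs (c := y - h)
      (d := -(β / 2 * h)) ⟨by linarith, by linarith⟩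
      ⟨by nlinarith, by nlinarith⟩
    simp only [zero_add, Nat.reduceAdd] at t3 t4
    rw [show y - h + h = y by ring, show y - h - h = y - 2 * h by ring] at t1
    rw [show y - 2 * h + h = y - h by ring, show y - 2 * h - h = y - 3 * h by ring] at t2
    rw [show y - h + -h = y - 2 * h by ring] at t3
    rw [show (i + 1) * h - h - j * h = y - h by rw [hy]; ring,
      show (i + 1) * h - h - h - j * h = y - 2 * h by rw [hy]; ring,
      show (i + 1) * h - h - h - h - j * h = y - 3 * h by rw [hy]; ring,
      show (i : ℝ) * h - j * h - β / 2 * h = y - h + -(β / 2 * h) by rw [hy]; ring,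
      show α / 2 = 1 - β / 2 by rw [hβ]; ring]
    set d1 := W 0 y - 2 * W 0 (y - h) + W 0 (y - 2 * h) with hd1
    set d2 := W 0 (y - h) - 2 * W 0 (y - 2 * h) + W 0 (y - 3 * h) with hd2
    have hid : ((1 - β / 2) * d1 + β / 2 * d2) / h ^ 2 - W 2 (y - h + -(β / 2 * h)) =
        (1 - β / 2) * ((d1 - h ^ 2 * W 2 (y - h)) / h ^ 2) +
        β / 2 * ((d2 - h ^ 2 * W 2 (y - 2 * h)) / h ^ 2) +
        β / 2 * (W 2 (y - 2 * h) - W 2 (y - h) - -h * W 3 (y - h)) -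
        (W 2 (y - h + -(β / 2 * h)) - W 2 (y - h) - -(β / 2 * h) * W 3 (y - h)) := by
      field_simp
      ring
    have s1 : |(d1 - h ^ 2 * W 2 (y - h)) / h ^ 2| ≤ 2 * M * h ^ 2 := by
      rw [abs_div, abs_of_pos (by positivity : 0 < h ^ 2), div_le_iff₀ (by positivity)]
      exact t1.trans (le_of_eq (by ring))
    have s2 : |(d2 - h ^ 2 * W 2 (y - 2 * h)) / h ^ 2| ≤ 2 * M * h ^ 2 := by
      rw [abs_div, abs_of_pos (by positivity : 0 < h ^ 2), div_le_iff₀ (by positivity)]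
      exact t2.trans (le_of_eq (by ring))
    have hK : 0 ≤ M * h ^ 2 := by positivity
    have s3 : (-h) ^ 2 = h ^ 2 := by ring
    have s4 : M * (-(β / 2 * h)) ^ 2 ≤ M * h ^ 2 := by
      have : (-(β / 2 * h)) ^ 2 = (β / 2) ^ 2 * h ^ 2 := by ring
      rw [this]
      have : (β / 2) ^ 2 ≤ 1 := by nlinarith
      nlinarith [mul_nonneg hK (sub_nonneg.2 this)]
    rw [s3] at t3
    rw [hid]
    exact abs_combination_le (by linarith) (by linarith) hK (by linarith) (by linarith)
      t3 (t4.trans s4) (by ring)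
  calc _ = |(deltaPlus α h (fun j => W 0 (j * h)) i -
      h ^ β * ∑ j ∈ Finset.range (i + 2), fracCoeff β j * W 2 (i * h - j * h - β / 2 * h)) +
      (h ^ β * ∑ j ∈ Finset.range (i + 2), fracCoeff β j * W 2 (i * h - j * h - β / 2 * h) -
        leftRL α (W 0) (i * h))| := by congr 1; ring
    _ ≤ C₁ * (4 * M * h ^ 2) + C₂ * (i * h) ^ β * M * h ^ 2 :=
        (abs_add_le _ _).trans (add_le_add hdiff hq')
    _ ≤ C₁ * (4 * M * h ^ 2) + C₂ * L ^ β * M * h ^ 2 := by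
        gcongr
        linarith
    _ = _ := by ring

end RieszWave

/-! ### The Riesz derivative by reflection, and the classical case `α = 2` -/

namespace RieszWave

open Set MeasureTheory Filter Topology

theorem deltaMinus_eq_deltaPlus (α h : ℝ) (N : ℕ) (v : ℕ → ℝ) (i : ℕ) (h1 : 1 ≤ i) (h2 : i < N) :
    deltaMinus α h N v i = deltaPlus α h (fun j => v (N - j)) (N - i) := by
  rw [deltaMinus, deltaPlus]
  congr 1
  refine Finset.sum_congr rfl fun m hm => ?_
  have := Finset.mem_range.1 hm
  congr 2
  omega

theorem deltaPlus_congr {α h : ℝ} {v w : ℕ → ℝ} {i : ℕ} (hvw : ∀ j ≤ i + 1, v j = w j) :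
    deltaPlus α h v i = deltaPlus α h w i := by
  rw [deltaPlus, deltaPlus]
  congr 1
  exact Finset.sum_congr rfl fun m _ => by rw [hvw _ (by omega)]

theorem deltaMinus_grid_eq {α h xr : ℝ} {N : ℕ} (hN : xr = N * h) (w : ℝ → ℝ) (i : ℕ)
    (h1 : 1 ≤ i) (h2 : i < N) :
    deltaMinus α h N (fun j => w (j * h)) i =
      deltaPlus α h (fun j => w (xr - j * h)) (N - i) := by
  rw [deltaMinus_eq_deltaPlus α h N _ i h1 h2]
  refine deltaPlus_congr fun j hj => ?_
  rw [Nat.cast_sub (by omega), hN]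
  congr 1
  ring

/-- Reflection about the midpoint exchanges the two integrals, and the sign from differentiating `xr
- y` cancels the factor `(-1)^n`. -/
theorem rightRL_eq_leftRL (α xr : ℝ) (v : ℝ → ℝ) (x : ℝ) :
    rightRL α xr v x = leftRL α (fun y => v (xr - y)) (xr - x) := by
  have e : (fun y => ∫ ξ in y..xr, (ξ - y) ^ (((⌊α⌋₊ + 1 : ℕ) : ℝ) - α - 1) * v ξ) =
      fun y => (fun z => ∫ ξ in (0 : ℝ)..z, (z - ξ) ^ (((⌊α⌋₊ + 1 : ℕ) : ℝ) - α - 1) *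
        v (xr - ξ)) (xr - y) := by
    funext y
    have := intervalIntegral.integral_comp_sub_left (a := 0) (b := xr - y)
      (fun ξ => (ξ - y) ^ (((⌊α⌋₊ + 1 : ℕ) : ℝ) - α - 1) * v ξ) xr
    rw [sub_sub_cancel, sub_zero] at this
    rw [← this]
    refine intervalIntegral.integral_congr fun ξ _ => ?_
    congr 2
    ring
  have e' := iteratedDeriv_comp_const_sub (n := ⌊α⌋₊ + 1) (s := xr) (f := fun z =>
    ∫ ξ in (0 : ℝ)..z, (z - ξ) ^ (((⌊α⌋₊ + 1 : ℕ) : ℝ) - α - 1) * v (xr - ξ))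
  rw [rightRL, leftRL, e, e']
  simp only [smul_eq_mul]
  have : ((-1 : ℝ) ^ (⌊α⌋₊ + 1)) * (-1) ^ (⌊α⌋₊ + 1) = 1 := by
    rw [← mul_pow]; norm_num
  rw [div_mul_eq_mul_div, ← mul_assoc, this]
  ring

theorem leftRL_congr {α xr : ℝ} {v w : ℝ → ℝ} (hvw : ∀ y ∈ Icc 0 xr, v y = w y) {x : ℝ}
    (hx : x ∈ Ioo 0 xr) : leftRL α v x = leftRL α w x := by
  rw [leftRL, leftRL]
  congr 1
  refine EventuallyEq.iteratedDeriv_eq _ ?_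
  filter_upwards [Ioo_mem_nhds hx.1 hx.2] with y hy
  refine intervalIntegral.integral_congr fun ξ hξ => ?_
  rw [uIcc_of_le hy.1.le] at hξ
  simp only [hvw ξ ⟨hξ.1, hξ.2.trans hy.2.le⟩]

theorem rieszDeriv_congr {α xr : ℝ} {v w : ℝ → ℝ} (hvw : ∀ y ∈ Icc 0 xr, v y = w y) {x : ℝ}
    (hx : x ∈ Ioo 0 xr) : rieszDeriv α xr v x = rieszDeriv α xr w x := by
  rw [rieszDeriv, rieszDeriv, rightRL_eq_leftRL, rightRL_eq_leftRL, leftRL_congr hvw hx]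
  congr 2
  exact leftRL_congr (xr := xr)
    (fun y hy => hvw _ ⟨by linarith [hy.2], by linarith [hy.1]⟩)
    ⟨by linarith [hx.2], by linarith [hx.1]⟩

/-- Second order consistency of `∇_h^α` with the Riesz derivative, for `α < 2`. -/
theorem abs_nabla_sub_rieszDeriv_le {α xr : ℝ} (h1 : 1 < α) (h2 : α < 2) (hxr : 0 < xr) :
    ∃ C, 0 ≤ C ∧ ∀ w : ℝ → ℝ, ContDiff ℝ 4 w → (∀ x < 0, w x = 0) → (∀ x > xr, w x = 0) →
      ∀ M : ℝ, (∀ x, |iteratedDeriv 4 w x| ≤ M) → ∀ (N : ℕ) (h : ℝ), 0 < h → xr = N * h →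
      ∀ i : ℕ, 1 ≤ i → i < N →
      |nabla α h N (fun j => w (j * h)) i - rieszDeriv α xr w (i * h)| ≤ C * M * h ^ 2 := by
  obtain ⟨C, hC, hp⟩ := abs_deltaPlus_sub_leftRL_le h1 h2 hxr
  refine ⟨|kappa α| * (2 * C), by positivity, fun w hw hw0 hw1 M hM N h hh hN i hi hiN => ?_⟩
  have hiN' : ((i + 1 : ℕ) : ℝ) ≤ N := by exact_mod_cast hiN
  push_cast at hiN'
  have b1 := hp _ (vanishingJet_iteratedDeriv hw hw0) M (fun x _ => hM x) h hh i hi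
    (by rw [hN]; gcongr)
  have hwr : ContDiff ℝ 4 fun y => w (xr - y) := hw.comp (contDiff_const.sub contDiff_id)
  have b2 := hp _ (vanishingJet_iteratedDeriv hwr fun x hx => hw1 _ (by linarith)) M
    (fun x _ => by
      simp only [iteratedDeriv_comp_const_sub]
      norm_num
      exact hM _) h hh (N - i) (by omega)
    (by
      rw [hN, Nat.cast_sub hiN.le]
      have : (1 : ℝ) ≤ i := by exact_mod_cast hi
      nlinarith)
  simp only [iteratedDeriv_zero] at b1 b2
  rw [Nat.cast_sub hiN.le, sub_mul, ← hN, ← rightRL_eq_leftRL,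
    ← deltaMinus_grid_eq hN w i hi hiN] at b2
  have e : nabla α h N (fun j => w (j * h)) i - rieszDeriv α xr w (i * h) =
      -kappa α * ((deltaPlus α h (fun j => w (j * h)) i - leftRL α w (i * h)) +
        (deltaMinus α h N (fun j => w (j * h)) i - rightRL α xr w (i * h))) := by
    rw [nabla, rieszDeriv]; ring
  rw [e, abs_mul, abs_neg]
  calc _ ≤ |kappa α| * (C * M * h ^ 2 + C * M * h ^ 2) := by
        gcongr
        exact (abs_add_le _ _).trans (add_le_add b1 b2)
    _ = _ := by ring

/-- `∇_h^α` is bounded by second differences, for `α < 2`. -/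
theorem abs_nabla_le {α xr : ℝ} (h1 : 1 < α) (h2 : α < 2) (hxr : 0 < xr) :
    ∃ C, 0 ≤ C ∧ ∀ w : ℝ → ℝ, (∀ x < 0, w x = 0) → (∀ x > xr, w x = 0) →
      ∀ M : ℝ, 0 ≤ M → ∀ (N : ℕ) (h : ℝ), 0 < h → xr = N * h →
      (∀ y, -(4 * xr) ≤ y - h → y + h ≤ 5 * xr →
        |w (y + h) - 2 * w y + w (y - h)| ≤ M * h ^ 2) →
      ∀ i : ℕ, 1 ≤ i → i < N → |nabla α h N (fun j => w (j * h)) i| ≤ C * M := by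
  obtain ⟨C, hC, hp⟩ := abs_deltaPlus_le h1 h2 hxr
  refine ⟨|kappa α| * (2 * C), by positivity, fun w hw0 hw1 M hM N h hh hN hD i hi hiN => ?_⟩
  have hiN' : ((i + 1 : ℕ) : ℝ) ≤ N := by exact_mod_cast hiN
  push_cast at hiN'
  have b1 := hp w hw0 M h hh hM (fun y hy hy' => hD y (by linarith) (by linarith)) i hi
    (by rw [hN]; gcongr)
  have b2 := hp (fun y => w (xr - y)) (fun x hx => hw1 _ (by linarith)) M h hh hM
    (fun y hy hy' => by
      have := hD (xr - y) (by linarith) (by linarith)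
      rw [show xr - (y + h) = xr - y - h by ring, show xr - (y - h) = xr - y + h by ring]
      convert this using 2
      ring) (N - i) (by omega)
    (by
      rw [hN, Nat.cast_sub hiN.le]
      have : (1 : ℝ) ≤ i := by exact_mod_cast hi
      nlinarith)
  rw [← deltaMinus_grid_eq hN w i hi hiN] at b2
  rw [nabla, abs_mul, abs_neg]
  calc _ ≤ |kappa α| * (C * M + C * M) := by
        gcongr
        exact (abs_add_le _ _).trans (add_le_add b1 b2)
    _ = _ := by ring

theorem phiCoeff_two_add_three (m : ℕ) : phiCoeff 2 (m + 3) = 0 := by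
  have hg : ∀ m : ℕ, gCoeff 2 (m + 3) = 0 := by
    intro m
    induction m with
    | zero => simp [gCoeff]; norm_num
    | succ m ih => rw [gCoeff, ih, mul_zero]
  rw [phiCoeff, hg]
  norm_num

theorem deltaPlus_two (h : ℝ) (v : ℕ → ℝ) (i : ℕ) (hi : 1 ≤ i) :
    deltaPlus 2 h v i = (v (i + 1) - 2 * v i + v (i - 1)) / h ^ 2 := by
  obtain ⟨k, rfl⟩ : ∃ k, i = k + 1 := ⟨i - 1, by omega⟩
  have p0 : phiCoeff 2 0 = 1 := by simp [phiCoeff, gCoeff]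
  have p1 : phiCoeff 2 1 = -2 := by simp [phiCoeff, gCoeff]
  have p2 : phiCoeff 2 2 = 1 := by simp [phiCoeff, gCoeff]; norm_num
  rw [deltaPlus, Real.rpow_two, show k + 1 + 2 = k + 3 by omega, Finset.sum_range_succ',
    Finset.sum_range_succ', Finset.sum_range_succ', Finset.sum_eq_zero fun j _ => ?_]
  · simp only [zero_add, Nat.reduceAdd, p0, p1, p2, Nat.add_sub_cancel, Nat.sub_zero]
    rw [show k + 1 + 1 - 2 = k by omega]
    ring
  · rw [show j + 1 + 1 + 1 = j + 3 by omega, phiCoeff_two_add_three, zero_mul]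

theorem kappa_two : kappa 2 = -1 / 2 := by
  rw [kappa, show (2 : ℝ) * Real.pi / 2 = Real.pi by ring, Real.cos_pi]
  norm_num

theorem nabla_two (h : ℝ) (N : ℕ) (v : ℕ → ℝ) (i : ℕ) (hi : 1 ≤ i) (hiN : i < N) :
    nabla 2 h N v i = (v (i + 1) - 2 * v i + v (i - 1)) / h ^ 2 := by
  rw [nabla, deltaMinus_eq_deltaPlus 2 h N v i hi hiN, deltaPlus_two h v i hi,
    deltaPlus_two h _ (N - i) (by omega), kappa_two]
  rw [show N - (N - i + 1) = i - 1 by omega, show N - (N - i) = i by omega,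
    show N - (N - i - 1) = i + 1 by omega]
  ring

/-- Here `n = 3` and the kernel exponent is zero, so the integral is a plain primitive
differentiated three times. No vanishing at the end points is needed. -/
theorem leftRL_two {xr : ℝ} {F : ℕ → ℝ → ℝ}
    (hF : ∀ j < 2, ∀ x ∈ Icc 0 xr, HasDerivWithinAt (F j) (F (j + 1) x) (Icc 0 xr) x)
    {x : ℝ} (hx : x ∈ Ioo 0 xr) : leftRL 2 (F 0) x = F 2 x := by
  have hd : ∀ j < 2, ∀ y ∈ Ioo 0 xr, HasDerivAt (F j) (F (j + 1) y) y := fun j hj y hy =>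
    (hF j hj y ⟨hy.1.le, hy.2.le⟩).hasDerivAt (Icc_mem_nhds hy.1 hy.2)
  have hc : ContinuousOn (F 0) (Icc 0 xr) := fun y hy => (hF 0 (by norm_num) y hy).continuousWithinAt
  have hcI : ContinuousOn (F 0) (Ioo 0 xr) := hc.mono Ioo_subset_Icc_self
  have e2 : ⌊(2 : ℝ)⌋₊ = 2 := by norm_num
  have e3 : (((2 + 1 : ℕ) : ℝ) - 2) = 1 := by norm_num
  have hI : ∀ y ∈ Ioo 0 xr, HasDerivAt (fun z => ∫ ξ in (0 : ℝ)..z, F 0 ξ) (F 0 y) y := by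
    intro y hy
    refine intervalIntegral.integral_hasDerivAt_right ?_ ?_ (hd 0 (by norm_num) y hy).continuousAt
    · refine (hc.mono ?_).intervalIntegrable
      rw [uIcc_of_le hy.1.le]
      exact Icc_subset_Icc le_rfl hy.2.le
    · exact hcI.stronglyMeasurableAtFilter isOpen_Ioo y hy
  rw [leftRL, e2, e3, sub_self, Real.Gamma_one]
  simp only [Real.rpow_zero, one_mul, div_one]
  rw [iteratedDeriv_succ']
  have h1 : deriv (fun z => ∫ ξ in (0 : ℝ)..z, F 0 ξ) =ᶠ[𝓝 x] F 0 := by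
    filter_upwards [Ioo_mem_nhds hx.1 hx.2] with y hy using (hI y hy).deriv
  have h2 : deriv (F 0) =ᶠ[𝓝 x] F 1 := by
    filter_upwards [Ioo_mem_nhds hx.1 hx.2] with y hy using (hd 0 (by norm_num) y hy).deriv
  rw [h1.iteratedDeriv_eq, iteratedDeriv_succ, iteratedDeriv_one, h2.deriv_eq,
    (hd 1 (by norm_num) x hx).deriv]

/-- The Riesz derivative of order two is the second derivative. -/
theorem rieszDeriv_two {xr : ℝ} {F : ℕ → ℝ → ℝ}
    (hF : ∀ j < 2, ∀ x ∈ Icc 0 xr, HasDerivWithinAt (F j) (F (j + 1) x) (Icc 0 xr) x)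
    {x : ℝ} (hx : x ∈ Ioo 0 xr) : rieszDeriv 2 xr (F 0) x = F 2 x := by
  have hmaps : MapsTo (fun y => xr - y) (Icc 0 xr) (Icc 0 xr) := fun y hy =>
    ⟨by linarith [hy.2], by linarith [hy.1]⟩
  have hR := leftRL_two (xr := xr) (F := fun j y => (-1) ^ j * F j (xr - y)) (fun j hj y hy => by
    have h1 : HasDerivWithinAt (fun y => xr - y) (-1) (Icc 0 xr) y := by
      simpa using ((hasDerivAt_id y).const_sub xr).hasDerivWithinAt
    have h2 := ((hF j hj (xr - y) (hmaps hy)).comp y h1 hmaps).const_mul ((-1) ^ j)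
    convert! h2 using 1
    ring) (x := xr - x) ⟨by linarith [hx.2], by linarith [hx.1]⟩
  simp only [pow_zero, one_mul, sub_sub_cancel] at hR
  rw [rieszDeriv, rightRL_eq_leftRL, leftRL_two hF hx, hR, kappa_two]
  norm_num
  ring

end RieszWave

/-! ### Partial derivatives of the solution and consistency along it -/

namespace RieszWave

open Set Filter Topology

/-- The directional derivative within a set. -/
noncomputable def dirDerivWithin (S : Set (ℝ × ℝ)) (e : ℝ × ℝ) (F : ℝ × ℝ → ℝ) : ℝ × ℝ → ℝ :=
  fun p => fderivWithin ℝ F S p e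

theorem contDiffOn_dirDerivWithin {S : Set (ℝ × ℝ)} (hS : UniqueDiffOn ℝ S) (e : ℝ × ℝ)
    {F : ℝ × ℝ → ℝ} {n : ℕ} (hF : ContDiffOn ℝ (n + 1 : ℕ) F S) :
    ContDiffOn ℝ n (dirDerivWithin S e F) S :=
  (hF.fderivWithin hS (by norm_cast)).clm_apply contDiffOn_const

theorem contDiffOn_iterate_dirDerivWithin {S : Set (ℝ × ℝ)} (hS : UniqueDiffOn ℝ S) (e : ℝ × ℝ)
    {F : ℝ × ℝ → ℝ} {n : ℕ} (k : ℕ) (hF : ContDiffOn ℝ (n + k : ℕ) F S) :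
    ContDiffOn ℝ n ((dirDerivWithin S e)^[k] F) S := by
  induction k generalizing F with
  | zero => exact hF
  | succ k ih =>
    rw [Function.iterate_succ_apply]
    exact ih (contDiffOn_dirDerivWithin hS e hF)

/-- The mixed partial derivatives of a `C⁴` function on a closed rectangle. -/
theorem exists_partialDerivs {l r T : ℝ} (hlr : l < r) (hT : 0 < T) {F : ℝ × ℝ → ℝ}
    (hF : ContDiffOn ℝ 4 F (Icc l r ×ˢ Icc 0 T)) :
    ∃ P : ℕ → ℕ → ℝ → ℝ → ℝ, (∀ x t, P 0 0 x t = F (x, t)) ∧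
      (∀ i j, i + j < 4 → ∀ x ∈ Icc l r, ∀ t ∈ Icc 0 T,
        HasDerivWithinAt (fun x => P i j x t) (P (i + 1) j x t) (Icc l r) x) ∧
      (∀ j < 4, ∀ x ∈ Icc l r, ∀ t ∈ Icc 0 T,
        HasDerivWithinAt (fun t => P 0 j x t) (P 0 (j + 1) x t) (Icc 0 T) t) ∧
      ∃ K, 0 ≤ K ∧ ∀ i j, i + j ≤ 4 → ∀ x ∈ Icc l r, ∀ t ∈ Icc 0 T, |P i j x t| ≤ K := by
  set S := Icc l r ×ˢ Icc 0 T with hSdef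
  have hS : UniqueDiffOn ℝ S := (uniqueDiffOn_Icc hlr).prod (uniqueDiffOn_Icc hT)
  have hcomp : IsCompact S := isCompact_Icc.prod isCompact_Icc
  -- Time derivatives are taken first, space derivatives afterwards. The chain in `t` is claimed
  -- only for `i = 0`, so symmetry of mixed derivatives is never needed.
  set Q : ℕ → ℕ → ℝ × ℝ → ℝ := fun i j =>
    (dirDerivWithin S (1, 0))^[i] ((dirDerivWithin S (0, 1))^[j] F) with hQ
  have hsm : ∀ i j n, n + i + j = 4 → ContDiffOn ℝ (n : ℕ) (Q i j) S := by
    intro i j n h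
    refine contDiffOn_iterate_dirDerivWithin hS _ i
      (contDiffOn_iterate_dirDerivWithin hS _ j ?_)
    rw [h]
    exact_mod_cast hF
  have hdiff : ∀ i j, i + j < 4 → DifferentiableOn ℝ (Q i j) S := by
    intro i j h
    refine (hsm i j (4 - i - j) (by omega)).differentiableOn ?_
    have : 4 - i - j ≠ 0 := by omega
    exact_mod_cast this
  refine ⟨fun i j x t => Q i j (x, t), fun x t => rfl, fun i j h x hx t ht => ?_,
    fun j h x hx t ht => ?_, ?_⟩
  · have h1 := (hdiff i j h (x, t) ⟨hx, ht⟩).hasFDerivWithinAt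
    have h2 : HasDerivWithinAt (fun x : ℝ => (x, t)) (1, 0) (Icc l r) x :=
      ((hasDerivAt_id x).prodMk (hasDerivAt_const x t)).hasDerivWithinAt
    have hm : MapsTo (fun x : ℝ => (x, t)) (Icc l r) S := fun y hy => ⟨hy, ht⟩
    have h3 := h1.comp_hasDerivWithinAt x h2 hm
    convert! h3 using 1
    simp only [hQ, Function.iterate_succ_apply']
    rfl
  · have h1 := (hdiff 0 j (by omega) (x, t) ⟨hx, ht⟩).hasFDerivWithinAt
    have h2 : HasDerivWithinAt (fun t : ℝ => (x, t)) (0, 1) (Icc 0 T) t :=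
      ((hasDerivAt_const t x).prodMk (hasDerivAt_id t)).hasDerivWithinAt
    have hm : MapsTo (fun t : ℝ => (x, t)) (Icc 0 T) S := fun s hs => ⟨hx, hs⟩
    have h3 := h1.comp_hasDerivWithinAt t h2 hm
    convert! h3 using 1
    simp only [hQ, Function.iterate_succ_apply', Function.iterate_zero, id_eq]
    rfl
  · have hb : ∀ q : ℕ × ℕ, ∃ K, q.1 + q.2 ≤ 4 → ∀ p ∈ S, |Q q.1 q.2 p| ≤ K := by
      intro q
      by_cases hq : q.1 + q.2 ≤ 4
      · obtain ⟨K, hK⟩ := hcomp.exists_bound_of_continuousOn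
          (hsm q.1 q.2 (4 - q.1 - q.2) (by omega)).continuousOn
        exact ⟨K, fun _ p hp => hK p hp⟩
      · exact ⟨0, fun h => absurd h hq⟩
    choose K hK using hb
    refine ⟨∑ q ∈ Finset.range 5 ×ˢ Finset.range 5, |K q|,
      Finset.sum_nonneg fun _ _ => abs_nonneg _, fun i j h x hx t ht => ?_⟩
    refine (hK (i, j) h (x, t) ⟨hx, ht⟩).trans ((le_abs_self _).trans ?_)
    exact Finset.single_le_sum (f := fun q => |K q|) (fun _ _ => abs_nonneg _)
      (Finset.mem_product.2 ⟨Finset.mem_range.2 (by simp; omega),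
        Finset.mem_range.2 (by simp; omega)⟩)

theorem iteratedDeriv_eq_of_chain {l r : ℝ} {n : ℕ} {F : ℕ → ℝ → ℝ}
    (hF : ∀ j < n, ∀ x ∈ Icc l r, HasDerivWithinAt (F j) (F (j + 1) x) (Icc l r) x) {x : ℝ}
    (hx : x ∈ Ioo l r) : ∀ j ≤ n, iteratedDeriv j (F 0) x = F j x := by
  intro j
  induction j generalizing x with
  | zero => intro _; simp
  | succ j ih =>
    intro hj
    rw [iteratedDeriv_succ]
    have : iteratedDeriv j (F 0) =ᶠ[𝓝 x] F j := by
      filter_upwards [Ioo_mem_nhds hx.1 hx.2] with y hy using ih hy (by omega)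
    rw [this.deriv_eq]
    exact ((hF j (by omega) x ⟨hx.1.le, hx.2.le⟩).hasDerivAt (Icc_mem_nhds hx.1 hx.2)).deriv

/-- The time derivatives of the solution, and the consistency of `∇_h^α` on it. -/
theorem exists_time_derivs {α xr T : ℝ} (h1 : 1 < α) (h2 : α ≤ 2) (hxr : 0 < xr) (hT : 0 < T)
    {u : ℝ → ℝ → ℝ} (hu : ContDiffOn ℝ 4 (fun p : ℝ × ℝ => u p.1 p.2) (Icc 0 xr ×ˢ Icc 0 T))
    (hz : α < 2 → ContDiffOn ℝ 4 (zeroExt xr u) (univ ×ˢ Icc 0 T)) :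
    ∃ V : ℕ → ℝ → ℝ → ℝ, ∃ K, 0 ≤ K ∧
      (∀ x ∈ Icc 0 xr, ∀ t, V 0 x t = u x t) ∧
      (∀ j < 4, ∀ x ∈ Icc 0 xr, ∀ t ∈ Icc 0 T,
        HasDerivWithinAt (V j x) (V (j + 1) x t) (Icc 0 T) t) ∧
      (∀ j ≤ 4, ∀ x ∈ Icc 0 xr, ∀ t ∈ Icc 0 T, |V j x t| ≤ K) ∧
      (∀ (N : ℕ) (h : ℝ), 0 < h → xr = N * h → ∀ i, 1 ≤ i → i < N → ∀ t ∈ Icc 0 T,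
        |nabla α h N (fun k => V 0 (k * h) t) i - rieszDeriv α xr (fun y => u y t) (i * h)| ≤
          K * h ^ 2) ∧
      (∀ (N : ℕ) (h : ℝ), 0 < h → xr = N * h → ∀ i, 1 ≤ i → i < N → ∀ t ∈ Icc 0 T,
        |nabla α h N (fun k => V 2 (k * h) t) i| ≤ K) := by
  rcases h2.lt_or_eq with h2 | rfl
  -- The enlarged rectangle leaves room for the stencil points that fall outside `[0, xr]` on either
  -- side.
  · have hlr : -(4 * xr) < 5 * xr := by linarith
    obtain ⟨P, hP0, hPx, hPt, K, hK, hPK⟩ := exists_partialDerivs hlr hT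
      ((hz h2).mono (prod_mono_left (subset_univ _)))
    obtain ⟨C₁, hC₁, hc⟩ := abs_nabla_sub_rieszDeriv_le h1 h2 hxr
    obtain ⟨C₂, hC₂, hb⟩ := abs_nabla_le h1 h2 hxr
    have hsub : Icc 0 xr ⊆ Icc (-(4 * xr)) (5 * xr) := Icc_subset_Icc (by linarith) (by linarith)
    have hu0 : ∀ x ∈ Icc 0 xr, ∀ t, P 0 0 x t = u x t := by
      intro x hx t
      rw [hP0, zeroExt, if_pos hx]
    have hzero : ∀ j ≤ 4, ∀ x ∈ Icc (-(4 * xr)) (5 * xr), x ∉ Icc 0 xr → ∀ t ∈ Icc 0 T,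
        P 0 j x t = 0 := by
      intro j
      induction j with
      | zero => intro _ x _ hx t _; rw [hP0, zeroExt, if_neg hx]
      | succ j ih =>
        intro hj x hx hx' t ht
        have hd := hPt j (by omega) x hx t ht
        have hd0 : HasDerivWithinAt (fun t => P 0 j x t) 0 (Icc 0 T) t :=
          (hasDerivWithinAt_const t (Icc 0 T) (0 : ℝ)).congr
            (fun s hs => ih (by omega) x hx hx' s hs) (ih (by omega) x hx hx' t ht)
        exact (uniqueDiffOn_Icc hT t ht).eq_deriv _ hd hd0
    refine ⟨P 0, max K (max (C₁ * K) (C₂ * (2 * K))), le_max_of_le_left hK, hu0,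
      fun j hj x hx t ht => hPt j hj x (hsub hx) t ht,
      fun j hj x hx t ht => (hPK 0 j (by omega) x (hsub hx) t ht).trans (le_max_left _ _),
      fun N h hh hN i hi hiN t ht => ?_, fun N h hh hN i hi hiN t ht => ?_⟩
    · have hw : ContDiff ℝ 4 fun x => zeroExt xr u (x, t) := by
        rw [← contDiffOn_univ]
        exact (hz h2).comp (contDiff_id.prodMk contDiff_const).contDiffOn fun x _ => ⟨mem_univ _, ht⟩
      have hw0 : ∀ x, x ∉ Icc 0 xr → zeroExt xr u (x, t) = 0 := fun x hx => by
        rw [zeroExt, if_neg hx]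
      have hM : ∀ x, |iteratedDeriv 4 (fun x => zeroExt xr u (x, t)) x| ≤ K := by
        intro x
        by_cases hx : x ∈ Icc 0 xr
        · have hx' : x ∈ Ioo (-(4 * xr)) (5 * xr) := ⟨by linarith [hx.1], by linarith [hx.2]⟩
          have e := iteratedDeriv_eq_of_chain (n := 4) (F := fun j x => P j 0 x t)
            (fun j hj y hy => hPx j 0 (by omega) y hy t ht) hx' 4 le_rfl
          simp only [hP0] at e
          rw [e]
          exact hPK 4 0 (by norm_num) x (hsub hx) t ht
        · have he : (fun x => zeroExt xr u (x, t)) =ᶠ[𝓝 x] fun _ => (0 : ℝ) := by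
            filter_upwards [isClosed_Icc.isOpen_compl.mem_nhds hx] with y hy using hw0 y hy
          rw [he.iteratedDeriv_eq]
          simpa using hK
      have := hc _ hw (fun x hx => hw0 x fun h => by linarith [h.1])
        (fun x hx => hw0 x fun h => by linarith [h.2]) K hM N h hh hN i hi hiN
      have hx : (i : ℝ) * h ∈ Ioo 0 xr := by
        have h1 : (0 : ℝ) < i := by exact_mod_cast hi
        have h2 : (i : ℝ) < N := by exact_mod_cast hiN
        exact ⟨by positivity, by rw [hN]; gcongr⟩
      rw [rieszDeriv_congr (v := fun y => u y t) (w := fun x => zeroExt xr u (x, t))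
        (fun y hy => by simp only [zeroExt, if_pos hy]) hx]
      simp only [hP0]
      refine this.trans (mul_le_mul_of_nonneg_right ?_ (by positivity))
      exact (le_max_left _ _).trans (le_max_right _ _)
    · classical
      -- `abs_nabla_le` asks for vanishing on the whole exterior, while `P` is controlled only on
      -- the rectangle; the two functions agree there by `hzero`.
      set w : ℝ → ℝ := fun x => if x ∈ Icc 0 xr then P 0 2 x t else 0 with hw
      have hwP : ∀ x ∈ Icc (-(4 * xr)) (5 * xr), w x = P 0 2 x t := by
        intro x hx
        by_cases hx' : x ∈ Icc 0 xr
        · simp only [hw, if_pos hx']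
        · simp only [hw, if_neg hx', hzero 2 (by norm_num) x hx hx' t ht]
      have := hb w (fun x hx => if_neg fun h => by linarith [h.1])
        (fun x hx => if_neg fun h => by linarith [h.2]) (2 * K) (by positivity) N h hh hN
        (fun y hy1 hy2 => by
          have m1 : y ∈ Icc (-(4 * xr)) (5 * xr) := ⟨by linarith, by linarith⟩
          have m2 : y + h ∈ Icc (-(4 * xr)) (5 * xr) := ⟨by linarith, by linarith⟩
          have m3 : y - h ∈ Icc (-(4 * xr)) (5 * xr) := ⟨by linarith, by linarith⟩
          rw [hwP _ m1, hwP _ m2, hwP _ m3]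
          exact abs_second_diff_le (F := fun j x => P j 2 x t)
            (fun j hj z hz => hPx j 2 (by omega) z hz t ht)
            (fun z hz => hPK 2 2 (by norm_num) z hz t ht) m1 m2 m3) i hi hiN
      have e : nabla α h N (fun k => P 0 2 (k * h) t) i = nabla α h N (fun k => w (k * h)) i := by
        have hk : ∀ k : ℕ, k ≤ N → P 0 2 (k * h) t = w (k * h) := by
          intro k hk
          refine (hwP _ (hsub ⟨by positivity, ?_⟩)).symm
          rw [hN]
          gcongr
        rw [nabla, nabla, deltaMinus_eq_deltaPlus _ _ _ _ i hi hiN,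
          deltaMinus_eq_deltaPlus _ _ _ _ i hi hiN, deltaPlus_congr fun j hj => hk j (by omega)]
        congr 2
        exact deltaPlus_congr fun j hj => hk (N - j) (by omega)
      rw [e]
      exact this.trans ((le_max_right _ _).trans (le_max_right _ _))
  · obtain ⟨P, hP0, hPx, hPt, K, hK, hPK⟩ := exists_partialDerivs hxr hT hu
    refine ⟨P 0, 2 * K, by positivity, fun x _ t => hP0 x t, hPt,
      fun j hj x hx t ht => (hPK 0 j (by omega) x hx t ht).trans (by linarith),
      fun N h hh hN i hi hiN t ht => ?_, fun N h hh hN i hi hiN t ht => ?_⟩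
    all_goals
      have hi0 : (1 : ℝ) ≤ i := by exact_mod_cast hi
      have hiN0 : (i : ℝ) + 1 ≤ N := by exact_mod_cast hiN
      have m1 : (i : ℝ) * h ∈ Icc 0 xr := ⟨by positivity, by rw [hN]; gcongr⟩
      have m2 : (i : ℝ) * h + h ∈ Icc 0 xr := ⟨by positivity, by rw [hN]; nlinarith⟩
      have m3 : (i : ℝ) * h - h ∈ Icc 0 xr := ⟨by nlinarith, by rw [hN]; nlinarith⟩
      have e1 : ((i + 1 : ℕ) : ℝ) * h = i * h + h := by push_cast; ring
      have e2 : ((i - 1 : ℕ) : ℝ) * h = i * h - h := by rw [Nat.cast_sub hi]; push_cast; ring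
      rw [nabla_two h N _ i hi hiN, e1, e2]
    · have hI : (i : ℝ) * h ∈ Ioo 0 xr := ⟨by positivity, by rw [hN]; nlinarith⟩
      have hr := rieszDeriv_two (F := fun j x => P j 0 x t)
        (fun j hj z hz => hPx j 0 (by omega) z hz t ht) hI
      simp only [hP0] at hr
      rw [hr]
      have := abs_second_diff_sub_le (F := fun j x => P j 0 x t)
            (fun j hj z hz => hPx j 0 (by omega) z hz t ht)
            (fun z hz => hPK 4 0 (by norm_num) z hz t ht) m1 m2 m3
      have hh2 : 0 < h ^ 2 := by positivity
      rw [div_sub' hh2.ne', abs_div, abs_of_pos hh2, div_le_iff₀ hh2]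
      exact this.trans (le_of_eq (by ring))
    · have := abs_second_diff_le (F := fun j x => P j 2 x t)
            (fun j hj z hz => hPx j 2 (by omega) z hz t ht)
            (fun z hz => hPK 2 2 (by norm_num) z hz t ht) m1 m2 m3
      have hh2 : 0 < h ^ 2 := by positivity
      rw [abs_div, abs_of_pos hh2, div_le_iff₀ hh2]
      exact this

end RieszWave

/-! ### Energy balance and unconditional stability -/

namespace RieszWave

open Set Matrix

section DiscreteEnergy

variable {ι : Type*} [Fintype ι]

/-- The discrete energy of two consecutive vectors `q`, `p` for `b u_tt + M u = 0`. -/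
noncomputable def weightedEnergy (θ τ : ℝ) (b : ι → ℝ) (M : Matrix ι ι ℝ) (p q : ι → ℝ) : ℝ :=
  ∑ i, b i * ((p i - q i) / τ) ^ 2 + 1 / 4 * ((p + q) ⬝ᵥ (M *ᵥ (p + q))) +
    1 / 4 * (4 * θ - 1) * ((p - q) ⬝ᵥ (M *ᵥ (p - q)))

theorem dotProduct_mulVec_symm {M : Matrix ι ι ℝ} (hM : M.PosSemidef) (x y : ι → ℝ) :
    x ⬝ᵥ (M *ᵥ y) = y ⬝ᵥ (M *ᵥ x) := by
  have : Mᵀ = M := by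
    have := hM.isHermitian
    rwa [IsHermitian, conjTranspose_eq_transpose_of_trivial] at this
  rw [dotProduct_mulVec, dotProduct_comm, ← mulVec_transpose, this]

theorem quadraticForm_nonneg {M : Matrix ι ι ℝ} (hM : M.PosSemidef) (x : ι → ℝ) :
    0 ≤ x ⬝ᵥ (M *ᵥ x) := by
  simpa using hM.dotProduct_mulVec_nonneg x

/-- Test with `p - s`, using `θ p + (1 - 2θ) q + θ s = (p + 2q + s)/4 + (θ - 1/4)(p - 2q + s)` and
`p - s = (p + q) - (q + s) = (p - q) + (q - s)`. By symmetry of `M` both products are differences of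
squares. -/
theorem weightedEnergy_sub {θ τ : ℝ} {b : ι → ℝ} {M : Matrix ι ι ℝ} (hM : M.PosSemidef)
    {p q s R : ι → ℝ}
    (h : ∀ i, b i * ((p i - 2 * q i + s i) / τ ^ 2) +
      (θ * (M *ᵥ p) i + (1 - 2 * θ) * (M *ᵥ q) i + θ * (M *ᵥ s) i) = b i * R i) :
    weightedEnergy θ τ b M p q - weightedEnergy θ τ b M q s = ∑ i, b i * R i * (p i - s i) := by
  have e1 : ∑ i, b i * R i * (p i - s i) =
      ∑ i, b i * ((p i - q i) / τ) ^ 2 - ∑ i, b i * ((q i - s i) / τ) ^ 2 +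
      (θ * ((p - s) ⬝ᵥ (M *ᵥ p)) + (1 - 2 * θ) * ((p - s) ⬝ᵥ (M *ᵥ q)) +
        θ * ((p - s) ⬝ᵥ (M *ᵥ s))) := by
    simp only [dotProduct, Finset.mul_sum, ← Finset.sum_sub_distrib, ← Finset.sum_add_distrib]
    refine Finset.sum_congr rfl fun i _ => ?_
    rw [← h i]
    simp only [Pi.sub_apply]
    ring
  rw [e1, weightedEnergy, weightedEnergy]
  simp only [mulVec_add, mulVec_sub, dotProduct_add, dotProduct_sub, add_dotProduct,
    sub_dotProduct]
  rw [dotProduct_mulVec_symm hM q p, dotProduct_mulVec_symm hM s p, dotProduct_mulVec_symm hM s q]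
  ring

theorem sum_le_weightedEnergy {θ τ : ℝ} {b : ι → ℝ} {M : Matrix ι ι ℝ} (hM : M.PosSemidef)
    (hθ : 1 / 4 ≤ θ) (p q : ι → ℝ) :
    ∑ i, b i * ((p i - q i) / τ) ^ 2 ≤ weightedEnergy θ τ b M p q := by
  have h1 := quadraticForm_nonneg hM (p + q)
  have h2 := quadraticForm_nonneg hM (p - q)
  have h3 : 0 ≤ 1 / 4 * (4 * θ - 1) * ((p - q) ⬝ᵥ (M *ᵥ (p - q))) :=
    mul_nonneg (by linarith) h2
  rw [weightedEnergy]
  linarith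

theorem weightedEnergy_nonneg {θ τ : ℝ} {b : ι → ℝ} {M : Matrix ι ι ℝ} (hM : M.PosSemidef)
    (hb : ∀ i, 0 ≤ b i) (hθ : 1 / 4 ≤ θ) (p q : ι → ℝ) : 0 ≤ weightedEnergy θ τ b M p q :=
  (Finset.sum_nonneg fun i _ => mul_nonneg (hb i) (sq_nonneg _)).trans
    (sum_le_weightedEnergy hM hθ p q)

theorem sum_mul_le_sqrt_mul_sqrt {b R d : ι → ℝ} (hb : ∀ i, 0 ≤ b i) {G E : ℝ} (hG : 0 ≤ G)
    (hR : ∑ i, b i * R i ^ 2 ≤ G ^ 2) (hd : ∑ i, b i * d i ^ 2 ≤ E) :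
    ∑ i, b i * R i * d i ≤ G * √E := by
  have h := Real.sum_mul_le_sqrt_mul_sqrt Finset.univ (fun i => √(b i) * R i)
    (fun i => √(b i) * d i)
  have e : ∀ r : ι → ℝ, ∑ i, (√(b i) * r i) ^ 2 = ∑ i, b i * r i ^ 2 := fun r =>
    Finset.sum_congr rfl fun i _ => by rw [mul_pow, Real.sq_sqrt (hb i)]
  have e2 : ∑ i, √(b i) * R i * (√(b i) * d i) = ∑ i, b i * R i * d i :=
    Finset.sum_congr rfl fun i _ => by
      have := Real.mul_self_sqrt (hb i)
      calc _ = √(b i) * √(b i) * R i * d i := by ring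
        _ = _ := by rw [this]
  rw [e, e, e2] at h
  refine h.trans (mul_le_mul ?_ (Real.sqrt_le_sqrt hd) (Real.sqrt_nonneg _) hG)
  exact (Real.sqrt_le_sqrt hR).trans (le_of_eq (Real.sqrt_sq hG))

/-- Split `p - s` into two increments, each bounded by the energy of its own step. The balance
becomes `X^2 - Y^2 ≤ τ G (X + Y)`, and `X + Y` is divided out. -/
theorem sqrt_weightedEnergy_le {θ τ G : ℝ} {b : ι → ℝ} {M : Matrix ι ι ℝ} (hM : M.PosSemidef)
    (hb : ∀ i, 0 ≤ b i) (hθ : 1 / 4 ≤ θ) (hτ : 0 < τ) (hG : 0 ≤ G) {p q s R : ι → ℝ}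
    (h : ∀ i, b i * ((p i - 2 * q i + s i) / τ ^ 2) +
      (θ * (M *ᵥ p) i + (1 - 2 * θ) * (M *ᵥ q) i + θ * (M *ᵥ s) i) = b i * R i)
    (hR : ∑ i, b i * R i ^ 2 ≤ G ^ 2) :
    √(weightedEnergy θ τ b M p q) ≤ √(weightedEnergy θ τ b M q s) + τ * G := by
  have h0 := weightedEnergy_sub hM h
  have h1 := sum_mul_le_sqrt_mul_sqrt hb hG hR (sum_le_weightedEnergy hM hθ (τ := τ) p q)
  have h2 := sum_mul_le_sqrt_mul_sqrt hb hG hR (sum_le_weightedEnergy hM hθ (τ := τ) q s)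
  have e : ∑ i, b i * R i * (p i - s i) =
      τ * (∑ i, b i * R i * ((p i - q i) / τ) + ∑ i, b i * R i * ((q i - s i) / τ)) := by
    rw [← Finset.sum_add_distrib, Finset.mul_sum]
    refine Finset.sum_congr rfl fun i _ => ?_
    field_simp
    ring
  have s1 := Real.sq_sqrt (weightedEnergy_nonneg (τ := τ) hM hb hθ p q)
  have s2 := Real.sq_sqrt (weightedEnergy_nonneg (τ := τ) hM hb hθ q s)
  have n1 := Real.sqrt_nonneg (weightedEnergy θ τ b M p q)
  have n2 := Real.sqrt_nonneg (weightedEnergy θ τ b M q s)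
  set X := √(weightedEnergy θ τ b M p q)
  set Y := √(weightedEnergy θ τ b M q s)
  have key : X ^ 2 - Y ^ 2 ≤ τ * G * (X + Y) := by
    rw [s1, s2, h0, e]
    have := mul_le_mul_of_nonneg_left (add_le_add h1 h2) hτ.le
    linarith
  by_contra hcon
  rw [not_le] at hcon
  have hpos : 0 < X + Y := by
    have : 0 ≤ τ * G := by positivity
    linarith
  have : (X - Y - τ * G) * (X + Y) ≤ 0 := by nlinarith
  nlinarith [mul_pos (by linarith : 0 < X - Y - τ * G) hpos]

/-- Unconditional stability of the weighted scheme. -/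
theorem sqrt_weightedEnergy_le_add {θ τ G : ℝ} {b : ι → ℝ} {M : Matrix ι ι ℝ} (hM : M.PosSemidef)
    (hb : ∀ i, 0 ≤ b i) (hθ : 1 / 4 ≤ θ) (hτ : 0 < τ) (hG : 0 ≤ G) (n : ℕ) (e R : ℕ → ι → ℝ)
    (h : ∀ k, 1 ≤ k → k < n → ∀ i, b i * ((e (k + 1) i - 2 * e k i + e (k - 1) i) / τ ^ 2) +
      (θ * (M *ᵥ e (k + 1)) i + (1 - 2 * θ) * (M *ᵥ e k) i + θ * (M *ᵥ e (k - 1)) i) =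
        b i * R k i)
    (hR : ∀ k, 1 ≤ k → k < n → ∑ i, b i * R k i ^ 2 ≤ G ^ 2) (k : ℕ) (hk : k < n) :
    √(weightedEnergy θ τ b M (e (k + 1)) (e k)) ≤
      √(weightedEnergy θ τ b M (e 1) (e 0)) + k * τ * G := by
  induction k with
  | zero => simp
  | succ k ih =>
    have h1 := sqrt_weightedEnergy_le hM hb hθ hτ hG (h (k + 1) (by omega) hk)
      (hR (k + 1) (by omega) hk)
    have h2 := ih (by omega)
    rw [Nat.add_sub_cancel] at h1
    push_cast
    linarith

end DiscreteEnergy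

theorem nabla_add_mul (α h : ℝ) (N : ℕ) (v w : ℕ → ℝ) (c : ℝ) (i : ℕ) :
    nabla α h N (fun k => v k + c * w k) i = nabla α h N v i + c * nabla α h N w i := by
  simp only [nabla, deltaPlus, deltaMinus, mul_add, Finset.sum_add_distrib, mul_left_comm _ c,
    ← Finset.mul_sum]
  ring

theorem nabla_congr {α h : ℝ} {N : ℕ} {v w : ℕ → ℝ} (hvw : ∀ k ≤ N, v k = w k) {i : ℕ}
    (h1 : 1 ≤ i) (h2 : i < N) : nabla α h N v i = nabla α h N w i := by
  rw [nabla, nabla, deltaMinus_eq_deltaPlus _ _ _ _ i h1 h2,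
    deltaMinus_eq_deltaPlus _ _ _ _ i h1 h2, deltaPlus_congr fun j hj => hvw j (by omega)]
  congr 2
  exact deltaPlus_congr fun j hj => hvw (N - j) (by omega)

theorem hasDerivWithinAt_nabla {α h : ℝ} {N : ℕ} {v : ℕ → ℝ → ℝ} {v' : ℕ → ℝ} {s : Set ℝ} {t : ℝ}
    {i : ℕ} (h1 : 1 ≤ i) (h2 : i < N) (hv : ∀ k ≤ N, HasDerivWithinAt (v k) (v' k) s t) :
    HasDerivWithinAt (fun t => nabla α h N (fun k => v k t) i) (nabla α h N v' i) s t := by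
  simp only [nabla, deltaPlus, deltaMinus]
  refine ((HasDerivWithinAt.const_mul _ (HasDerivWithinAt.fun_sum fun m hm => ?_)).add
    (HasDerivWithinAt.const_mul _ (HasDerivWithinAt.fun_sum fun m hm => ?_))).const_mul _
  · exact (hv _ (by omega)).const_mul _
  · have := Finset.mem_range.1 hm
    exact (hv _ (by omega)).const_mul _

/-- The energy of the statement is controlled by the energy weighted with `1 / a`. -/
theorem energy_le_weightedEnergy {α θ h τ a₁ : ℝ} {a : ℝ → ℝ} {N : ℕ}
    {Λ : Matrix (Fin (N - 1)) (Fin (N - 1)) ℝ} (hΛ : IsLambda α h N Λ) (hh : 0 < h)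
    (hθ : 1 / 4 ≤ θ)
    (ha : ∀ j : Fin (N - 1), 0 < a ((((j : ℕ) + 1 : ℕ) : ℝ) * h) ∧
      a ((((j : ℕ) + 1 : ℕ) : ℝ) * h) ≤ a₁)
    (e : ℕ → ℕ → ℝ) (k : ℕ) :
    energy θ a h τ N Λ e k ≤ a₁ * weightedEnergy θ τ
      (fun j : Fin (N - 1) => h / a ((((j : ℕ) + 1 : ℕ) : ℝ) * h)) (h • (-nablaMatrix α h N))
      (interiorVec N (e (k + 1))) (interiorVec N (e k)) := by
  have hsym : Λᵀ = Λ := by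
    have := hΛ.1.isHermitian
    rwa [IsHermitian, conjTranspose_eq_transpose_of_trivial] at this
  have hquad : ∀ x : Fin (N - 1) → ℝ, normSq h N (sqrtMul a h N (Λ *ᵥ x)) ≤
      a₁ * (x ⬝ᵥ ((h • (-nablaMatrix α h N)) *ᵥ x)) := by
    intro x
    have e1 : x ⬝ᵥ ((h • (-nablaMatrix α h N)) *ᵥ x) = h * ∑ j, (Λ *ᵥ x) j ^ 2 := by
      rw [smul_mulVec, dotProduct_smul, ← hΛ.2, ← mulVec_mulVec, dotProduct_mulVec,
        ← mulVec_transpose, hsym, smul_eq_mul]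
      simp only [dotProduct, sq]
    rw [e1, normSq, mul_left_comm]
    refine mul_le_mul_of_nonneg_left ?_ hh.le
    rw [Finset.mul_sum]
    refine Finset.sum_le_sum fun j _ => ?_
    rw [sqrtMul, mul_pow, Real.sq_sqrt (ha j).1.le]
    exact mul_le_mul_of_nonneg_right (ha j).2 (sq_nonneg _)
  have hkin : normSq h N (interiorVec N fun i => (e (k + 1) i - e k i) / τ) ≤
      a₁ * ∑ j : Fin (N - 1), h / a ((((j : ℕ) + 1 : ℕ) : ℝ) * h) *
        ((interiorVec N (e (k + 1)) j - interiorVec N (e k) j) / τ) ^ 2 := by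
    rw [normSq, Finset.mul_sum, Finset.mul_sum]
    refine Finset.sum_le_sum fun j _ => ?_
    simp only [interiorVec]
    have h1 : h ≤ a₁ * (h / a ((((j : ℕ) + 1 : ℕ) : ℝ) * h)) := by
      rw [mul_div_assoc', le_div_iff₀ (ha j).1, mul_comm]
      exact mul_le_mul_of_nonneg_right (ha j).2 hh.le
    rw [← mul_assoc]
    exact mul_le_mul_of_nonneg_right h1 (sq_nonneg _)
  have q1 := hquad (interiorVec N (e (k + 1)) + interiorVec N (e k))
  have q2 := hquad (interiorVec N (e (k + 1)) - interiorVec N (e k))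
  rw [mulVec_add] at q1
  rw [mulVec_sub] at q2
  rw [energy, weightedEnergy, mul_add, mul_add]
  have q3 := mul_le_mul_of_nonneg_left q2 (by linarith : 0 ≤ 1 / 4 * (4 * θ - 1))
  linarith

end RieszWave

/-! ### Truncation error and error of the starting step -/

namespace RieszWave

open Set Matrix

/-- The regularity and consistency properties of a solution that the error analysis uses: `V j` is
the `j`-th time derivative of the solution and `Z` is its Riesz derivative. -/
structure IsConsistent (α xr T K : ℝ) (a : ℝ → ℝ) (f : ℝ → ℝ → ℝ) (φ ψ : ℝ → ℝ)
    (V : ℕ → ℝ → ℝ → ℝ) (Z : ℝ → ℝ → ℝ) : Prop where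
  deriv : ∀ j < 4, ∀ x ∈ Icc 0 xr, ∀ t ∈ Icc 0 T,
    HasDerivWithinAt (V j x) (V (j + 1) x t) (Icc 0 T) t
  bound : ∀ j ≤ 4, ∀ x ∈ Icc 0 xr, ∀ t ∈ Icc 0 T, |V j x t| ≤ K
  consistent : ∀ (N : ℕ) (h : ℝ), 0 < h → xr = N * h → ∀ i, 1 ≤ i → i < N → ∀ t ∈ Icc 0 T,
    |nabla α h N (fun k => V 0 (k * h) t) i - Z (i * h) t| ≤ K * h ^ 2
  nabla_bound : ∀ (N : ℕ) (h : ℝ), 0 < h → xr = N * h → ∀ i, 1 ≤ i → i < N → ∀ t ∈ Icc 0 T,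
    |nabla α h N (fun k => V 2 (k * h) t) i| ≤ K
  pde : ∀ x ∈ Ioo 0 xr, ∀ t ∈ Icc 0 T, V 2 x t = a x * Z x t + f x t
  init : ∀ x ∈ Ioo 0 xr, V 0 x 0 = φ x
  init_deriv : ∀ x ∈ Ioo 0 xr, V 1 x 0 = ψ x
  dirichlet : ∀ t ∈ Icc 0 T, V 0 0 t = 0 ∧ V 0 xr t = 0

theorem exists_isConsistent {α xr T : ℝ} (h1 : 1 < α) (h2 : α ≤ 2) (hxr : 0 < xr) (hT : 0 < T)
    {a : ℝ → ℝ} {f : ℝ → ℝ → ℝ} {φ ψ : ℝ → ℝ} {u : ℝ → ℝ → ℝ}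
    (hu : IsSolution α xr T a f φ ψ u) :
    ∃ V K Z, 0 ≤ K ∧ IsConsistent α xr T K a f φ ψ V Z ∧
      ∀ x ∈ Icc 0 xr, ∀ t, V 0 x t = u x t := by
  obtain ⟨V, K, hK, hVu, hd, hb, hc, hn⟩ :=
    exists_time_derivs h1 h2 hxr hT hu.smooth hu.smooth_zeroExt
  have hfun : ∀ x ∈ Icc 0 xr, (fun s => u x s) = V 0 x := fun x hx =>
    funext fun t => (hVu x hx t).symm
  have hdw : ∀ j < 4, ∀ x ∈ Icc 0 xr, ∀ t ∈ Icc 0 T,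
      derivWithin (V j x) (Icc 0 T) t = V (j + 1) x t := fun j hj x hx t ht =>
    (hd j hj x hx t ht).derivWithin (uniqueDiffOn_Icc hT t ht)
  have h0 : (0 : ℝ) ∈ Icc 0 T := ⟨le_rfl, hT.le⟩
  refine ⟨V, K, fun x t => rieszDeriv α xr (fun y => u y t) x, hK,
    ⟨hd, hb, hc, hn, fun x hx t ht => ?_, fun x hx => ?_, fun x hx => ?_, fun t ht => ?_⟩, hVu⟩
  · have hx' := Ioo_subset_Icc_self hx
    rw [← hu.pde x hx t ht, hfun x hx', iteratedDerivWithin_succ, iteratedDerivWithin_one,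
      derivWithin_congr (fun s hs => hdw 0 (by norm_num) x hx' s hs)
        (hdw 0 (by norm_num) x hx' t ht), hdw 1 (by norm_num) x hx' t ht]
  · rw [hVu x (Ioo_subset_Icc_self hx), hu.init x hx]
  · have hx' := Ioo_subset_Icc_self hx
    rw [← hu.init_deriv x hx, hfun x hx', hdw 0 (by norm_num) x hx' 0 h0]
  · rw [hVu 0 ⟨le_rfl, hxr.le⟩, hVu xr ⟨hxr.le, le_rfl⟩]
    exact hu.dirichlet t ht

section ErrorBounds

variable {α xr T K a₁ : ℝ} {a : ℝ → ℝ} {f : ℝ → ℝ → ℝ} {φ ψ : ℝ → ℝ} {V : ℕ → ℝ → ℝ → ℝ}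
  {Z : ℝ → ℝ → ℝ} {N : ℕ} {h τ : ℝ}

theorem grid_mem_Icc (hh : 0 < h) (hN : xr = N * h) {k : ℕ} (hk : k ≤ N) :
    (k : ℝ) * h ∈ Icc 0 xr :=
  ⟨by positivity, hN ▸ mul_le_mul_of_nonneg_right (Nat.cast_le.2 hk) hh.le⟩

theorem grid_mem_Ioo (hh : 0 < h) (hN : xr = N * h) {i : ℕ} (h1 : 1 ≤ i) (h2 : i < N) :
    (i : ℝ) * h ∈ Ioo 0 xr := by
  have : (0 : ℝ) < i := by exact_mod_cast h1
  have : (i : ℝ) < N := by exact_mod_cast h2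
  exact ⟨by positivity, by rw [hN]; gcongr⟩

theorem IsConsistent.hasDerivWithinAt_nabla (hV : IsConsistent α xr T K a f φ ψ V Z) (hh : 0 < h)
    (hN : xr = N * h) {i : ℕ} (h1 : 1 ≤ i) (h2 : i < N) {j : ℕ} (hj : j < 4) {t : ℝ}
    (ht : t ∈ Icc 0 T) :
    HasDerivWithinAt (fun t => nabla α h N (fun k => V j (k * h) t) i)
      (nabla α h N (fun k => V (j + 1) (k * h) t) i) (Icc 0 T) t :=
  RieszWave.hasDerivWithinAt_nabla (v := fun k => V j (k * h)) h1 h2 fun _ hk =>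
    hV.deriv j hj _ (grid_mem_Icc hh hN hk) t ht

/-- Used to see that `startRemainder` vanishes at both end points, so that the matrix acts on it as
the full operator `nabla`. -/
theorem IsConsistent.dirichlet_deriv (hV : IsConsistent α xr T K a f φ ψ V Z) (hT : 0 < T)
    (hxr : 0 ≤ xr) {j : ℕ} (hj : j ≤ 4) : ∀ t ∈ Icc 0 T, V j 0 t = 0 ∧ V j xr t = 0 := by
  induction j with
  | zero => exact hV.dirichlet
  | succ j ih =>
    intro t ht
    have key : ∀ x ∈ Icc 0 xr, (∀ s ∈ Icc 0 T, V j x s = 0) → V (j + 1) x t = 0 := by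
      intro x hx hz
      have hd0 : HasDerivWithinAt (V j x) 0 (Icc 0 T) t :=
        (hasDerivWithinAt_const t (Icc 0 T) (0 : ℝ)).congr hz (hz t ht)
      exact (uniqueDiffOn_Icc hT t ht).eq_deriv _ (hV.deriv j (by omega) x hx t ht) hd0
    exact ⟨key 0 ⟨le_rfl, hxr⟩ fun s hs => (ih (by omega) s hs).1,
      key xr ⟨hxr, le_rfl⟩ fun s hs => (ih (by omega) s hs).2⟩

/-- The truncation error of the weighted scheme. -/
noncomputable def truncation (α θ : ℝ) (a : ℝ → ℝ) (V : ℕ → ℝ → ℝ → ℝ) (Z : ℝ → ℝ → ℝ) (N : ℕ)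
    (h τ : ℝ) (i : ℕ) (t : ℝ) : ℝ :=
  ((V 0 (i * h) (t + τ) - 2 * V 0 (i * h) t + V 0 (i * h) (t - τ)) / τ ^ 2 - V 2 (i * h) t) +
    a (i * h) * (Z (i * h) t - nabla α h N (fun k => V 0 (k * h) t) i) -
    a (i * h) * θ * (nabla α h N (fun k => V 0 (k * h) (t + τ)) i -
      2 * nabla α h N (fun k => V 0 (k * h) t) i +
      nabla α h N (fun k => V 0 (k * h) (t - τ)) i)

theorem abs_truncation_le (hV : IsConsistent α xr T K a f φ ψ V Z) (hK : 0 ≤ K)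
    (ha : ∀ x ∈ Ioo 0 xr, 0 ≤ a x ∧ a x ≤ a₁) (hh : 0 < h) (hτ : 0 < τ)
    (hN : xr = N * h) {i : ℕ} (h1 : 1 ≤ i) (h2 : i < N) {t θ : ℝ} (hθ0 : 0 ≤ θ) (hθ : θ ≤ 1)
    (m1 : t ∈ Icc 0 T) (m2 : t + τ ∈ Icc 0 T) (m3 : t - τ ∈ Icc 0 T) :
    |truncation α θ a V Z N h τ i t| ≤ 2 * K * (1 + a₁) * (τ ^ 2 + h ^ 2) := by
  obtain ⟨ha0, ha1⟩ := ha _ (grid_mem_Ioo hh hN h1 h2)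
  have hx := grid_mem_Icc hh hN h2.le
  have hτ2 : 0 < τ ^ 2 := by positivity
  have b1 : |(V 0 (i * h) (t + τ) - 2 * V 0 (i * h) t + V 0 (i * h) (t - τ)) / τ ^ 2 -
      V 2 (i * h) t| ≤ 2 * K * τ ^ 2 := by
    have := abs_second_diff_sub_le (F := fun j t => V j (i * h) t)
      (fun j hj s hs => hV.deriv j hj _ hx s hs) (fun s hs => hV.bound 4 le_rfl _ hx s hs) m1 m2 m3
    rw [div_sub' hτ2.ne', abs_div, abs_of_pos hτ2, div_le_iff₀ hτ2]
    exact this.trans (le_of_eq (by ring))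
  have b2 : |a (i * h) * (Z (i * h) t - nabla α h N (fun k => V 0 (k * h) t) i)| ≤
      a₁ * (K * h ^ 2) := by
    rw [abs_mul, abs_of_nonneg ha0, abs_sub_comm]
    exact mul_le_mul ha1 (hV.consistent N h hh hN i h1 h2 t m1) (abs_nonneg _) (ha0.trans ha1)
  have b3 : |a (i * h) * θ * (nabla α h N (fun k => V 0 (k * h) (t + τ)) i -
      2 * nabla α h N (fun k => V 0 (k * h) t) i +
      nabla α h N (fun k => V 0 (k * h) (t - τ)) i)| ≤ a₁ * (2 * K * τ ^ 2) := by
    -- The `θ` part of the scheme is its value at the middle time plus `θ` times a second time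
    -- difference. As `nabla` commutes with time derivatives, `nabla_bound` controls that
    -- difference.
    have := abs_second_diff_le (F := fun j t => nabla α h N (fun k => V j (k * h) t) i)
      (fun j hj s hs => hV.hasDerivWithinAt_nabla hh hN h1 h2 (by omega) hs)
      (fun s hs => hV.nabla_bound N h hh hN i h1 h2 s hs) m1 m2 m3
    rw [abs_mul, abs_of_nonneg (mul_nonneg ha0 hθ0)]
    refine mul_le_mul ?_ this (abs_nonneg _) (ha0.trans ha1)
    exact (mul_le_of_le_one_right ha0 hθ).trans ha1
  rw [truncation]
  refine (abs_sub _ _).trans ((add_le_add_left (abs_add_le _ _) _).trans ?_)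
  have p1 : 0 ≤ a₁ * (K * h ^ 2) := mul_nonneg (ha0.trans ha1) (by positivity)
  have p2 : 0 ≤ K * h ^ 2 := by positivity
  have e : 2 * K * (1 + a₁) * (τ ^ 2 + h ^ 2) = 2 * K * τ ^ 2 + a₁ * (2 * K * τ ^ 2) +
      2 * (K * h ^ 2) + 2 * (a₁ * (K * h ^ 2)) := by ring
  rw [e]
  linarith

/-- The error satisfies the scheme with the truncation error as right hand side. -/
theorem error_equation (hV : IsConsistent α xr T K a f φ ψ V Z) (hh : 0 < h)
    (hN : xr = N * h) {Nt : ℕ} (hτ : 0 < τ) (hNt : T = Nt * τ) {θ : ℝ} {U : ℕ → ℕ → ℝ}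
    (hU : IsScheme α θ a f φ ψ N Nt h τ U) {e : ℕ → ℕ → ℝ}
    (he : ∀ k, ∀ i ≤ N, e k i = V 0 (i * h) (k * τ) - U k i) {k : ℕ} (hk : 1 ≤ k) (hkN : k < Nt)
    {i : ℕ} (h1 : 1 ≤ i) (h2 : i < N) :
    (e (k + 1) i - 2 * e k i + e (k - 1) i) / τ ^ 2 =
      a (i * h) * (θ * nabla α h N (e (k + 1)) i + (1 - 2 * θ) * nabla α h N (e k) i +
        θ * nabla α h N (e (k - 1)) i) + truncation α θ a V Z N h τ i (k * τ) := by
  have hkt := grid_mem_Icc hτ hNt hkN.le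
  have e1 : ((k + 1 : ℕ) : ℝ) * τ = k * τ + τ := by push_cast; ring
  have e2 : ((k - 1 : ℕ) : ℝ) * τ = k * τ - τ := by rw [Nat.cast_sub hk]; push_cast; ring
  have hn : ∀ m, nabla α h N (e m) i =
      nabla α h N (fun k => V 0 (k * h) (m * τ)) i - nabla α h N (U m) i := by
    intro m
    rw [nabla_congr (w := fun k => V 0 (k * h) (m * τ) + (-1) * U m k)
      (fun k hk => by rw [he m k hk]; ring) h1 h2, nabla_add_mul]
    ring
  have hs := hU.step k hk hkN i h1 h2
  have hp := hV.pde _ (grid_mem_Ioo hh hN h1 h2) _ hkt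
  have hf : f (i * h) (k * τ) = V 2 (i * h) (k * τ) - a (i * h) * Z (i * h) (k * τ) := by
    rw [hp]; ring
  rw [hf] at hs
  have hsplit : (e (k + 1) i - 2 * e k i + e (k - 1) i) / τ ^ 2 =
      (V 0 (i * h) (k * τ + τ) - 2 * V 0 (i * h) (k * τ) + V 0 (i * h) (k * τ - τ)) / τ ^ 2 -
        (U (k + 1) i - 2 * U k i + U (k - 1) i) / τ ^ 2 := by
    rw [he _ i h2.le, he _ i h2.le, he _ i h2.le, e1, e2]
    ring
  rw [hsplit, hs, hn, hn, hn, e1, e2, truncation]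
  ring

/-- The Taylor remainder of the exact solution in the first time step. -/
noncomputable def startRemainder (V : ℕ → ℝ → ℝ → ℝ) (h τ : ℝ) (i : ℕ) : ℝ :=
  V 0 (i * h) τ - V 0 (i * h) 0 - τ * V 1 (i * h) 0 - τ ^ 2 / 2 * V 2 (i * h) 0

/-- The space discretization error in the first time step. -/
noncomputable def startDefect (α : ℝ) (a : ℝ → ℝ) (V : ℕ → ℝ → ℝ → ℝ) (Z : ℝ → ℝ → ℝ) (N : ℕ)
    (h τ : ℝ) (i : ℕ) : ℝ :=
  τ ^ 2 / 2 * (a (i * h) * (Z (i * h) 0 - nabla α h N (fun k => V 0 (k * h) 0) i))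

theorem error_start (hV : IsConsistent α xr T K a f φ ψ V Z) (hT : 0 < T) (hh : 0 < h)
    (hN : xr = N * h) {Nt : ℕ} {θ : ℝ} {U : ℕ → ℕ → ℝ}
    (hU : IsScheme α θ a f φ ψ N Nt h τ U) {e : ℕ → ℕ → ℝ}
    (he : ∀ k, ∀ i ≤ N, e k i = V 0 (i * h) (k * τ) - U k i) {i : ℕ} (h1 : 1 ≤ i) (h2 : i < N) :
    e 0 i = 0 ∧ e 1 i = startRemainder V h τ i + startDefect α a V Z N h τ i := by
  have hx := grid_mem_Ioo hh hN h1 h2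
  have h0 : (0 : ℝ) ∈ Icc 0 T := ⟨le_rfl, hT.le⟩
  have hU0 : ∀ k ≤ N, U 0 k = V 0 (k * h) 0 := by
    intro k hk
    rcases Nat.eq_zero_or_pos k with rfl | hk0
    · rw [(hU.boundary 0 (Nat.zero_le _)).1]
      simp [(hV.dirichlet 0 h0).1]
    · rcases hk.lt_or_eq with hk | rfl
      · rw [hU.init k hk0 hk, hV.init _ (grid_mem_Ioo hh hN hk0 hk)]
      · rw [(hU.boundary 0 (Nat.zero_le _)).2, ← hN, (hV.dirichlet 0 h0).2]
  constructor
  · rw [he 0 i h2.le, hU0 i h2.le]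
    simp
  · rw [he 1 i h2.le, hU.start i h1 h2, nabla_congr hU0 h1 h2, startRemainder, startDefect,
      hV.pde _ hx 0 h0, hV.init _ hx, hV.init_deriv _ hx]
    simp only [Nat.cast_one, one_mul]
    ring

theorem abs_startRemainder_le (hV : IsConsistent α xr T K a f φ ψ V Z) (hh : 0 < h)
    (hτ : 0 < τ) (hτT : τ ≤ T) (hN : xr = N * h) {i : ℕ} (h2 : i ≤ N) :
    |startRemainder V h τ i| ≤ K * τ ^ 3 := by
  have hx := grid_mem_Icc hh hN h2
  have := abs_sub_taylor_three_le (F := fun j t => V j (i * h) t) (a := 0) (b := T) (c := 0)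
    (d := τ) (fun j hj s hs => hV.deriv j (by omega) _ hx s hs)
    (fun s hs => hV.bound 3 (by norm_num) _ hx s hs) ⟨le_rfl, by linarith⟩
    ⟨by linarith, by linarith⟩
  rwa [zero_add, abs_of_pos hτ] at this

/-- Only `nabla` of the second time derivative is bounded under `C⁴` regularity, so one power of `τ`
is lost against `abs_startRemainder_le`. -/
theorem abs_nabla_startRemainder_le (hV : IsConsistent α xr T K a f φ ψ V Z)
    (hh : 0 < h) (hτ : 0 < τ) (hτT : τ ≤ T) (hN : xr = N * h) {i : ℕ} (h1 : 1 ≤ i) (h2 : i < N) :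
    |nabla α h N (startRemainder V h τ) i| ≤ 2 * K * τ ^ 2 := by
  have h0 : (0 : ℝ) ∈ Icc 0 T := ⟨le_rfl, by linarith⟩
  have e : startRemainder V h τ = fun k : ℕ => V 0 (k * h) τ + (-1) * V 0 (k * h) 0 +
      (-τ) * V 1 (k * h) 0 + (-(τ ^ 2 / 2)) * V 2 (k * h) 0 := by
    funext k
    rw [startRemainder]
    ring
  have ht := abs_sub_taylor_two_le (F := fun j t => nabla α h N (fun k => V j (k * h) t) i)
    (a := 0) (b := T) (c := 0) (d := τ)
    (fun j hj s hs => hV.hasDerivWithinAt_nabla hh hN h1 h2 (by omega) hs)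
    (fun s hs => hV.nabla_bound N h hh hN i h1 h2 s hs) h0 ⟨by linarith, by linarith⟩
  have hb := hV.nabla_bound N h hh hN i h1 h2 0 h0
  rw [zero_add] at ht
  rw [e, nabla_add_mul, nabla_add_mul, nabla_add_mul]
  have hb' : |τ ^ 2 / 2 * nabla α h N (fun k => V 2 (k * h) 0) i| ≤ τ ^ 2 * K := by
    rw [abs_mul, abs_of_pos (by positivity)]
    refine mul_le_mul (by nlinarith [sq_nonneg τ]) hb (abs_nonneg _) (by positivity)
  calc _ = |(nabla α h N (fun k => V 0 (k * h) τ) i - nabla α h N (fun k => V 0 (k * h) 0) i -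
        τ * nabla α h N (fun k => V 1 (k * h) 0) i) -
        τ ^ 2 / 2 * nabla α h N (fun k => V 2 (k * h) 0) i| := by congr 1; ring
    _ ≤ K * τ ^ 2 + τ ^ 2 * K := (abs_sub _ _).trans (add_le_add ht hb')
    _ = _ := by ring

theorem abs_startDefect_le (hV : IsConsistent α xr T K a f φ ψ V Z) (hT : 0 < T)
    (ha : ∀ x ∈ Ioo 0 xr, 0 ≤ a x ∧ a x ≤ a₁) (hh : 0 < h)
    (hN : xr = N * h) {i : ℕ} (h1 : 1 ≤ i) (h2 : i < N) :
    |startDefect α a V Z N h τ i| ≤ a₁ * K * τ ^ 2 * h ^ 2 := by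
  obtain ⟨ha0, ha1⟩ := ha _ (grid_mem_Ioo hh hN h1 h2)
  have hc := hV.consistent N h hh hN i h1 h2 0 ⟨le_rfl, hT.le⟩
  rw [startDefect, abs_mul, abs_mul, abs_of_nonneg ha0, abs_sub_comm, abs_of_nonneg (by positivity)]
  calc _ ≤ τ ^ 2 * (a₁ * (K * h ^ 2)) := by
        refine mul_le_mul (by nlinarith [sq_nonneg τ]) ?_ (mul_nonneg ha0 (abs_nonneg _))
          (by positivity)
        exact mul_le_mul ha1 hc (abs_nonneg _) (ha0.trans ha1)
    _ = _ := by ring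

theorem sum_fin_le {N : ℕ} {g : Fin (N - 1) → ℝ} {B : ℝ} (hB : 0 ≤ B) (hg : ∀ j, g j ≤ B) :
    ∑ j, g j ≤ N * B := by
  calc ∑ j, g j ≤ ∑ _j : Fin (N - 1), B := Finset.sum_le_sum fun j _ => hg j
    _ = ((N - 1 : ℕ) : ℝ) * B := by simp
    _ ≤ _ := by
        gcongr
        exact_mod_cast Nat.sub_le N 1

end ErrorBounds

end RieszWave

/-! ### Energy of the first step -/

namespace RieszWave

open Set Matrix

section StartEnergy

variable {α xr T K a₀ a₁ : ℝ} {a : ℝ → ℝ} {f : ℝ → ℝ → ℝ} {φ ψ : ℝ → ℝ} {V : ℕ → ℝ → ℝ → ℝ}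
  {Z : ℝ → ℝ → ℝ} {N : ℕ} {h τ : ℝ}

/-- The weights `h / a(x_i)` of the energy. -/
noncomputable def energyWeight (a : ℝ → ℝ) (h : ℝ) (N : ℕ) : Fin (N - 1) → ℝ :=
  fun j => h / a ((((j : ℕ) + 1 : ℕ) : ℝ) * h)

/-- The matrix of `-h ∇_h^α`. -/
noncomputable def stiffness (α h : ℝ) (N : ℕ) : Matrix (Fin (N - 1)) (Fin (N - 1)) ℝ :=
  h • (-nablaMatrix α h N)

theorem stiffness_posSemidef (hα1 : 1 < α) (hα2 : α ≤ 2) (hh : 0 < h) (hN : 1 ≤ N) :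
    (stiffness α h N).PosSemidef :=
  (neg_nablaMatrix_posDef hα1 hα2 hh N hN).posSemidef.smul hh.le

theorem stiffness_mulVec (v : ℕ → ℝ) (h0 : v 0 = 0) (h1 : v N = 0) (j : Fin (N - 1)) :
    (stiffness α h N *ᵥ interiorVec N v) j = -(h * nabla α h N v (j + 1)) := by
  rw [stiffness, smul_mulVec, neg_mulVec, Pi.smul_apply, Pi.neg_apply,
    nablaMatrix_mulVec α h N v h0 h1, smul_eq_mul, mul_neg]

/-- Pairing `O(τ^3)` with `O(τ^2)` pointwise gives `τ^5`, one power more than needed; the spare `τ`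
is bounded by `T`. -/
theorem dotProduct_stiffness_startRemainder_le (hV : IsConsistent α xr T K a f φ ψ V Z)
    (hT : 0 < T) (hK : 0 ≤ K) (hh : 0 < h) (hτ : 0 < τ) (hτT : τ ≤ T)
    (hN : xr = N * h) :
    interiorVec N (startRemainder V h τ) ⬝ᵥ
      (stiffness α h N *ᵥ interiorVec N (startRemainder V h τ)) ≤ 2 * xr * K ^ 2 * T * τ ^ 4 := by
  have hxr : 0 ≤ xr := by rw [hN]; positivity
  have hb : ∀ j ≤ 2, V j 0 0 = 0 ∧ V j xr 0 = 0 ∧ V j 0 τ = 0 ∧ V j xr τ = 0 := fun j hj =>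
    ⟨(hV.dirichlet_deriv hT hxr (by omega) 0 ⟨le_rfl, hT.le⟩).1,
      (hV.dirichlet_deriv hT hxr (by omega) 0 ⟨le_rfl, hT.le⟩).2,
      (hV.dirichlet_deriv hT hxr (by omega) τ ⟨hτ.le, hτT⟩).1,
      (hV.dirichlet_deriv hT hxr (by omega) τ ⟨hτ.le, hτT⟩).2⟩
  have r0 : startRemainder V h τ 0 = 0 := by
    simp [startRemainder, hb 0 (by norm_num), hb 1 (by norm_num), hb 2 (by norm_num)]
  have rN : startRemainder V h τ N = 0 := by
    simp [startRemainder, ← hN, hb 0 (by norm_num), hb 1 (by norm_num), hb 2 (by norm_num)]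
  rw [dotProduct]
  refine (sum_fin_le (B := h * (2 * K ^ 2 * T * τ ^ 4)) (by positivity) fun j => ?_).trans
    (le_of_eq (by rw [hN]; ring))
  rw [stiffness_mulVec _ r0 rN]
  have hj := j.2
  have b1 := abs_startRemainder_le hV hh hτ hτT hN (i := j + 1) (by omega)
  have b2 := abs_nabla_startRemainder_le hV hh hτ hτT hN (i := j + 1) (by omega) (by omega)
  simp only [interiorVec]
  calc startRemainder V h τ (j + 1) * -(h * nabla α h N (startRemainder V h τ) (j + 1))
      ≤ |startRemainder V h τ (j + 1) * -(h * nabla α h N (startRemainder V h τ) (j + 1))| :=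
        le_abs_self _
    _ = h * (|startRemainder V h τ (j + 1)| * |nabla α h N (startRemainder V h τ) (j + 1)|) := by
        rw [abs_mul, abs_neg, abs_mul, abs_of_pos hh]; ring
    _ ≤ h * ((K * τ ^ 3) * (2 * K * τ ^ 2)) := by gcongr
    _ = h * (2 * K ^ 2 * τ * τ ^ 4) := by ring
    _ ≤ _ := by gcongr

/-- The defect is known only pointwise, with no bound on its discrete derivatives. The inverse
inequality costs `h^{-α}`, which the factor `(τ^2 h^2)^2` absorbs, leaving `h^{4-α} ≤ xr^{4-α}`. -/
theorem dotProduct_stiffness_startDefect_le (hα1 : 1 < α) (hα2 : α ≤ 2)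
    (hV : IsConsistent α xr T K a f φ ψ V Z)
    (hT : 0 < T) (ha : ∀ x ∈ Ioo 0 xr, 0 ≤ a x ∧ a x ≤ a₁) (hh : 0 < h)
    (hN : xr = N * h) (hN1 : 1 ≤ N) :
    interiorVec N (startDefect α a V Z N h τ) ⬝ᵥ
      (stiffness α h N *ᵥ interiorVec N (startDefect α a V Z N h τ)) ≤
      4 * (kappa α * phiCoeff α 1) * xr * xr ^ (4 - α) * (a₁ * K) ^ 2 * τ ^ 4 := by
  have hκ : 0 ≤ kappa α * phiCoeff α 1 := by
    rw [phiCoeff_one]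
    have h1 := kappa_neg hα1 hα2
    have : 0 ≤ (α - 1) * (α + 2) / 2 := by
      have : 0 ≤ α - 1 := by linarith
      positivity
    nlinarith
  have hhxr : h ≤ xr := by
    rw [hN]
    have : (1 : ℝ) ≤ N := by exact_mod_cast hN1
    nlinarith
  rw [stiffness, smul_mulVec, dotProduct_smul, smul_eq_mul]
  have h1 := dotProduct_neg_nablaMatrix_le hα1 hα2 hh N hN1
    (interiorVec N (startDefect α a V Z N h τ))
  have h2 : ∑ j, interiorVec N (startDefect α a V Z N h τ) j ^ 2 ≤
      N * ((a₁ * K * τ ^ 2 * h ^ 2) ^ 2) := by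
    refine sum_fin_le (sq_nonneg _) fun j => ?_
    have hj := j.2
    have := abs_startDefect_le (τ := τ) hV hT ha hh hN (i := j + 1) (by omega) (by omega)
    rw [← sq_abs]
    exact pow_le_pow_left₀ (abs_nonneg _) this 2
  have hpow : h ^ 4 / h ^ α ≤ xr ^ (4 - α) := by
    have : h ^ 4 / h ^ α = h ^ (4 - α) := by
      rw [Real.rpow_sub hh, show (4 : ℝ) = ((4 : ℕ) : ℝ) by norm_num, Real.rpow_natCast]
    rw [this]
    exact Real.rpow_le_rpow hh.le hhxr (by linarith)
  calc _ ≤ h * (4 * (kappa α * phiCoeff α 1) / h ^ α * (N * ((a₁ * K * τ ^ 2 * h ^ 2) ^ 2))) := by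
        refine mul_le_mul_of_nonneg_left (h1.trans ?_) hh.le
        exact mul_le_mul_of_nonneg_left h2 (by positivity)
    _ = 4 * (kappa α * phiCoeff α 1) * xr * (h ^ 4 / h ^ α) * (a₁ * K) ^ 2 * τ ^ 4 := by
        rw [hN]; ring
    _ ≤ _ := by
        have : 0 ≤ xr := by linarith
        gcongr

theorem sum_energyWeight_mul_sq_le (ha₀ : 0 < a₀) (ha : ∀ x ∈ Ioo 0 xr, a₀ ≤ a x) (hh : 0 < h)
    (hN : xr = N * h) {R : Fin (N - 1) → ℝ} {B : ℝ} (hR : ∀ j, |R j| ≤ B) :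
    ∑ j, energyWeight a h N j * R j ^ 2 ≤ xr / a₀ * B ^ 2 := by
  refine (sum_fin_le (B := h / a₀ * B ^ 2) (by positivity) fun j => ?_).trans
    (le_of_eq (by rw [hN]; ring))
  have hj := j.2
  have h1 := ha _ (grid_mem_Ioo hh hN (i := j + 1) (by omega) (by omega))
  have h2 : R j ^ 2 ≤ B ^ 2 := by
    rw [← sq_abs]
    exact pow_le_pow_left₀ (abs_nonneg _) (hR j) 2
  rw [energyWeight]
  gcongr

theorem weightedEnergy_start_le {θ : ℝ} (hα1 : 1 < α) (hα2 : α ≤ 2)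
    (hV : IsConsistent α xr T K a f φ ψ V Z) (hT : 0 < T) (hK : 0 ≤ K) (ha₀ : 0 < a₀)
    (ha : ∀ x ∈ Ioo 0 xr, a₀ ≤ a x ∧ a x ≤ a₁) (ha₁ : 0 ≤ a₁) (hh : 0 < h) (hτ : 0 < τ)
    (hτT : τ ≤ T) (hN : xr = N * h) (hN1 : 1 ≤ N) (hθ : θ ≤ 1) {e : ℕ → ℕ → ℝ}
    (he : ∀ i, 1 ≤ i → i < N →
      e 0 i = 0 ∧ e 1 i = startRemainder V h τ i + startDefect α a V Z N h τ i) :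
    weightedEnergy θ τ (energyWeight a h N) (stiffness α h N) (interiorVec N (e 1))
      (interiorVec N (e 0)) ≤
      (xr / a₀ * (K + a₁ * K * T) ^ 2 + 2 * (2 * xr * K ^ 2 * T +
        4 * (kappa α * phiCoeff α 1) * xr * xr ^ (4 - α) * (a₁ * K) ^ 2)) *
        (τ ^ 2 + h ^ 2) ^ 2 := by
  have hM := stiffness_posSemidef hα1 hα2 hh hN1
  have ha' : ∀ x ∈ Ioo 0 xr, 0 ≤ a x ∧ a x ≤ a₁ := fun x hx =>
    ⟨ha₀.le.trans (ha x hx).1, (ha x hx).2⟩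
  set r := interiorVec N (startRemainder V h τ) with hr
  set q := interiorVec N (startDefect α a V Z N h τ) with hq
  have e0 : interiorVec N (e 0) = 0 := by
    ext j
    have hj := j.2
    exact (he (j + 1) (by omega) (by omega)).1
  have e1 : interiorVec N (e 1) = r + q := by
    ext j
    have hj := j.2
    exact (he (j + 1) (by omega) (by omega)).2
  have hquad : (r + q) ⬝ᵥ (stiffness α h N *ᵥ (r + q)) ≤
      2 * (r ⬝ᵥ (stiffness α h N *ᵥ r) + q ⬝ᵥ (stiffness α h N *ᵥ q)) := by
    have := quadraticForm_nonneg hM (r - q)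
    simp only [mulVec_add, mulVec_sub, dotProduct_add, dotProduct_sub, add_dotProduct,
      sub_dotProduct] at this ⊢
    linarith
  have b1 := dotProduct_stiffness_startRemainder_le hV hT hK hh hτ hτT hN
  have b2 := dotProduct_stiffness_startDefect_le (τ := τ) hα1 hα2 hV hT ha' hh hN hN1
  have b3 : ∑ j, energyWeight a h N j * (((r + q) j - (0 : Fin (N - 1) → ℝ) j) / τ) ^ 2 ≤
      xr / a₀ * ((K + a₁ * K * T) * (τ ^ 2 + h ^ 2)) ^ 2 := by
    refine sum_energyWeight_mul_sq_le ha₀ (fun x hx => (ha x hx).1) hh hN fun j => ?_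
    have hj := j.2
    have c1 := abs_startRemainder_le hV hh hτ hτT hN (i := j + 1) (by omega)
    have c2 := abs_startDefect_le (τ := τ) hV hT ha' hh hN (i := j + 1) (by omega) (by omega)
    rw [Pi.zero_apply, sub_zero, abs_div, abs_of_pos hτ, div_le_iff₀ hτ]
    have c3 : a₁ * K * τ ^ 2 * h ^ 2 ≤ a₁ * K * T * h ^ 2 * τ := by
      have : 0 ≤ a₁ * K * τ * h ^ 2 * (T - τ) := by
        have : 0 ≤ T - τ := by linarith
        positivity
      nlinarith
    have c4 : 0 ≤ K * h ^ 2 * τ := by positivity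
    have c5 : 0 ≤ a₁ * K * T * τ ^ 2 * τ := by positivity
    calc _ ≤ K * τ ^ 3 + a₁ * K * τ ^ 2 * h ^ 2 := (abs_add_le _ _).trans (add_le_add c1 c2)
      _ ≤ _ := by nlinarith
  have hQ := quadraticForm_nonneg hM (r + q)
  have hκ : 0 ≤ kappa α * phiCoeff α 1 := by
    rw [phiCoeff_one]
    have h1 := kappa_neg hα1 hα2
    have : 0 ≤ (α - 1) * (α + 2) / 2 := by
      have : 0 ≤ α - 1 := by linarith
      positivity
    nlinarith
  have hxr : 0 ≤ xr := by rw [hN]; positivity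
  have hτ4 : τ ^ 4 ≤ (τ ^ 2 + h ^ 2) ^ 2 := by nlinarith [sq_nonneg h, sq_nonneg τ, sq_nonneg (h * τ)]
  set D := 2 * xr * K ^ 2 * T +
        4 * (kappa α * phiCoeff α 1) * xr * xr ^ (4 - α) * (a₁ * K) ^ 2 with hD
  have hD0 : 0 ≤ D := by positivity
  have b4 : (r + q) ⬝ᵥ (stiffness α h N *ᵥ (r + q)) ≤ 2 * (D * (τ ^ 2 + h ^ 2) ^ 2) := by
    refine hquad.trans ?_
    have := mul_le_mul_of_nonneg_left hτ4 hD0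
    rw [hD] at this ⊢
    linarith
  -- Since the initial error is zero, the two quadratic terms merge into `θ` times the form at the
  -- first error, and `θ ≤ 1` makes the bound uniform.
  rw [e0, e1, weightedEnergy, add_zero, sub_zero]
  have b5 : θ * ((r + q) ⬝ᵥ (stiffness α h N *ᵥ (r + q))) ≤
      (r + q) ⬝ᵥ (stiffness α h N *ᵥ (r + q)) := mul_le_of_le_one_left hQ hθ
  rw [mul_pow] at b3
  linarith

end StartEnergy

end RieszWave

/-! ### Assembly of the error estimate -/

theorem theorem3p1 (α xr T a₀ a₁ : ℝ) (hα : 1 < α) (hα2 : α ≤ 2) (hxr : 0 < xr) (hT : 0 < T)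
    (a : ℝ → ℝ) (ha₀ : 0 < a₀) (ha : ∀ x ∈ Set.Ioo 0 xr, a₀ ≤ a x ∧ a x ≤ a₁)
    (f : ℝ → ℝ → ℝ) (φ ψ : ℝ → ℝ) (u : ℝ → ℝ → ℝ)
    (hu : RieszWave.IsSolution α xr T a f φ ψ u) :
    ∃ C : ℝ, ∀ θ : ℝ, 1 / 4 ≤ θ → θ ≤ 1 → ∀ Nx Nt : ℕ, 1 ≤ Nx → 1 ≤ Nt → ∀ h τ : ℝ,
      h = xr / Nx → τ = T / Nt →
      (∃ Λ, RieszWave.IsLambda α h Nx Λ) ∧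
      ∀ Λ, RieszWave.IsLambda α h Nx Λ →
        ∀ U : ℕ → ℕ → ℝ, RieszWave.IsScheme α θ a f φ ψ Nx Nt h τ U →
          ∀ k < Nt,
            RieszWave.energy θ a h τ Nx Λ (fun k i => u (i * h) (k * τ) - U k i) k ≤
              C * (τ ^ 2 + h ^ 2) ^ 2 := by
  open RieszWave in
  obtain ⟨V, K, Z, hK, hV, hVu⟩ := exists_isConsistent hα hα2 hxr hT hu
  have ha₁ : 0 ≤ a₁ := by
    have := ha (xr / 2) ⟨by linarith, by linarith⟩
    linarith [this.1, this.2]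
  have ha' : ∀ x ∈ Set.Ioo 0 xr, 0 ≤ a x ∧ a x ≤ a₁ := fun x hx =>
    ⟨ha₀.le.trans (ha x hx).1, (ha x hx).2⟩
  set C₀ := xr / a₀ * (K + a₁ * K * T) ^ 2 + 2 * (2 * xr * K ^ 2 * T +
        4 * (kappa α * phiCoeff α 1) * xr * xr ^ (4 - α) * (a₁ * K) ^ 2) with hC₀
  set G₀ := √(xr / a₀) * (2 * K * (1 + a₁)) with hG₀
  have hG₀' : 0 ≤ G₀ := by positivity
  -- `C₀` bounds the starting energy, `G₀` the weighted norm of the truncation error accumulated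
  -- over a time at most `T`, and `a₁` is the price of returning from the weighted energy.
  refine ⟨a₁ * (√C₀ + T * G₀) ^ 2, fun θ hθ0 hθ Nx Nt hNx hNt h τ hh' hτ' => ?_⟩
  have hNx0 : (0 : ℝ) < Nx := by exact_mod_cast hNx
  have hNt0 : (0 : ℝ) < Nt := by exact_mod_cast hNt
  have hh : 0 < h := by rw [hh']; positivity
  have hτ : 0 < τ := by rw [hτ']; positivity
  have hN : xr = Nx * h := by rw [hh']; field_simp
  have hTN : T = Nt * τ := by rw [hτ']; field_simp
  have hτT : τ ≤ T := by
    rw [hTN]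
    have : (1 : ℝ) ≤ Nt := by exact_mod_cast hNt
    nlinarith
  refine ⟨exists_isLambda hα hα2 hh Nx hNx, fun Λ hΛ U hU k hk => ?_⟩
  set e : ℕ → ℕ → ℝ := fun k i => u (i * h) (k * τ) - U k i with he_def
  have he : ∀ k, ∀ i ≤ Nx, e k i = V 0 (i * h) (k * τ) - U k i := fun k i hi => by
    rw [he_def, hVu _ (grid_mem_Icc hh hN hi)]
  have hbd : ∀ k ≤ Nt, e k 0 = 0 ∧ e k Nx = 0 := fun k hk => by
    have hd := hV.dirichlet _ (grid_mem_Icc hτ hTN hk)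
    rw [he k 0 (Nat.zero_le _), he k Nx le_rfl, (hU.boundary k hk).1, (hU.boundary k hk).2, ← hN]
    simp [hd]
  have hM := stiffness_posSemidef hα hα2 hh hNx (N := Nx)
  have hx : ∀ j : Fin (Nx - 1), (((j : ℕ) + 1 : ℕ) : ℝ) * h ∈ Set.Ioo 0 xr := fun j =>
    grid_mem_Ioo hh hN (by omega) (by have := j.2; omega)
  have hb : ∀ j, 0 ≤ energyWeight a h Nx j := fun j =>
    div_nonneg hh.le (ha' _ (hx j)).1
  set S := τ ^ 2 + h ^ 2 with hS
  have hS0 : 0 ≤ S := by positivity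
  have hstab := sqrt_weightedEnergy_le_add (θ := θ) (G := G₀ * S) hM hb hθ0 hτ (by positivity) Nt
    (fun k => interiorVec Nx (e k))
    (fun k (j : Fin (Nx - 1)) => truncation α θ a V Z Nx h τ (j + 1) (k * τ))
    (fun m hm hmN j => by
      have hj := j.2
      have haj := ha _ (hx j)
      have heq := error_equation hV hh hN hτ hTN hU he hm hmN (i := j + 1) (by omega) (by omega)
      obtain ⟨p0, p1⟩ := hbd (m + 1) (by omega)
      obtain ⟨q0, q1⟩ := hbd m (by omega)
      obtain ⟨s0, s1⟩ := hbd (m - 1) (by omega)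
      rw [stiffness_mulVec _ p0 p1, stiffness_mulVec _ q0 q1, stiffness_mulVec _ s0 s1]
      simp only [interiorVec]
      rw [heq, energyWeight]
      have hne : a ((((j : ℕ) + 1 : ℕ) : ℝ) * h) ≠ 0 := by linarith [haj.1]
      generalize a ((((j : ℕ) + 1 : ℕ) : ℝ) * h) = A at hne ⊢
      field_simp
      ring)
    (fun m hm hmN => by
      have := sum_energyWeight_mul_sq_le ha₀ (fun x hx => (ha x hx).1) hh hN
        (R := fun j : Fin (Nx - 1) => truncation α θ a V Z Nx h τ (j + 1) (m * τ))
        (B := 2 * K * (1 + a₁) * S) (fun j => by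
          have hj := j.2
          have t1 := grid_mem_Icc hτ hTN (k := m) hmN.le
          have t2 := grid_mem_Icc hτ hTN (k := m + 1) hmN
          have t3 := grid_mem_Icc hτ hTN (k := m - 1) (by omega)
          rw [show ((m + 1 : ℕ) : ℝ) * τ = m * τ + τ by push_cast; ring] at t2
          rw [show ((m - 1 : ℕ) : ℝ) * τ = m * τ - τ by rw [Nat.cast_sub hm]; push_cast; ring] at t3
          exact abs_truncation_le hV hK ha' hh hτ hN (by omega) (by omega) (by linarith) hθ
            t1 t2 t3)
      refine this.trans (le_of_eq ?_)
      rw [hG₀]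
      simp only [mul_pow]
      rw [Real.sq_sqrt (by positivity)]
      ring) k hk
  have hstart := weightedEnergy_start_le (θ := θ) hα hα2 hV hT hK ha₀ ha ha₁ hh hτ hτT hN hNx hθ
    (e := e) (fun i h1 h2 => error_start hV hT hh hN hU he h1 h2)
  rw [← hC₀, ← hS] at hstart
  have hsq : √(weightedEnergy θ τ (energyWeight a h Nx) (stiffness α h Nx)
      (interiorVec Nx (e 1)) (interiorVec Nx (e 0))) ≤ √C₀ * S := by
    refine (Real.sqrt_le_sqrt hstart).trans (le_of_eq ?_)
    rw [Real.sqrt_mul' _ (sq_nonneg S), Real.sqrt_sq hS0]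
  have hkτ : (k : ℝ) * τ ≤ T := (grid_mem_Icc hτ hTN hk.le).2
  have hfin : √(weightedEnergy θ τ (energyWeight a h Nx) (stiffness α h Nx)
      (interiorVec Nx (e (k + 1))) (interiorVec Nx (e k))) ≤ (√C₀ + T * G₀) * S := by
    have : (k : ℝ) * τ * (G₀ * S) ≤ T * (G₀ * S) :=
      mul_le_mul_of_nonneg_right hkτ (by positivity)
    linarith
  have hE := weightedEnergy_nonneg (τ := τ) hM hb hθ0 (interiorVec Nx (e (k + 1)))
    (interiorVec Nx (e k))
  refine (energy_le_weightedEnergy hΛ hh hθ0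
    (fun j => ⟨by linarith [(ha _ (hx j)).1], (ha _ (hx j)).2⟩) e k).trans ?_
  rw [mul_assoc, ← mul_pow]
  refine mul_le_mul_of_nonneg_left ?_ ha₁
  exact (Real.sqrt_le_left (by positivity)).1 hfin
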